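/- **Setting.** Let $b\in(0,\infty]$ and let $q$ be a real-valued potential on $(0,b)$ together with a boundary condition at $b$, of one of the following kinds. 1. $b<\infty$, $q\in L^1((0,b))$, with the boundary condition $u'(b_-)+hu(b_-)=0$ for some $h\in\mathbb R$, or $u(b_-)=0$ ($h=\infty$). 2. $b=\infty$, $q\in L^1((0,R))$ for all $R<\infty$, and either $\sup_{x>0}\int_x^{x+1}\max(-q(y),0)\,dy<\infty$, or $-\frac{d^2}{dx^2}+q$ is limit point at infinity (for each $z$ with $\operatorname{Im}z>0$, $-u''+qu=zu$ has, up to constant multiples, exactly one nonzero solution that is $L^2$ at infinity). The boundary condition is that $u$ is $L^2$ at infinity. 3. $b=\infty$, $q\in L^1((0,R))$ for all $R<\infty$, and $-\frac{d^2}{dx^2}+q$ is limit circle at infinity (for each $z$ with $\operatorname{Im}z>0$, all solutions of $-u''+qu=zu$ are $L^2$ at infinity). The boundary condition is $\lim_{x\to\infty}[u_0(x)u'(x)-u_0'(x)u(x)]=0$, where $u_0\ne0$ is a fixed solution of $-u_0''+qu_0=iu_0$ with $\lim_{x\to\infty}\operatorname{Im}(\overline{u_0(x)}\,u_0'(x))=0$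 (so that the condition is self-adjoint). Solutions are functions $u$ with $u,u'$ locally absolutely continuous that satisfy the equation almost everywhere. For $z\in\mathbb C\setminus\mathbb R$ the Weyl–Titchmarsh function is $m(z)=u'(0_+)/u(0_+)$, where $u$ is any nonzero solution of $-u''+qu=zu$ satisfying the boundary condition at $b$. **Theorem.** Let $q_1,q_2$ be two such potentials, on $(0,b_1)$ and $(0,b_2)$, with boundary conditions as above and Weyl–Titchmarsh functions $m_1,m_2$. Let $a\ge0$ and $\delta>0$ be real with $a+\delta\le\min(b_1,b_2)$, suppose that $q_1=q_2$ a.e. on $[0,a]$, and put $$\eta=\max_{j=1,2}\ \sup_{0\le x\le a}\int_x^{x+\delta}|q_j(y)|\,dy .$$ (i) For every $\varepsilon>0$ there are a constant $C$, depending only on $\varepsilon$, $\delta$ and (an upper bound for) $\eta$, and a number $K_0$, depending only on these and on $a$, such that $$|m_1(-\kappa^2)-m_2(-\kappa^2)|\le C\exp(-2a\operatorname{Re}\kappa)$$ for all $\kappa\in\mathbb C$ with $-\frac\pi2+\varepsilon<\arg\kappa<-\varepsilon$ and $|\kappa|\ge K_0$. (ii) For all $\kappa\in\mathbb C$ with $\operatorname{Re}\kappa\ge\max(4\eta,\delta^{-1}\ln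 6)$ and $\operatorname{Im}\kappa\ne0$, $$|m_1(-\kappa^2)-m_2(-\kappa^2)|\le 2F(\kappa)\exp\bigl(-2a[\operatorname{Re}\kappa-F(\kappa)]\bigr),\qquad F(\kappa)=2\eta+\frac{864}{5}\,\frac{|\kappa|^2}{|\operatorname{Im}\kappa|}\,e^{-2\delta\operatorname{Re}\kappa}.$$ In both parts $m_1(-\kappa^2)$ and $m_2(-\kappa^2)$ exist: solutions $u$ as above exist, have $u(0_+)\ne0$, and the quotient $u'(0_+)/u(0_+)$ does not depend on the choice of $u$. -/

import Mathlib

open MeasureTheory Filter Topology Set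

noncomputable section

namespace Schrodinger

/-- `u` solves `-u'' + q u = z u` on the interval `I` (which contains its left endpoint `0`), with
derivative `u'`: `u` is differentiable on `I` with derivative `u'` (one-sided at endpoints), `u'` is
absolutely continuous on every compact interval `[0, c] ⊆ I`, and the equation holds almost
everywhere. At the endpoints belonging to `I` the potential is integrable, so `u` and `u'` are
given there by their limits. -/
structure IsSolution (q : ℝ → ℝ) (z : ℂ) (I : Set ℝ) (u u' : ℝ → ℂ) : Prop where
  hasDeriv : ∀ x ∈ I, HasDerivWithinAt u (u' x) I x
  absCont : ∀ c ∈ I, AbsolutelyContinuousOnInterval u' 0 c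
  equation : ∀ᵐ x ∂(volume.restrict I), HasDerivAt u' (((q x : ℂ) - z) * u x) x

/-- `u` does not vanish identically on `I`. -/
def IsNonzeroOn (I : Set ℝ) (u : ℝ → ℂ) : Prop := ∃ x ∈ I, u x ≠ 0

/-- `u` is square integrable near infinity. -/
def IsL2AtInfinity (u : ℝ → ℂ) : Prop :=
  ∃ R : ℝ, 0 ≤ R ∧ IntegrableOn (fun x => ‖u x‖ ^ 2) (Ioi R)

/-- `q` is integrable on `(0, R)` for all finite `R`. -/
def LocallyIntegrableHalfLine (q : ℝ → ℝ) : Prop := ∀ R : ℝ, 0 < R → IntegrableOn q (Ioo 0 R)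

/-- `sup_{x > 0} ∫_x^{x+1} max(-q, 0) < ∞`. -/
def EssentiallyBoundedBelow (q : ℝ → ℝ) : Prop :=
  ∃ M : ℝ, ∀ x : ℝ, 0 < x → ∫ y in x..(x + 1), max (-q y) 0 ≤ M

/-- Limit point at infinity: for all `z` in the open upper half-plane there is, up to a
multiplicative constant, exactly one solution that is square integrable at infinity. -/
def IsLimitPoint (q : ℝ → ℝ) : Prop :=
  ∀ z : ℂ, 0 < z.im → ∃ u u' : ℝ → ℂ, IsSolution q z (Ici 0) u u' ∧ IsNonzeroOn (Ici 0) u ∧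
    IsL2AtInfinity u ∧
    ∀ v v' : ℝ → ℂ, IsSolution q z (Ici 0) v v' → IsL2AtInfinity v →
      ∃ c : ℂ, ∀ x ∈ Ici (0 : ℝ), v x = c * u x

/-- Limit circle at infinity: for all `z` in the open upper half-plane every solution is square
integrable at infinity. -/
def IsLimitCircle (q : ℝ → ℝ) : Prop :=
  ∀ z : ℂ, 0 < z.im → ∀ u u' : ℝ → ℂ, IsSolution q z (Ici 0) u u' → IsL2AtInfinity u

/-- The right endpoint `b` together with the boundary condition there.
* `regular b h`: `b < ∞`, with the condition `u'(b) + h u(b) = 0` for `h ∈ ℝ`, and `u(b) = 0` for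
  `h = ∞`;
* `squareIntegrable`: `b = ∞`, with square integrability as the only condition;
* `limitCircle u₀ u₀'`: `b = ∞`, with the condition `u₀ u' - u₀' u → 0` at infinity. -/
inductive Endpoint where
  | regular (b : ℝ) (h : OnePoint ℝ)
  | squareIntegrable
  | limitCircle (u₀ u₀' : ℝ → ℂ)

/-- The number `b ∈ (0, ∞]`. -/
def Endpoint.right : Endpoint → EReal
  | .regular b _ => (b : EReal)
  | .squareIntegrable => ⊤
  | .limitCircle _ _ => ⊤

/-- The interval `(0, b)` together with its regular endpoints. -/
def Endpoint.interval : Endpoint → Set ℝ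
  | .regular b _ => Icc 0 b
  | .squareIntegrable => Ici 0
  | .limitCircle _ _ => Ici 0

/-- The potentials considered for each kind of right endpoint. In the limit circle case the
boundary condition is given by a nonzero solution `u₀` for `z = i`; it is a self-adjoint one, i.e.
the Wronskian of `conj u₀` and `u₀`, which is `2 i Im (conj u₀ * u₀')`, tends to `0`. -/
def Endpoint.Admissible (q : ℝ → ℝ) : Endpoint → Prop
  | .regular b _ => 0 < b ∧ IntegrableOn q (Ioo 0 b)
  | .squareIntegrable =>
      LocallyIntegrableHalfLine q ∧ (EssentiallyBoundedBelow q ∨ IsLimitPoint q)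
  | .limitCircle u₀ u₀' =>
      LocallyIntegrableHalfLine q ∧ IsLimitCircle q ∧
        IsSolution q Complex.I (Ici 0) u₀ u₀' ∧ IsNonzeroOn (Ici 0) u₀ ∧
        Tendsto (fun x => ((starRingEnd ℂ) (u₀ x) * u₀' x).im) atTop (𝓝 0)

/-- The boundary condition at `b`. -/
def Endpoint.Satisfies : Endpoint → (ℝ → ℂ) → (ℝ → ℂ) → Prop
  | .regular b (some h), u, u' => u' b + (h : ℂ) * u b = 0
  | .regular b none, u, _ => u b = 0
  | .squareIntegrable, u, _ => IsL2AtInfinity u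
  | .limitCircle u₀ u₀', u, u' => Tendsto (fun x => u₀ x * u' x - u₀' x * u x) atTop (𝓝 0)

/-- A nonzero solution for the spectral parameter `z` satisfying the boundary condition at `b`. -/
def IsWeylSolution (q : ℝ → ℝ) (e : Endpoint) (z : ℂ) (u u' : ℝ → ℂ) : Prop :=
  IsSolution q z e.interval u u' ∧ IsNonzeroOn e.interval u ∧ e.Satisfies u u'

/-- `m` is the value `m(z)` of the Weyl-Titchmarsh function: there are nonzero solutions satisfying
the boundary condition at `b`, and all of them have `u(0) ≠ 0` and `u'(0) / u(0) = m`. -/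
def IsWeylM (q : ℝ → ℝ) (e : Endpoint) (z m : ℂ) : Prop :=
  (∃ u u' : ℝ → ℂ, IsWeylSolution q e z u u') ∧
    ∀ u u' : ℝ → ℂ, IsWeylSolution q e z u u' → u 0 ≠ 0 ∧ u' 0 / u 0 = m

/-- `sup_{0 ≤ x ≤ a} ∫_x^{x+δ} |q(y)| dy`. -/
def localL1Sup (a δ : ℝ) (q : ℝ → ℝ) : ℝ :=
  sSup ((fun x => ∫ y in x..(x + δ), |q y|) '' Icc 0 a)

/-- `F(κ) = 2 η + (864/5) (|κ|² / |Im κ|) exp(-2 δ Re κ)`. -/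
def boundF (η δ : ℝ) (κ : ℂ) : ℝ :=
  2 * η + 864 / 5 * (‖κ‖ ^ 2 / |κ.im|) * Real.exp (-2 * δ * κ.re)

end Schrodinger

end

/-!
If `ψ` is a Weyl solution for `z = -κ²`, then `ψ'/ψ` stays in the half-plane determined by the sign
of `Im z`. On an interval `(x, x + δ)` on which `q` is small compared with `Re κ`, the solution
operator maps this half-plane into a small disc: the solution with data `1, -κ` at `x + δ` and the
sine-type solution at `x` are perturbations of exponentials, and give
`ψ'(x)/ψ(x) = -κ + O(∫ exp(-2 Re κ (y - x)) |q y| dy) + O(|κ|² / |Im κ| exp(-2 δ Re κ))`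
whatever the boundary condition at `b`. If the two potentials agree on `[0, a]`, the Wronskian of
`ψ₁` and `ψ₂` is constant there, so that
`m₁ - m₂ = (ψ₁'(a)/ψ₁(a) - ψ₂'(a)/ψ₂(a)) exp (∫₀ᵃ (ψ₁'/ψ₁ + ψ₂'/ψ₂))`,
and the exponential is about `exp(-2 a κ)`. Bounding the error integral over `[0, a]` pointwise
gives part (ii); exchanging the integrations over `x` and `y` gains the factor `1 / Re κ` that makes
the constant in part (i) independent of `a`.
-/

noncomputable section

namespace Schrodinger

open scoped ComplexConjugate

/-! ### Absolutely continuous functions as indefinite integrals -/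

theorem absolutelyContinuousOnInterval_of_dist_le {X Y : Type*} [PseudoMetricSpace X]
    [PseudoMetricSpace Y] {f : ℝ → X} {g : ℝ → Y} {a b : ℝ}
    (hg : AbsolutelyContinuousOnInterval g a b)
    (hfg : ∀ x ∈ uIcc a b, ∀ y ∈ uIcc a b, dist (f x) (f y) ≤ dist (g x) (g y)) :
    AbsolutelyContinuousOnInterval f a b := by
  rw [absolutelyContinuousOnInterval_iff] at hg ⊢
  intro ε hε
  obtain ⟨δ, hδ, hgδ⟩ := hg ε hε
  refine ⟨δ, hδ, fun E hE hlength => ?_⟩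
  refine (Finset.sum_le_sum fun i hi => ?_).trans_lt (hgδ E hE hlength)
  exact hfg _ (hE.1 i hi).1 _ (hE.1 i hi).2

/-- `f` is the indefinite integral of the integrable function `f'` on the interval between `a`
and `b`. This is absolute continuity together with a choice of derivative, in the form in which
the calculus of absolutely continuous functions is used for differential equations. -/
structure IsPrimitiveOn {E : Type*} [NormedAddCommGroup E] [NormedSpace ℝ E] (f f' : ℝ → E)
    (a b : ℝ) : Prop where
  intervalIntegrable : IntervalIntegrable f' volume a b
  eq_add_integral : ∀ x ∈ uIcc a b, f x = f a + ∫ t in a..x, f' t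

namespace IsPrimitiveOn

variable {E F : Type*} [NormedAddCommGroup E] [NormedSpace ℝ E] [NormedAddCommGroup F]
  [NormedSpace ℝ F] {f f' g g' : ℝ → E} {a b c d : ℝ}

theorem intervalIntegrable_of_mem (hf : IsPrimitiveOn f f' a b) (hc : c ∈ uIcc a b)
    (hd : d ∈ uIcc a b) : IntervalIntegrable f' volume c d :=
  hf.intervalIntegrable.mono_set (uIcc_subset_uIcc hc hd)

theorem integral_eq_sub (hf : IsPrimitiveOn f f' a b) (hc : c ∈ uIcc a b) (hd : d ∈ uIcc a b) :
    ∫ t in c..d, f' t = f d - f c := by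
  rw [hf.eq_add_integral c hc, hf.eq_add_integral d hd, add_sub_add_left_eq_sub,
    intervalIntegral.integral_interval_sub_left (hf.intervalIntegrable_of_mem left_mem_uIcc hd)
      (hf.intervalIntegrable_of_mem left_mem_uIcc hc)]

theorem mono (hf : IsPrimitiveOn f f' a b) (hc : c ∈ uIcc a b) (hd : d ∈ uIcc a b) :
    IsPrimitiveOn f f' c d :=
  ⟨hf.intervalIntegrable_of_mem hc hd, fun x hx => by
    rw [hf.integral_eq_sub hc (uIcc_subset_uIcc hc hd hx), add_sub_cancel]⟩

theorem congr_ae (hf : IsPrimitiveOn f f' a b) (hg : ∀ x ∈ uIcc a b, g x = f x)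
    (hg' : ∀ᵐ x, x ∈ uIoc a b → f' x = g' x) : IsPrimitiveOn g g' a b where
  intervalIntegrable := hf.intervalIntegrable.congr_ae
    ((ae_restrict_iff' measurableSet_uIoc).2 hg')
  eq_add_integral x hx := by
    rw [hg x hx, hg a left_mem_uIcc, hf.eq_add_integral x hx]
    congr 1
    refine intervalIntegral.integral_congr_ae (hg'.mono fun t ht htx => ht ?_)
    exact uIoc_subset_uIoc_of_uIcc_subset_uIcc (uIcc_subset_uIcc left_mem_uIcc hx) htx

theorem congr (hf : IsPrimitiveOn f f' a b) (hg : ∀ x ∈ uIcc a b, g x = f x)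
    (hg' : ∀ x ∈ uIcc a b, f' x = g' x) : IsPrimitiveOn g g' a b :=
  hf.congr_ae hg (Eventually.of_forall fun x hx => hg' x (uIoc_subset_uIcc hx))

theorem congr_deriv (hf : IsPrimitiveOn f f' a b) (hg' : ∀ x, f' x = g' x) :
    IsPrimitiveOn f g' a b :=
  hf.congr (fun _ _ => rfl) fun x _ => hg' x

theorem comp_add_left (s : ℝ) (hf : IsPrimitiveOn f f' (s + a) (s + b)) :
    IsPrimitiveOn (fun x => f (s + x)) (fun x => f' (s + x)) a b where
  intervalIntegrable := by simpa using hf.intervalIntegrable.comp_add_left s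
  eq_add_integral x hx := by
    rw [intervalIntegral.integral_comp_add_left, hf.eq_add_integral (s + x)]
    exact image_const_add_uIcc s a b ▸ mem_image_of_mem _ hx

theorem absolutelyContinuousOnInterval (hf : IsPrimitiveOn f f' a b) :
    AbsolutelyContinuousOnInterval f a b := by
  have hnorm := hf.intervalIntegrable.norm
  refine absolutelyContinuousOnInterval_of_dist_le
    (hnorm.absolutelyContinuousOnInterval_intervalIntegral left_mem_uIcc) fun x hx y hy => ?_
  have hsub : ∀ {c}, c ∈ uIcc a b → IntervalIntegrable (fun t => ‖f' t‖) volume a c := fun hc =>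
    hnorm.mono_set (uIcc_subset_uIcc left_mem_uIcc hc)
  rw [dist_eq_norm, dist_eq_norm, ← hf.integral_eq_sub hy hx,
    intervalIntegral.integral_interval_sub_left (hsub hx) (hsub hy)]
  exact intervalIntegral.norm_integral_le_abs_integral_norm

theorem continuousOn (hf : IsPrimitiveOn f f' a b) : ContinuousOn f (uIcc a b) :=
  hf.absolutelyContinuousOnInterval.continuousOn

theorem add (hf : IsPrimitiveOn f f' a b) (hg : IsPrimitiveOn g g' a b) :
    IsPrimitiveOn (fun x => f x + g x) (fun x => f' x + g' x) a b where
  intervalIntegrable := hf.intervalIntegrable.add hg.intervalIntegrable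
  eq_add_integral x hx := by
    rw [intervalIntegral.integral_add (hf.intervalIntegrable_of_mem left_mem_uIcc hx)
      (hg.intervalIntegrable_of_mem left_mem_uIcc hx), hf.eq_add_integral x hx,
      hg.eq_add_integral x hx, add_add_add_comm]

variable [CompleteSpace E]

theorem clm_comp [CompleteSpace F] (L : E →L[ℝ] F) (hf : IsPrimitiveOn f f' a b) :
    IsPrimitiveOn (fun x => L (f x)) (fun x => L (f' x)) a b where
  intervalIntegrable := ⟨L.integrable_comp hf.intervalIntegrable.1,
    L.integrable_comp hf.intervalIntegrable.2⟩
  eq_add_integral x hx := by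
    rw [hf.eq_add_integral x hx, map_add,
      L.intervalIntegral_comp_comm (hf.intervalIntegrable_of_mem left_mem_uIcc hx)]

theorem sub (hf : IsPrimitiveOn f f' a b) (hg : IsPrimitiveOn g g' a b) :
    IsPrimitiveOn (fun x => f x - g x) (fun x => f' x - g' x) a b := by
  simpa [sub_eq_add_neg] using hf.add (hg.clm_comp (-ContinuousLinearMap.id ℝ E))

theorem ae_hasDerivAt (hf : IsPrimitiveOn f f' a b) :
    ∀ᵐ x, x ∈ uIoc a b → HasDerivAt f (f' x) x := by
  have hne_max : ∀ᵐ x : ℝ, x ≠ max a b := by simp [ae_iff, measure_singleton]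
  filter_upwards [hf.intervalIntegrable.ae_hasDerivAt_integral, hne_max] with x hx hxb hxI
  have hmem : uIcc a b ∈ 𝓝 x := Icc_mem_nhds hxI.1 (lt_of_le_of_ne hxI.2 hxb)
  refine ((hx (uIoc_subset_uIcc hxI) a left_mem_uIcc).const_add (f a)).congr_of_eventuallyEq ?_
  filter_upwards [hmem] with y hy using hf.eq_add_integral y hy

theorem of_absolutelyContinuousOnInterval (hf : AbsolutelyContinuousOnInterval f a b)
    (hf' : IntervalIntegrable f' volume a b)
    (hderiv : ∀ᵐ x, x ∈ uIoc a b → HasDerivAt f (f' x) x) : IsPrimitiveOn f f' a b := by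
  have hprimitive : IsPrimitiveOn (fun x => ∫ t in a..x, f' t) f' a b := ⟨hf', by simp⟩
  have hne_min : ∀ᵐ x : ℝ, x ≠ min a b := by simp [ae_iff, measure_singleton]
  obtain ⟨C, hC⟩ :=
    (hf.sub hprimitive.absolutelyContinuousOnInterval).const_of_ae_hasDerivAt_zero (by
      filter_upwards [hderiv, hprimitive.ae_hasDerivAt, hne_min] with x hfx hpx hxa hx
      have hxI : x ∈ uIoc a b := ⟨lt_of_le_of_ne hx.1 hxa.symm, hx.2⟩
      simpa using (hfx hxI).sub (hpx hxI))
  refine ⟨hf', fun x hx => ?_⟩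
  have hxa := (hC x hx).trans (hC a left_mem_uIcc).symm
  simpa [sub_eq_iff_eq_add, add_comm] using hxa

theorem of_hasDerivAt (hf : ∀ x, HasDerivAt f (f' x) x) (hf' : Continuous f') (a b : ℝ) :
    IsPrimitiveOn f f' a b where
  intervalIntegrable := hf'.intervalIntegrable a b
  eq_add_integral x _ := by
    rw [intervalIntegral.integral_eq_sub_of_hasDerivAt (fun t _ => hf t)
      (hf'.intervalIntegrable a x), add_sub_cancel]

theorem mul {A : Type*} [NormedDivisionRing A] [NormedAlgebra ℝ A] [CompleteSpace A]
    {f f' g g' : ℝ → A} (hf : IsPrimitiveOn f f' a b) (hg : IsPrimitiveOn g g' a b) :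
    IsPrimitiveOn (fun x => f x * g x) (fun x => f' x * g x + f x * g' x) a b := by
  refine of_absolutelyContinuousOnInterval
    (hf.absolutelyContinuousOnInterval.smul hg.absolutelyContinuousOnInterval) ?_ ?_
  · exact (hf.intervalIntegrable.mul_continuousOn hg.continuousOn).add
      (hg.intervalIntegrable.continuousOn_mul hf.continuousOn)
  · filter_upwards [hf.ae_hasDerivAt, hg.ae_hasDerivAt] with x hfx hgx hx
    exact (hfx hx).mul (hgx hx)

theorem const_mul {f f' : ℝ → ℂ} (c : ℂ) (hf : IsPrimitiveOn f f' a b) :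
    IsPrimitiveOn (fun x => c * f x) (fun x => c * f' x) a b :=
  hf.clm_comp (ContinuousLinearMap.mul ℝ ℂ c)

theorem star {f f' : ℝ → ℂ} (hf : IsPrimitiveOn f f' a b) :
    IsPrimitiveOn (fun x => conj (f x)) (fun x => conj (f' x)) a b :=
  hf.clm_comp Complex.conjCLE.toContinuousLinearMap

end IsPrimitiveOn

/-! ### Solutions in integrated form -/

/-- `u` solves `-u'' + q u = z u` on the interval between `a` and `b`, with derivative `u'`, in
integrated form. -/
structure SolvesOn (q : ℝ → ℝ) (z : ℂ) (a b : ℝ) (u u' : ℝ → ℂ) : Prop where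
  isPrimitiveOn : IsPrimitiveOn u u' a b
  isPrimitiveOn_deriv : IsPrimitiveOn u' (fun x => ((q x : ℂ) - z) * u x) a b

namespace SolvesOn

variable {q q₁ q₂ : ℝ → ℝ} {z z₁ z₂ : ℂ} {a b c d x : ℝ} {u u' v v' : ℝ → ℂ}

theorem mono (h : SolvesOn q z a b u u') (hc : c ∈ uIcc a b) (hd : d ∈ uIcc a b) :
    SolvesOn q z c d u u' :=
  ⟨h.isPrimitiveOn.mono hc hd, h.isPrimitiveOn_deriv.mono hc hd⟩

theorem comp_add_left (s : ℝ) (h : SolvesOn q z (s + a) (s + b) u u') :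
    SolvesOn (fun x => q (s + x)) z a b (fun x => u (s + x)) (fun x => u' (s + x)) :=
  ⟨h.isPrimitiveOn.comp_add_left s, h.isPrimitiveOn_deriv.comp_add_left s⟩

theorem congr_potential (h : SolvesOn q₁ z a b u u') (hq : ∀ᵐ x, x ∈ uIoc a b → q₁ x = q₂ x) :
    SolvesOn q₂ z a b u u' :=
  ⟨h.isPrimitiveOn, h.isPrimitiveOn_deriv.congr_ae (fun _ _ => rfl)
    (hq.mono fun x hx hxI => by rw [hx hxI])⟩

theorem congr (h : SolvesOn q z a b u u') (hu : ∀ x ∈ uIcc a b, v x = u x)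
    (hu' : ∀ x ∈ uIcc a b, v' x = u' x) : SolvesOn q z a b v v' :=
  ⟨h.isPrimitiveOn.congr hu fun x hx => (hu' x hx).symm,
    h.isPrimitiveOn_deriv.congr hu' fun x hx => by rw [hu x hx]⟩

theorem add (hu : SolvesOn q z a b u u') (hv : SolvesOn q z a b v v') :
    SolvesOn q z a b (fun x => u x + v x) (fun x => u' x + v' x) :=
  ⟨hu.isPrimitiveOn.add hv.isPrimitiveOn,
    (hu.isPrimitiveOn_deriv.add hv.isPrimitiveOn_deriv).congr_deriv fun x => by ring⟩

theorem const_mul (w : ℂ) (h : SolvesOn q z a b u u') :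
    SolvesOn q z a b (fun x => w * u x) (fun x => w * u' x) :=
  ⟨h.isPrimitiveOn.const_mul w,
    (h.isPrimitiveOn_deriv.const_mul w).congr_deriv fun x => by ring⟩

theorem sub (hu : SolvesOn q z a b u u') (hv : SolvesOn q z a b v v') :
    SolvesOn q z a b (fun x => u x - v x) (fun x => u' x - v' x) := by
  simpa [sub_eq_add_neg] using hu.add (hv.const_mul (-1))

theorem star (h : SolvesOn q z a b u u') :
    SolvesOn q (conj z) a b (fun x => conj (u x)) (fun x => conj (u' x)) :=
  ⟨h.isPrimitiveOn.star, h.isPrimitiveOn_deriv.star.congr_deriv fun x => by simp⟩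

theorem continuousOn (h : SolvesOn q z a b u u') : ContinuousOn u (uIcc a b) :=
  h.isPrimitiveOn.continuousOn

theorem continuousOn_deriv (h : SolvesOn q z a b u u') : ContinuousOn u' (uIcc a b) :=
  h.isPrimitiveOn_deriv.continuousOn

theorem intervalIntegrable_norm_sq (h : SolvesOn q z a b u u') (hc : c ∈ uIcc a b)
    (hd : d ∈ uIcc a b) : IntervalIntegrable (fun t => ‖u t‖ ^ 2) volume c d :=
  ((h.continuousOn.mono (uIcc_subset_uIcc hc hd)).norm.pow 2).intervalIntegrable

theorem wronskian (hu : SolvesOn q₁ z₁ a b u u') (hv : SolvesOn q₂ z₂ a b v v') :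
    IsPrimitiveOn (fun x => u x * v' x - u' x * v x)
      (fun x => (((q₂ x : ℂ) - z₂) - ((q₁ x : ℂ) - z₁)) * (u x * v x)) a b :=
  ((hu.isPrimitiveOn.mul hv.isPrimitiveOn_deriv).sub
    (hu.isPrimitiveOn_deriv.mul hv.isPrimitiveOn)).congr_deriv fun x => by ring

theorem wronskian_eq (hu : SolvesOn q z a b u u') (hv : SolvesOn q z a b v v')
    (hx : x ∈ uIcc a b) : u x * v' x - u' x * v x = u a * v' a - u' a * v a := by
  simpa using (hu.wronskian hv).eq_add_integral x hx

theorem green (h : SolvesOn q z a b u u') :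
    IsPrimitiveOn (fun x => conj (u x) * u' x)
      (fun x => ((‖u' x‖ ^ 2 : ℝ) : ℂ) + ((q x : ℂ) - z) * ((‖u x‖ ^ 2 : ℝ) : ℂ)) a b :=
  (h.isPrimitiveOn.star.mul h.isPrimitiveOn_deriv).congr_deriv fun x => by
    push_cast [← Complex.conj_mul']
    ring

theorem green_im (h : SolvesOn q z a b u u') :
    IsPrimitiveOn (fun x => (conj (u x) * u' x).im) (fun x => -z.im * ‖u x‖ ^ 2) a b :=
  (h.green.clm_comp Complex.imCLM).congr_deriv fun x => by
    rw [Complex.imCLM_apply, Complex.add_im, Complex.im_mul_ofReal, Complex.sub_im,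
      Complex.ofReal_im, Complex.ofReal_im, zero_add, zero_sub]

theorem green_re (h : SolvesOn q z a b u u') :
    IsPrimitiveOn (fun x => (conj (u x) * u' x).re)
      (fun x => ‖u' x‖ ^ 2 + (q x - z.re) * ‖u x‖ ^ 2) a b :=
  (h.green.clm_comp Complex.reCLM).congr_deriv fun x => by
    rw [Complex.reCLM_apply, Complex.add_re, Complex.re_mul_ofReal, Complex.sub_re,
      Complex.ofReal_re, Complex.ofReal_re]

theorem im_sub_im (h : SolvesOn q z a b u u') (hc : c ∈ uIcc a b) (hd : d ∈ uIcc a b) :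
    (conj (u d) * u' d).im - (conj (u c) * u' c).im = -z.im * ∫ t in c..d, ‖u t‖ ^ 2 := by
  rw [← intervalIntegral.integral_const_mul, h.green_im.integral_eq_sub hc hd]

theorem eq_zero_of_fundamentalSystem {θ θ' φ φ' : ℝ → ℂ} (h : SolvesOn q z a b u u')
    (hθ : SolvesOn q z a b θ θ') (hφ : SolvesOn q z a b φ φ') (hW : θ a * φ' a - θ' a * φ a = 1)
    (h0 : u a = 0) (h0' : u' a = 0) (hx : x ∈ uIcc a b) : u x = 0 ∧ u' x = 0 := by
  have huθ := h.wronskian_eq hθ hx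
  have huφ := h.wronskian_eq hφ hx
  have hθφ := hθ.wronskian_eq hφ hx
  rw [hW] at hθφ
  rw [h0, h0'] at huθ huφ
  constructor
  · linear_combination (-u x) * hθφ + (-φ x) * huθ + θ x * huφ
  · linear_combination (-u' x) * hθφ + (-φ' x) * huθ + θ' x * huφ

end SolvesOn

/-! ### Existence and uniqueness of solutions -/

theorem exists_kernelOperator {X : Type*} [TopologicalSpace X] [FirstCountableTopology X]
    [MeasurableSpace X] [OpensMeasurableSpace X] {μ : Measure X} {K : X → X → ℂ} {B : X → ℝ}
    (hmeas : ∀ x, AEStronglyMeasurable (K x) μ) (hcont : ∀ y, Continuous fun x => K x y)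
    (hbound : ∀ x y, ‖K x y‖ ≤ B y) (hB : Integrable B μ) :
    ∃ T : BoundedContinuousFunction X ℂ →L[ℂ] BoundedContinuousFunction X ℂ,
      ‖T‖ ≤ ∫ y, B y ∂μ ∧ ∀ v x, T v x = ∫ y, K x y * v y ∂μ := by
  have hle (v : BoundedContinuousFunction X ℂ) (x y : X) : ‖K x y * v y‖ ≤ B y * ‖v‖ := by
    rw [norm_mul]
    exact mul_le_mul (hbound x y) (v.norm_coe_le_norm y) (norm_nonneg _)
      ((norm_nonneg _).trans (hbound x y))
  have hdominant (v : BoundedContinuousFunction X ℂ) : Integrable (fun y => B y * ‖v‖) μ :=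
    hB.mul_const _
  have hmeas' (v : BoundedContinuousFunction X ℂ) (x : X) :
      AEStronglyMeasurable (fun y => K x y * v y) μ :=
    (hmeas x).mul v.continuous.aestronglyMeasurable
  have hintegrable (v : BoundedContinuousFunction X ℂ) (x : X) :
      Integrable (fun y => K x y * v y) μ :=
    (hdominant v).mono' (hmeas' v x) (Eventually.of_forall (hle v x))
  have hnorm (v : BoundedContinuousFunction X ℂ) (x : X) :
      ‖∫ y, K x y * v y ∂μ‖ ≤ (∫ y, B y ∂μ) * ‖v‖ :=
    (norm_integral_le_of_norm_le (hdominant v) (Eventually.of_forall (hle v x))).trans_eq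
      (integral_mul_const _ _)
  let T : BoundedContinuousFunction X ℂ →ₗ[ℂ] BoundedContinuousFunction X ℂ :=
    { toFun v := BoundedContinuousFunction.ofNormedAddCommGroup (fun x => ∫ y, K x y * v y ∂μ)
        (continuous_of_dominated (hmeas' v) (fun x => Eventually.of_forall (hle v x))
          (hdominant v) (Eventually.of_forall fun y => (hcont y).mul continuous_const)) _ (hnorm v)
      map_add' v w := by
        ext x
        simp [mul_add, integral_add (hintegrable v x) (hintegrable w x)]
      map_smul' c v := by
        ext x
        simp [mul_left_comm, integral_const_mul] }
  by_cases hX : Nonempty X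
  · have hB0 : 0 ≤ ∫ y, B y ∂μ :=
      integral_nonneg fun y => (norm_nonneg _).trans (hbound hX.some y)
    exact ⟨T.mkContinuous _ fun v => (BoundedContinuousFunction.norm_le
      (mul_nonneg hB0 (norm_nonneg v))).2 (hnorm v), T.mkContinuous_norm_le hB0 _, fun _ _ => rfl⟩
  · rw [not_nonempty_iff] at hX
    exact ⟨0, by simp [integral_of_isEmpty], fun v x => hX.elim x⟩

theorem exists_eq_add_integral_kernel {X : Type*} [TopologicalSpace X] [FirstCountableTopology X]
    [MeasurableSpace X] [OpensMeasurableSpace X] {μ : Measure X} {K : X → X → ℂ} {B : X → ℝ}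
    (hmeas : ∀ x, AEStronglyMeasurable (K x) μ) (hcont : ∀ y, Continuous fun x => K x y)
    (hbound : ∀ x y, ‖K x y‖ ≤ B y) (hB : Integrable B μ) (hlt : ∫ y, B y ∂μ < 1)
    (g : BoundedContinuousFunction X ℂ) :
    ∃ v : BoundedContinuousFunction X ℂ, ∀ x, v x = g x + ∫ y, K x y * v y ∂μ := by
  obtain ⟨T, hT, hTv⟩ := exists_kernelOperator hmeas hcont hbound hB
  obtain ⟨S, hS⟩ := isUnit_one_sub_of_norm_lt_one
    (R := BoundedContinuousFunction X ℂ →L[ℂ] BoundedContinuousFunction X ℂ) (hT.trans_lt hlt)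
  refine ⟨(↑S⁻¹ : _ →L[ℂ] _) g, fun x => ?_⟩
  have hinv := DFunLike.congr_fun (DFunLike.congr_fun S.mul_inv g) x
  rw [hS] at hinv
  rw [← hTv]
  exact sub_eq_iff_eq_add.1 hinv

/-- The kernel `t₊ exp(-l t₊)`: the kernel `t₊` of twofold integration, damped by an exponential so
that it is bounded by `1 / l`. -/
def volterraKernel (l t : ℝ) : ℝ := max t 0 * Real.exp (-(l * max t 0))

theorem continuous_volterraKernel (l : ℝ) : Continuous (volterraKernel l) := by
  unfold volterraKernel
  fun_prop

theorem volterraKernel_of_nonpos (l : ℝ) {t : ℝ} (ht : t ≤ 0) : volterraKernel l t = 0 := by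
  rw [volterraKernel, max_eq_right ht, zero_mul]

theorem exp_mul_volterraKernel (l : ℝ) {t : ℝ} (ht : 0 ≤ t) :
    Real.exp (l * t) * volterraKernel l t = t := by
  rw [volterraKernel, max_eq_left ht, mul_left_comm, ← Real.exp_add, add_neg_cancel, Real.exp_zero,
    mul_one]

theorem norm_volterraKernel_le {l : ℝ} (hl : 0 < l) (t : ℝ) :
    ‖(volterraKernel l t : ℂ)‖ ≤ 1 / l := by
  rw [Complex.norm_real, volterraKernel, Real.norm_of_nonneg
    (mul_nonneg (le_max_right _ _) (Real.exp_pos _).le), Real.exp_neg, ← div_eq_mul_inv,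
    div_le_div_iff₀ (Real.exp_pos _) hl]
  linarith [Real.add_one_le_exp (l * max t 0)]

/-- The free solution `A + B x`, damped by `exp(-l x)` for `0 ≤ x` and continued to a bounded
function. -/
def volterraData {l : ℝ} (hl : 0 < l) (A B : ℂ) : BoundedContinuousFunction ℝ ℂ :=
  BoundedContinuousFunction.ofNormedAddCommGroup
    (fun x => Real.exp (-(l * max x 0)) * A + volterraKernel l x * B)
    (by have := continuous_volterraKernel l; fun_prop) (1 * ‖A‖ + 1 / l * ‖B‖) fun x => by
      refine norm_add_le_of_le ?_ ?_ <;> rw [norm_mul]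
      · gcongr
        rw [Complex.norm_real, Real.norm_of_nonneg (Real.exp_pos _).le, Real.exp_le_one_iff]
        exact neg_nonpos.2 (mul_nonneg hl.le (le_max_right _ _))
      · gcongr
        exact norm_volterraKernel_le hl x

theorem exp_mul_volterraData {l : ℝ} (hl : 0 < l) (A B : ℂ) {x : ℝ} (hx : 0 ≤ x) :
    Real.exp (l * x) * volterraData hl A B x = A + B * x := by
  have hexp : (Real.exp (l * x) : ℂ) * Real.exp (-(l * x)) = 1 := by
    rw [← Complex.ofReal_mul, ← Real.exp_add, add_neg_cancel, Real.exp_zero, Complex.ofReal_one]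
  have hkernel : (Real.exp (l * x) : ℂ) * volterraKernel l x = x := by
    rw [← Complex.ofReal_mul, exp_mul_volterraKernel l hx]
  rw [volterraData, BoundedContinuousFunction.coe_ofNormedAddCommGroup, max_eq_left hx]
  linear_combination A * hexp + B * hkernel

theorem exists_eq_add_integral_volterraKernel {Q : ℝ → ℂ} (hQ : Integrable Q) (A B : ℂ) :
    ∃ (l : ℝ) (hl : 0 < l) (v : ℝ → ℂ), Continuous v ∧ ∀ x,
      v x = volterraData hl A B x + ∫ y, volterraKernel l (x - y) * Q y * v y := by
  set N := ∫ y, ‖Q y‖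
  have hN : 0 ≤ N := integral_nonneg fun _ => norm_nonneg _
  have hl : 0 < 2 * N + 1 := by linarith
  have hkernel := continuous_volterraKernel (2 * N + 1)
  obtain ⟨v, hv⟩ := exists_eq_add_integral_kernel
    (K := fun x y => volterraKernel (2 * N + 1) (x - y) * Q y)
    (B := fun y => 1 / (2 * N + 1) * ‖Q y‖)
    (fun x => Continuous.aestronglyMeasurable (by fun_prop) |>.mul hQ.1)
    (fun y => by fun_prop)
    (fun x y => by rw [norm_mul]; gcongr; exact norm_volterraKernel_le hl _)
    (hQ.norm.const_mul _)
    (by rw [integral_const_mul, one_div, inv_mul_lt_iff₀ hl]; linarith)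
    (volterraData hl A B)
  exact ⟨_, hl, v, v.continuous, hv⟩

theorem exists_eq_add_integral_sub_mul {Q : ℝ → ℂ} (hQ : Integrable Q) (A B : ℂ) :
    ∃ u : ℝ → ℂ, Continuous u ∧ ∀ x, 0 ≤ x →
      u x = A + B * x + ∫ y in 0..x, ((x : ℂ) - y) * (Q y * u y) := by
  obtain ⟨l, hl, v, hv, hveq⟩ := exists_eq_add_integral_volterraKernel
    (hQ.indicator (measurableSet_Ioi (a := (0 : ℝ)))) A B
  refine ⟨fun x => Real.exp (l * x) * v x, by fun_prop, fun x hx => ?_⟩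
  beta_reduce
  rw [hveq x, mul_add, exp_mul_volterraData hl A B hx, ← integral_const_mul,
    intervalIntegral.integral_of_le hx, ← integral_indicator measurableSet_Ioc]
  congr 2 with y
  by_cases hy : y ∈ Ioc 0 x
  · have hkernel : (Real.exp (l * x) : ℂ) * volterraKernel l (x - y)
        = Real.exp (l * y) * (x - y) := by
      norm_cast
      nth_rw 1 [show l * x = l * y + l * (x - y) by ring]
      rw [Real.exp_add, mul_assoc, exp_mul_volterraKernel l (sub_nonneg.2 hy.2)]
    rw [indicator_of_mem (mem_Ioi.2 hy.1), indicator_of_mem hy]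
    linear_combination (Q y * v y) * hkernel
  · rw [indicator_of_notMem hy]
    rcases le_or_gt y 0 with hy0 | hy0
    · rw [indicator_of_notMem (notMem_Ioi.2 hy0), mul_zero, zero_mul, mul_zero]
    · rw [volterraKernel_of_nonpos l (sub_nonpos.2 (le_of_not_ge fun h => hy ⟨hy0, h⟩)),
        Complex.ofReal_zero, zero_mul, zero_mul, mul_zero]

theorem isPrimitiveOn_integral_sub_mul {F : ℝ → ℂ} {a b : ℝ}
    (hF : IntervalIntegrable F volume a b) :
    IsPrimitiveOn (fun x => ∫ y in a..x, ((x : ℂ) - y) * F y) (fun x => ∫ y in a..x, F y) a b := by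
  have hyF : IntervalIntegrable (fun y => (y : ℂ) * F y) volume a b :=
    hF.continuousOn_mul Complex.continuous_ofReal.continuousOn
  have hid : IsPrimitiveOn (fun x : ℝ => (x : ℂ)) (fun _ => 1) a b :=
    .of_hasDerivAt (fun x => (hasDerivAt_id x).ofReal_comp) continuous_const a b
  have hintegral : IsPrimitiveOn (fun x => ∫ y in a..x, F y) F a b := ⟨hF, by simp⟩
  have hmoment : IsPrimitiveOn (fun x => ∫ y in a..x, (y : ℂ) * F y) (fun x => (x : ℂ) * F x) a b :=
    ⟨hyF, by simp⟩
  refine ((hid.mul hintegral).sub hmoment).congr (fun x hx => ?_) fun x _ => by ring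
  have hsub := uIcc_subset_uIcc left_mem_uIcc hx
  rw [← intervalIntegral.integral_const_mul,
    ← intervalIntegral.integral_sub ((hF.mono_set hsub).const_mul _) (hyF.mono_set hsub)]
  simp only [sub_mul]

theorem exists_isPrimitiveOn_of_integrable {Q : ℝ → ℂ} (hQ : Integrable Q) (A B : ℂ) :
    ∃ u u' : ℝ → ℂ, u 0 = A ∧ u' 0 = B ∧ ∀ c, 0 ≤ c →
      IsPrimitiveOn u u' 0 c ∧ IsPrimitiveOn u' (fun x => Q x * u x) 0 c := by
  obtain ⟨u, hu, hueq⟩ := exists_eq_add_integral_sub_mul hQ A B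
  have hQu (c : ℝ) : IntervalIntegrable (fun y => Q y * u y) volume 0 c :=
    hQ.intervalIntegrable.mul_continuousOn hu.continuousOn
  refine ⟨u, fun x => B + ∫ y in 0..x, Q y * u y, by simpa using hueq 0 le_rfl, by simp,
    fun c hc => ⟨?_, hQu c, by simp⟩⟩
  have hfree : IsPrimitiveOn (fun x : ℝ => A + B * x) (fun _ => B) 0 c :=
    .of_hasDerivAt (fun x => by
      simpa using ((hasDerivAt_id x).ofReal_comp.const_mul B).const_add A) continuous_const 0 c
  refine (hfree.add (isPrimitiveOn_integral_sub_mul (hQu c))).congr (fun x hx => ?_) fun _ _ => rfl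
  exact hueq x (uIcc_of_le hc ▸ hx).1

theorem exists_solvesOn {q : ℝ → ℝ} {c : ℝ} (hc : 0 ≤ c) (hq : IntegrableOn q (Ioo 0 c))
    (z A B : ℂ) : ∃ u u' : ℝ → ℂ, u 0 = A ∧ u' 0 = B ∧ SolvesOn q z 0 c u u' := by
  have hI : IntegrableOn (fun x => (q x : ℂ) - z) (Ioo 0 c) :=
    hq.ofReal.sub (integrableOn_const (by simp))
  obtain ⟨u, u', h0, h0', h⟩ := exists_isPrimitiveOn_of_integrable
    (hI.integrable_indicator measurableSet_Ioo) A B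
  have hne : ∀ᵐ x : ℝ, x ≠ c := by simp [ae_iff, measure_singleton]
  refine ⟨u, u', h0, h0', (h c hc).1, (h c hc).2.congr_ae (fun _ _ => rfl) ?_⟩
  filter_upwards [hne] with x hxc hx
  rw [uIoc_of_le hc] at hx
  rw [indicator_of_mem (mem_Ioo.2 ⟨hx.1, lt_of_le_of_ne hx.2 hxc⟩)]

theorem SolvesOn.eq_of_initial {q : ℝ → ℝ} {c x : ℝ} {z : ℂ} {u u' v v' : ℝ → ℂ} (hc : 0 ≤ c)
    (hq : IntegrableOn q (Ioo 0 c)) (hu : SolvesOn q z 0 c u u') (hv : SolvesOn q z 0 c v v')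
    (h0 : u 0 = v 0) (h0' : u' 0 = v' 0) (hx : x ∈ Icc 0 c) : u x = v x ∧ u' x = v' x := by
  obtain ⟨θ, θ', hθ0, hθ0', hθ⟩ := exists_solvesOn hc hq z 1 0
  obtain ⟨φ, φ', hφ0, hφ0', hφ⟩ := exists_solvesOn hc hq z 0 1
  simpa [sub_eq_zero] using (hu.sub hv).eq_zero_of_fundamentalSystem hθ hφ
    (by simp [hθ0, hθ0', hφ0, hφ0']) (by simp [h0]) (by simp [h0']) (Icc_subset_uIcc hx)

theorem exists_solvesOn_final {q : ℝ → ℝ} {c : ℝ} (hc : 0 ≤ c) (hq : IntegrableOn q (Ioo 0 c))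
    (z A B : ℂ) : ∃ u u' : ℝ → ℂ, u c = A ∧ u' c = B ∧ SolvesOn q z 0 c u u' := by
  obtain ⟨θ, θ', hθ0, hθ0', hθ⟩ := exists_solvesOn hc hq z 1 0
  obtain ⟨φ, φ', hφ0, hφ0', hφ⟩ := exists_solvesOn hc hq z 0 1
  have hW := hθ.wronskian_eq hφ right_mem_uIcc
  rw [hθ0, hθ0', hφ0, hφ0'] at hW
  refine ⟨_, _, ?_, ?_, (hθ.const_mul (A * φ' c - B * φ c)).add
    (hφ.const_mul (B * θ c - A * θ' c))⟩
  · linear_combination A * hW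
  · linear_combination B * hW

theorem exists_solvesOn_halfLine {q : ℝ → ℝ} (hq : LocallyIntegrableHalfLine q) (z A B : ℂ) :
    ∃ u u' : ℝ → ℂ, u 0 = A ∧ u' 0 = B ∧ ∀ c, 0 ≤ c → SolvesOn q z 0 c u u' := by
  have hpos : ∀ n : ℕ, (0 : ℝ) < n + 1 := fun n => by positivity
  choose u u' h0 h0' h using fun n : ℕ => exists_solvesOn (hpos n).le (hq _ (hpos n)) z A B
  have hmem {x : ℝ} {n : ℕ} (hx : 0 ≤ x) (hxn : x ≤ n + 1) : x ∈ uIcc 0 ((n : ℝ) + 1) :=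
    Icc_subset_uIcc ⟨hx, hxn⟩
  refine ⟨fun x => u ⌊x⌋₊ x, fun x => u' ⌊x⌋₊ x, by simp [h0], by simp [h0'], fun c hc => ?_⟩
  have hagree : ∀ x ∈ uIcc 0 c, u ⌊x⌋₊ x = u ⌊c⌋₊ x ∧ u' ⌊x⌋₊ x = u' ⌊c⌋₊ x := by
    intro x hx
    rw [uIcc_of_le hc] at hx
    have hle : ((⌊x⌋₊ : ℝ) + 1) ≤ (⌊c⌋₊ : ℝ) + 1 := by
      gcongr
      exact hx.2
    exact SolvesOn.eq_of_initial (hpos ⌊x⌋₊).le (hq _ (hpos ⌊x⌋₊)) (h _)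
      ((h ⌊c⌋₊).mono left_mem_uIcc (hmem (hpos _).le hle)) (by rw [h0, h0]) (by rw [h0', h0'])
      ⟨hx.1, (Nat.lt_floor_add_one x).le⟩
  exact ((h ⌊c⌋₊).mono left_mem_uIcc (hmem hc (Nat.lt_floor_add_one c).le)).congr
    (fun x hx => (hagree x hx).1) fun x hx => (hagree x hx).2

/-! ### Solutions for `z = -κ ^ 2` on an interval with a small potential -/

theorem IsPrimitiveOn.comp_sub_left {E : Type*} [NormedAddCommGroup E] [NormedSpace ℝ E]
    {f f' : ℝ → E} {a b : ℝ} (s : ℝ) (hf : IsPrimitiveOn f f' (s - a) (s - b)) :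
    IsPrimitiveOn (fun x => f (s - x)) (fun x => -f' (s - x)) a b where
  intervalIntegrable := by
    have hcomp := hf.intervalIntegrable.comp_sub_left s
    simp only [sub_sub_cancel] at hcomp
    exact hcomp.neg
  eq_add_integral x hx := by
    rw [intervalIntegral.integral_neg, intervalIntegral.integral_comp_sub_left,
      ← intervalIntegral.integral_symm, hf.eq_add_integral (s - x)]
    exact image_const_sub_uIcc s a b ▸ mem_image_of_mem _ hx

theorem SolvesOn.comp_sub_left {q : ℝ → ℝ} {z : ℂ} {a b : ℝ} {u u' : ℝ → ℂ} (s : ℝ)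
    (h : SolvesOn q z (s - a) (s - b) u u') :
    SolvesOn (fun x => q (s - x)) z a b (fun x => u (s - x)) (fun x => -u' (s - x)) :=
  ⟨h.isPrimitiveOn.comp_sub_left s, by
    simpa using (h.isPrimitiveOn_deriv.comp_sub_left s).const_mul (-1)⟩

theorem norm_cexp_mul_ofReal (κ : ℂ) (x : ℝ) : ‖Complex.exp (κ * x)‖ = Real.exp (κ.re * x) := by
  rw [Complex.norm_exp, Complex.re_mul_ofReal]

theorem isPrimitiveOn_cexp (κ : ℂ) (a b : ℝ) :
    IsPrimitiveOn (fun x => Complex.exp (κ * x)) (fun x => κ * Complex.exp (κ * x)) a b := by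
  refine .of_hasDerivAt (fun x => ?_) (by fun_prop) a b
  simpa [mul_comm] using ((hasDerivAt_id x).ofReal_comp.const_mul κ).cexp

theorem norm_integral_le_mul_integral_abs {q : ℝ → ℝ} {g : ℝ → ℂ} {b c N : ℝ}
    (hq : IntervalIntegrable q volume 0 b) (hc : c ∈ Icc 0 b) (hN : 0 ≤ N)
    (h : ∀ y ∈ Icc 0 c, ‖g y‖ ≤ N * |q y|) : ‖∫ y in 0..c, g y‖ ≤ N * ∫ y in 0..b, |q y| :=
  calc ‖∫ y in 0..c, g y‖ ≤ ∫ y in 0..c, N * |q y| :=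
        intervalIntegral.norm_integral_le_of_norm_le hc.1
          (Eventually.of_forall fun y hy => h y (Ioc_subset_Icc_self hy))
          ((hq.abs.mono_set (uIcc_subset_uIcc left_mem_uIcc (Icc_subset_uIcc hc))).const_mul N)
    _ = N * ∫ y in 0..c, |q y| := intervalIntegral.integral_const_mul _ _
    _ ≤ N * ∫ y in 0..b, |q y| := by
        gcongr
        exact intervalIntegral.integral_mono_interval le_rfl hc.1 hc.2
          (Eventually.of_forall fun y => abs_nonneg _) hq.abs

namespace SolvesOn

variable {q : ℝ → ℝ} {κ : ℂ} {a b δ N x : ℝ} {u u' : ℝ → ℂ}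

theorem isPrimitiveOn_exp_neg_mul (h : SolvesOn q (-κ ^ 2) a b u u') :
    IsPrimitiveOn (fun x => Complex.exp (-κ * x) * (u' x + κ * u x))
      (fun x => Complex.exp (-κ * x) * (q x * u x)) a b :=
  ((isPrimitiveOn_cexp (-κ) a b).mul
    (h.isPrimitiveOn_deriv.add (h.isPrimitiveOn.const_mul κ))).congr_deriv fun x => by ring

theorem isPrimitiveOn_exp_mul (h : SolvesOn q (-κ ^ 2) a b u u') :
    IsPrimitiveOn (fun x => Complex.exp (κ * x) * (u' x - κ * u x))
      (fun x => Complex.exp (κ * x) * (q x * u x)) a b := by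
  have h' : SolvesOn q (-(-κ) ^ 2) a b u u' := by rwa [neg_sq]
  simpa [sub_eq_add_neg] using h'.isPrimitiveOn_exp_neg_mul

theorem norm_exp_neg_mul_sub_le (h : SolvesOn q (-κ ^ 2) 0 δ u u')
    (hq : IntervalIntegrable q volume 0 δ)
    (hN : ∀ y ∈ Icc 0 δ, ‖u y‖ ≤ N * Real.exp (κ.re * y)) (hx : x ∈ Icc 0 δ) :
    ‖Complex.exp (-κ * x) * (u' x + κ * u x) - (u' 0 + κ * u 0)‖ ≤ N * ∫ y in 0..δ, |q y| := by
  have hvariation := h.isPrimitiveOn_exp_neg_mul.integral_eq_sub left_mem_uIcc (Icc_subset_uIcc hx)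
  simp only [Complex.ofReal_zero, mul_zero, Complex.exp_zero, one_mul] at hvariation
  rw [← hvariation]
  have hN0 : 0 ≤ N := by simpa using (norm_nonneg _).trans (hN 0 ⟨le_rfl, hx.1.trans hx.2⟩)
  refine norm_integral_le_mul_integral_abs hq hx hN0 fun y hy => ?_
  rw [norm_mul, norm_mul, norm_cexp_mul_ofReal, Complex.norm_real, Real.norm_eq_abs]
  calc Real.exp ((-κ).re * y) * (|q y| * ‖u y‖)
      ≤ Real.exp ((-κ).re * y) * (|q y| * (N * Real.exp (κ.re * y))) := by
        gcongr
        exact hN y ⟨hy.1, hy.2.trans hx.2⟩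
    _ = Real.exp ((-κ).re * y + κ.re * y) * (N * |q y|) := by
        rw [Real.exp_add]
        ring
    _ = N * |q y| := by
        rw [Complex.neg_re, neg_mul, neg_add_cancel, Real.exp_zero, one_mul]

theorem norm_exp_mul_sub_le (h : SolvesOn q (-κ ^ 2) 0 δ u u')
    (hq : IntervalIntegrable q volume 0 δ) (hκ : 0 ≤ κ.re)
    (hN : ∀ y ∈ Icc 0 δ, ‖u y‖ ≤ N * Real.exp (κ.re * y)) (hx : x ∈ Icc 0 δ) :
    ‖Complex.exp (κ * x) * (u' x - κ * u x) - (u' 0 - κ * u 0)‖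
      ≤ Real.exp (2 * κ.re * x) * N * ∫ y in 0..δ, |q y| := by
  have hvariation := h.isPrimitiveOn_exp_mul.integral_eq_sub left_mem_uIcc (Icc_subset_uIcc hx)
  simp only [Complex.ofReal_zero, mul_zero, Complex.exp_zero, one_mul] at hvariation
  rw [← hvariation]
  have hN0 : 0 ≤ N := by simpa using (norm_nonneg _).trans (hN 0 ⟨le_rfl, hx.1.trans hx.2⟩)
  refine norm_integral_le_mul_integral_abs hq hx (by positivity) fun y hy => ?_
  rw [norm_mul, norm_mul, norm_cexp_mul_ofReal, Complex.norm_real, Real.norm_eq_abs]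
  calc Real.exp (κ.re * y) * (|q y| * ‖u y‖)
      ≤ Real.exp (κ.re * y) * (|q y| * (N * Real.exp (κ.re * y))) := by
        gcongr
        exact hN y ⟨hy.1, hy.2.trans hx.2⟩
    _ = Real.exp (2 * κ.re * y) * N * |q y| := by
        rw [show 2 * κ.re * y = κ.re * y + κ.re * y by ring, Real.exp_add]
        ring
    _ ≤ Real.exp (2 * κ.re * x) * N * |q y| := by
        gcongr
        exact hy.2

theorem norm_two_mul_sub_le (h : SolvesOn q (-κ ^ 2) 0 δ u u')
    (hq : IntervalIntegrable q volume 0 δ) (hκ : 0 ≤ κ.re)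
    (hN : ∀ y ∈ Icc 0 δ, ‖u y‖ ≤ N * Real.exp (κ.re * y)) (hx : x ∈ Icc 0 δ) :
    ‖2 * κ * u x
        - (Complex.exp (κ * x) * (u' 0 + κ * u 0) - Complex.exp (-κ * x) * (u' 0 - κ * u 0))‖
      ≤ 2 * Real.exp (κ.re * x) * (N * ∫ y in 0..δ, |q y|) := by
  have hcancel : Complex.exp (κ * x) * Complex.exp (-κ * x) = 1 := by
    rw [← Complex.exp_add, neg_mul, add_neg_cancel, Complex.exp_zero]
  have hexp : Real.exp ((-κ).re * x) * Real.exp (2 * κ.re * x) = Real.exp (κ.re * x) := by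
    rw [← Real.exp_add, Complex.neg_re]
    ring_nf
  calc _ = ‖Complex.exp (κ * x)
            * (Complex.exp (-κ * x) * (u' x + κ * u x) - (u' 0 + κ * u 0))
          - Complex.exp (-κ * x)
            * (Complex.exp (κ * x) * (u' x - κ * u x) - (u' 0 - κ * u 0))‖ := by
        congr 1
        linear_combination (-2 * κ * u x) * hcancel
    _ ≤ Real.exp (κ.re * x) * (N * ∫ y in 0..δ, |q y|) + Real.exp ((-κ).re * x)
          * (Real.exp (2 * κ.re * x) * N * ∫ y in 0..δ, |q y|) := by
        refine norm_sub_le_of_le ?_ ?_ <;> rw [norm_mul, norm_cexp_mul_ofReal] <;> gcongr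
        · exact h.norm_exp_neg_mul_sub_le hq hN hx
        · exact h.norm_exp_mul_sub_le hq hκ hN hx
    _ = 2 * Real.exp (κ.re * x) * (N * ∫ y in 0..δ, |q y|) := by
        linear_combination (N * ∫ y in 0..δ, |q y|) * hexp

theorem norm_mul_norm_le (h : SolvesOn q (-κ ^ 2) 0 δ u u')
    (hq : IntervalIntegrable q volume 0 δ) (hκ : 0 ≤ κ.re) (hI : ∫ y in 0..δ, |q y| ≤ ‖κ‖ / 4)
    (hx : x ∈ Icc 0 δ) :
    ‖κ‖ * ‖u x‖
      ≤ 2 / 3 * (‖u' 0 + κ * u 0‖ + ‖u' 0 - κ * u 0‖) * Real.exp (κ.re * x) := by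
  have hδ : 0 ≤ δ := hx.1.trans hx.2
  have hweighted : ContinuousOn (fun y => ‖u y‖ / Real.exp (κ.re * y)) (Icc 0 δ) :=
    (uIcc_of_le hδ ▸ h.continuousOn).norm.div (by fun_prop) fun y _ => (Real.exp_pos _).ne'
  obtain ⟨x₀, hx₀, hmax⟩ := isCompact_Icc.exists_isMaxOn ⟨x, hx⟩ hweighted
  set N := ‖u x₀‖ / Real.exp (κ.re * x₀)
  set S := ‖u' 0 + κ * u 0‖ + ‖u' 0 - κ * u 0‖
  have hN0 : 0 ≤ N := by positivity
  have hN : ∀ y ∈ Icc 0 δ, ‖u y‖ ≤ N * Real.exp (κ.re * y) := fun y hy =>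
    (div_le_iff₀ (Real.exp_pos _)).1 (hmax hy)
  have hx₀N : ‖u x₀‖ = N * Real.exp (κ.re * x₀) := (div_mul_cancel₀ _ (Real.exp_pos _).ne').symm
  have hfree : ‖Complex.exp (κ * x₀) * (u' 0 + κ * u 0)
      - Complex.exp (-κ * x₀) * (u' 0 - κ * u 0)‖ ≤ Real.exp (κ.re * x₀) * S := by
    refine (norm_sub_le _ _).trans ?_
    rw [norm_mul, norm_mul, norm_cexp_mul_ofReal, norm_cexp_mul_ofReal, mul_add, Complex.neg_re]
    gcongr
    · exact hx₀.1
    · linarith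
  have hx₀_le : ‖2 * κ * u x₀‖ ≤ 2 * Real.exp (κ.re * x₀) * (N * ∫ y in 0..δ, |q y|)
      + Real.exp (κ.re * x₀) * S :=
    (norm_le_norm_sub_add (2 * κ * u x₀) _).trans
      (add_le_add (h.norm_two_mul_sub_le hq hκ hN hx₀) hfree)
  rw [norm_mul, norm_mul, Complex.norm_ofNat, hx₀N] at hx₀_le
  have hdivided : 2 * ‖κ‖ * N ≤ 2 * (N * ∫ y in 0..δ, |q y|) + S :=
    le_of_mul_le_mul_right (by linarith) (Real.exp_pos (κ.re * x₀))
  have hκN : ‖κ‖ * N ≤ 2 / 3 * S := by linarith [mul_le_mul_of_nonneg_left hI hN0]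
  calc ‖κ‖ * ‖u x‖ ≤ ‖κ‖ * (N * Real.exp (κ.re * x)) := by
        gcongr
        exact hN x hx
    _ = ‖κ‖ * N * Real.exp (κ.re * x) := (mul_assoc _ _ _).symm
    _ ≤ 2 / 3 * S * Real.exp (κ.re * x) := by gcongr

end SolvesOn

theorem im_neg_sq (κ : ℂ) : (-κ ^ 2).im = -2 * κ.re * κ.im := by
  rw [Complex.neg_im, sq, Complex.mul_im]
  ring

theorem im_neg_sq_ne_zero {κ : ℂ} (hκ : 0 < κ.re) (him : κ.im ≠ 0) : (-κ ^ 2).im ≠ 0 := by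
  rw [im_neg_sq]
  exact mul_ne_zero (mul_ne_zero (by norm_num) hκ.ne') him

section SineSolution

variable {q : ℝ → ℝ} {κ : ℂ} {δ x : ℝ} {φ φ' : ℝ → ℂ}

theorem SolvesOn.norm_sine_le (h : SolvesOn q (-κ ^ 2) 0 δ φ φ')
    (hq : IntervalIntegrable q volume 0 δ) (hκ : 0 < κ.re) (hI : ∫ y in 0..δ, |q y| ≤ ‖κ‖ / 4)
    (h0 : φ 0 = 0) (h0' : φ' 0 = 1) (hx : x ∈ Icc 0 δ) :
    ‖φ x‖ ≤ 4 / 3 / ‖κ‖ * Real.exp (κ.re * x) := by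
  have hnorm : 0 < ‖κ‖ := hκ.trans_le (Complex.re_le_norm κ)
  have hbound := h.norm_mul_norm_le hq hκ.le hI hx
  rw [h0, h0', mul_zero, add_zero, sub_zero, norm_one] at hbound
  rw [div_mul_eq_mul_div, le_div_iff₀ hnorm]
  linarith

theorem sine_error_le (hq : ∫ y in 0..δ, |q y| ≤ ‖κ‖ / 4) (hκ : 0 < κ.re) :
    4 / 3 / ‖κ‖ * ∫ y in 0..δ, |q y| ≤ 1 / 3 := by
  have hnorm : 0 < ‖κ‖ := hκ.trans_le (Complex.re_le_norm κ)
  rw [div_mul_eq_mul_div, div_le_iff₀ hnorm]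
  linarith

theorem SolvesOn.le_norm_sine_deriv_add (h : SolvesOn q (-κ ^ 2) 0 δ φ φ')
    (hq : IntervalIntegrable q volume 0 δ) (hκ : 0 < κ.re) (hI : ∫ y in 0..δ, |q y| ≤ ‖κ‖ / 4)
    (h0 : φ 0 = 0) (h0' : φ' 0 = 1) (hx : x ∈ Icc 0 δ) :
    2 / 3 * Real.exp (κ.re * x) ≤ ‖φ' x + κ * φ x‖ := by
  have hdev := (h.norm_exp_neg_mul_sub_le hq (fun y hy => h.norm_sine_le hq hκ hI h0 h0' hy)
    hx).trans (sine_error_le hI hκ)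
  rw [h0, h0', mul_zero, add_zero] at hdev
  have hlower : 2 / 3 ≤ ‖Complex.exp (-κ * x) * (φ' x + κ * φ x)‖ := by
    have := norm_sub_norm_le (1 : ℂ) (1 - Complex.exp (-κ * x) * (φ' x + κ * φ x))
    rw [norm_sub_rev 1, norm_one, sub_sub_cancel] at this
    linarith
  rwa [norm_mul, norm_cexp_mul_ofReal, Complex.neg_re, neg_mul, Real.exp_neg,
    le_inv_mul_iff₀ (Real.exp_pos _), mul_comm] at hlower

theorem SolvesOn.le_norm_sine (h : SolvesOn q (-κ ^ 2) 0 δ φ φ')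
    (hq : IntervalIntegrable q volume 0 δ) (hκ : 0 < κ.re) (hI : ∫ y in 0..δ, |q y| ≤ ‖κ‖ / 4)
    (h0 : φ 0 = 0) (h0' : φ' 0 = 1) (hx : x ∈ Icc 0 δ) :
    Real.exp (κ.re * x) / 3 - Real.exp (-(κ.re * x)) ≤ 2 * ‖κ‖ * ‖φ x‖ := by
  have hdev := (h.norm_two_mul_sub_le hq hκ.le (fun y hy => h.norm_sine_le hq hκ hI h0 h0' hy)
    hx).trans (mul_le_mul_of_nonneg_left (sine_error_le hI hκ) (by positivity))
  rw [h0, h0', mul_zero, add_zero, sub_zero, mul_one, mul_one, norm_sub_rev] at hdev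
  have hfree : Real.exp (κ.re * x) - Real.exp (-(κ.re * x))
      ≤ ‖Complex.exp (κ * x) - Complex.exp (-κ * x)‖ := by
    have := norm_sub_norm_le (Complex.exp (κ * x)) (Complex.exp (-κ * x))
    rwa [norm_cexp_mul_ofReal, norm_cexp_mul_ofReal, Complex.neg_re, neg_mul] at this
  have hsub := norm_sub_norm_le (Complex.exp (κ * x) - Complex.exp (-κ * x)) (2 * κ * φ x)
  rw [norm_mul, norm_mul, Complex.norm_ofNat] at hsub
  linarith

theorem exp_two_mul : Real.exp (2 * κ.re * x) = Real.exp (κ.re * x) ^ 2 := by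
  rw [← Real.exp_nat_mul]
  push_cast
  ring_nf

theorem SolvesOn.exp_div_le_norm_sine_sq (h : SolvesOn q (-κ ^ 2) 0 δ φ φ')
    (hq : IntervalIntegrable q volume 0 δ) (hκ : 0 < κ.re) (hI : ∫ y in 0..δ, |q y| ≤ ‖κ‖ / 4)
    (h0 : φ 0 = 0) (h0' : φ' 0 = 1) (hx : x ∈ Icc 0 δ) (hexp : 12 ≤ Real.exp (2 * κ.re * x)) :
    Real.exp (2 * κ.re * x) / (64 * ‖κ‖ ^ 2) ≤ ‖φ x‖ ^ 2 := by
  have hnorm : 0 < ‖κ‖ := hκ.trans_le (Complex.re_le_norm κ)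
  have hdecay : Real.exp (-(κ.re * x)) ≤ Real.exp (κ.re * x) / 12 := by
    rw [Real.exp_neg, inv_le_iff_one_le_mul₀ (Real.exp_pos _)]
    rw [exp_two_mul] at hexp
    linarith
  have hlower : Real.exp (κ.re * x) / 8 ≤ ‖κ‖ * ‖φ x‖ := by
    linarith [h.le_norm_sine hq hκ hI h0 h0' hx]
  rw [div_le_iff₀ (by positivity), exp_two_mul]
  calc Real.exp (κ.re * x) ^ 2 = 64 * (Real.exp (κ.re * x) / 8) ^ 2 := by ring
    _ ≤ 64 * (‖κ‖ * ‖φ x‖) ^ 2 := by gcongr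
    _ = ‖φ x‖ ^ 2 * (64 * ‖κ‖ ^ 2) := by ring

theorem integral_exp_mul {c : ℝ} (hc : c ≠ 0) (a b : ℝ) :
    ∫ y in a..b, Real.exp (c * y) = (Real.exp (c * b) - Real.exp (c * a)) / c := by
  rw [intervalIntegral.integral_comp_mul_left _ hc, integral_exp, smul_eq_mul, inv_mul_eq_div]

theorem six_le_exp_mul (hlog : Real.log 6 ≤ δ * κ.re) : 6 ≤ Real.exp (κ.re * δ) := by
  rwa [← Real.log_le_iff_le_exp (by norm_num), mul_comm]

theorem SolvesOn.le_integral_norm_sine_sq (h : SolvesOn q (-κ ^ 2) 0 δ φ φ')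
    (hq : IntervalIntegrable q volume 0 δ) (hκ : 0 < κ.re) (hI : ∫ y in 0..δ, |q y| ≤ ‖κ‖ / 4)
    (h0 : φ 0 = 0) (h0' : φ' 0 = 1) (hlog : Real.log 6 ≤ δ * κ.re) :
    Real.exp (2 * κ.re * δ) / (192 * κ.re * ‖κ‖ ^ 2) ≤ ∫ y in 0..δ, ‖φ y‖ ^ 2 := by
  have hnorm : 0 < ‖κ‖ := hκ.trans_le (Complex.re_le_norm κ)
  have h2κ : 0 < 2 * κ.re := by positivity
  have hexp : 36 ≤ Real.exp (2 * κ.re * δ) := by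
    rw [exp_two_mul]
    nlinarith [six_le_exp_mul hlog]
  -- The lower bound for `φ` is effective from the point where `exp (2 Re κ x) = 12`.
  obtain ⟨x₁, hx₁⟩ : ∃ x₁, Real.exp (2 * κ.re * x₁) = 12 :=
    ⟨Real.log 12 / (2 * κ.re), by rw [mul_div_cancel₀ _ h2κ.ne', Real.exp_log (by norm_num)]⟩
  have hx₁0 : 0 ≤ x₁ := by
    have : 1 ≤ Real.exp (2 * κ.re * x₁) := by rw [hx₁]; norm_num
    exact (mul_nonneg_iff_of_pos_left h2κ).1 (Real.one_le_exp_iff.1 this)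
  have hx₁δ : x₁ ≤ δ := by
    have : Real.exp (2 * κ.re * x₁) ≤ Real.exp (2 * κ.re * δ) := by linarith
    exact le_of_mul_le_mul_left (Real.exp_le_exp.1 this) h2κ
  have hmem : x₁ ∈ uIcc 0 δ := Icc_subset_uIcc ⟨hx₁0, hx₁δ⟩
  calc Real.exp (2 * κ.re * δ) / (192 * κ.re * ‖κ‖ ^ 2)
      ≤ (Real.exp (2 * κ.re * δ) - 12) / (2 * κ.re) / (64 * ‖κ‖ ^ 2) := by
        rw [div_div, div_le_div_iff₀ (by positivity) (by positivity)]
        nlinarith [mul_pos hκ (pow_pos hnorm 2)]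
    _ = ∫ y in x₁..δ, Real.exp (2 * κ.re * y) / (64 * ‖κ‖ ^ 2) := by
        rw [intervalIntegral.integral_div, integral_exp_mul h2κ.ne', hx₁]
    _ ≤ ∫ y in x₁..δ, ‖φ y‖ ^ 2 := by
        refine intervalIntegral.integral_mono_on hx₁δ
          (Continuous.intervalIntegrable (by fun_prop) _ _)
          (h.intervalIntegrable_norm_sq hmem right_mem_uIcc) fun y hy => ?_
        refine h.exp_div_le_norm_sine_sq hq hκ hI h0 h0' ⟨hx₁0.trans hy.1, hy.2⟩ ?_
        rw [← hx₁]
        gcongr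
        exact hy.1
    _ ≤ ∫ y in 0..δ, ‖φ y‖ ^ 2 :=
        intervalIntegral.integral_mono_interval hx₁0 hx₁δ le_rfl
          (Eventually.of_forall fun y => by positivity)
          (h.intervalIntegrable_norm_sq left_mem_uIcc right_mem_uIcc)

end SineSolution

section JostSolution

variable {q : ℝ → ℝ} {κ : ℂ} {δ : ℝ} {f f' : ℝ → ℂ}

theorem SolvesOn.norm_jost_le {y : ℝ} (h : SolvesOn q (-κ ^ 2) 0 δ f f')
    (hq : IntervalIntegrable q volume 0 δ) (hκ : 0 < κ.re) (hI : ∫ y in 0..δ, |q y| ≤ ‖κ‖ / 4)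
    (hδ : f δ = 1) (hδ' : f' δ = -κ) (hy : y ∈ Icc 0 δ) :
    ‖f y‖ ≤ 4 / 3 * Real.exp (κ.re * (δ - y)) := by
  have hnorm : 0 < ‖κ‖ := hκ.trans_le (Complex.re_le_norm κ)
  have hreflect : SolvesOn (fun x => q (δ - x)) (-κ ^ 2) 0 δ (fun x => f (δ - x))
      (fun x => -f' (δ - x)) := by
    refine SolvesOn.comp_sub_left δ (h.mono ?_ ?_) <;> simp
  have hqreflect : IntervalIntegrable (fun x => q (δ - x)) volume 0 δ := by
    simpa using (hq.comp_sub_left δ).symm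
  have hbound := hreflect.norm_mul_norm_le hqreflect hκ.le
    (by simpa [intervalIntegral.integral_comp_sub_left (fun x => |q x|)] using hI)
    (x := δ - y) ⟨sub_nonneg.2 hy.2, sub_le_self _ hy.1⟩
  rw [sub_sub_cancel, sub_zero, hδ, hδ', neg_neg, mul_one, sub_self, norm_zero, add_zero,
    ← two_mul, norm_mul, Complex.norm_ofNat] at hbound
  refine le_of_mul_le_mul_left (hbound.trans_eq ?_) hnorm
  ring

theorem SolvesOn.norm_jost_deriv_add_le (h : SolvesOn q (-κ ^ 2) 0 δ f f') (hδ0 : 0 ≤ δ)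
    (hq : IntervalIntegrable q volume 0 δ) (hκ : 0 < κ.re) (hI : ∫ y in 0..δ, |q y| ≤ ‖κ‖ / 4)
    (hδ : f δ = 1) (hδ' : f' δ = -κ) :
    ‖f' 0 + κ * f 0‖
      ≤ 4 / 3 * Real.exp (κ.re * δ) * ∫ y in 0..δ, Real.exp (-2 * κ.re * y) * |q y| := by
  have hvariation := h.isPrimitiveOn_exp_neg_mul.integral_eq_sub left_mem_uIcc right_mem_uIcc
  rw [hδ, hδ', mul_one, neg_add_cancel, mul_zero, Complex.ofReal_zero, mul_zero, Complex.exp_zero,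
    one_mul, zero_sub] at hvariation
  rw [← norm_neg, ← hvariation, ← intervalIntegral.integral_const_mul]
  refine intervalIntegral.norm_integral_le_of_norm_le hδ0 (Eventually.of_forall fun y hy => ?_)
    ((hq.abs.continuousOn_mul (by fun_prop)).const_mul _)
  rw [norm_mul, norm_mul, norm_cexp_mul_ofReal, Complex.norm_real, Real.norm_eq_abs]
  calc Real.exp ((-κ).re * y) * (|q y| * ‖f y‖)
      ≤ Real.exp ((-κ).re * y) * (|q y| * (4 / 3 * Real.exp (κ.re * (δ - y)))) := by
        gcongr
        exact h.norm_jost_le hq hκ hI hδ hδ' (Ioc_subset_Icc_self hy)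
    _ = 4 / 3 * Real.exp ((-κ).re * y + κ.re * (δ - y)) * |q y| := by
        rw [Real.exp_add]
        ring
    _ = 4 / 3 * Real.exp (κ.re * δ) * (Real.exp (-2 * κ.re * y) * |q y|) := by
        rw [Complex.neg_re, show -κ.re * y + κ.re * (δ - y) = κ.re * δ + -2 * κ.re * y by ring,
          Real.exp_add]
        ring

end JostSolution

/-! ### The Weyl disc of an interval -/

section Moebius

variable {v v' p p' : ℂ}

theorem norm_mul_abs_im_le (hsign : (conj v * v').im * (conj p * p').im ≤ 0) :
    ‖v‖ * |(conj p * p').im| ≤ ‖v * p' - v' * p‖ * ‖p‖ := by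
  rcases eq_or_ne v 0 with rfl | hv
  · rw [norm_zero, zero_mul]
    positivity
  have hidentity : (conj v * conj p * (v * p' - v' * p)).im
      = ‖v‖ ^ 2 * (conj p * p').im - ‖p‖ ^ 2 * (conj v * v').im := by
    rw [← Complex.im_ofReal_mul, ← Complex.im_ofReal_mul, ← Complex.sub_im]
    push_cast [← Complex.conj_mul']
    ring_nf
  have habs : |‖v‖ ^ 2 * (conj p * p').im| ≤ |(conj v * conj p * (v * p' - v' * p)).im| := by
    rw [hidentity, ← sq_le_sq]
    nlinarith [mul_nonneg (mul_nonneg (sq_nonneg ‖v‖) (sq_nonneg ‖p‖)) (neg_nonneg.2 hsign),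
      sq_nonneg (‖p‖ ^ 2 * (conj v * v').im)]
  refine le_of_mul_le_mul_left ?_ (norm_pos_iff.2 hv)
  calc ‖v‖ * (‖v‖ * |(conj p * p').im|) = |‖v‖ ^ 2 * (conj p * p').im| := by
        rw [abs_mul, abs_of_nonneg (sq_nonneg ‖v‖)]
        ring
    _ ≤ ‖conj v * conj p * (v * p' - v' * p)‖ := habs.trans (Complex.abs_im_le_norm _)
    _ = ‖v‖ * (‖v * p' - v' * p‖ * ‖p‖) := by
        rw [norm_mul, norm_mul, Complex.norm_conj, Complex.norm_conj]
        ring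

theorem wronskian_ne_zero_of_im_mul_im_nonpos
    (hsign : (conj v * v').im * (conj p * p').im ≤ 0) (hp : (conj p * p').im ≠ 0)
    (hv : v ≠ 0 ∨ v' ≠ 0) : v * p' - v' * p ≠ 0 := by
  intro hW
  have hv0 : v = 0 := by
    have hle := norm_mul_abs_im_le hsign
    rw [hW, norm_zero, zero_mul] at hle
    exact norm_le_zero_iff.1 (nonpos_of_mul_nonpos_left hle (abs_pos.2 hp))
  have hp0 : p ≠ 0 := fun h => hp (by simp [h])
  rcases hv with hv | hv
  · exact hv hv0
  · rw [hv0, zero_mul, zero_sub, neg_eq_zero] at hW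
    exact mul_ne_zero hv hp0 hW

theorem norm_add_mul_div_le {κ : ℂ} (hsign : (conj v * v').im * (conj p * p').im ≤ 0)
    (hp : (conj p * p').im ≠ 0) (hW : v * p' - v' * p ≠ 0) (hP : p' + κ * p ≠ 0) :
    ‖(v' + κ * v) / ((v * p' - v' * p) * (p' + κ * p))‖
      ≤ 1 / |(conj p * p').im| + 1 / (‖p‖ * ‖p' + κ * p‖) := by
  have hp0 : p ≠ 0 := fun h => hp (by simp [h])
  have hsplit : (v' + κ * v) / ((v * p' - v' * p) * (p' + κ * p))
      = v / ((v * p' - v' * p) * p) - 1 / (p * (p' + κ * p)) := by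
    rw [div_sub_div _ _ (mul_ne_zero hW hp0) (mul_ne_zero hp0 hP),
      div_eq_div_iff (mul_ne_zero hW hP) (mul_ne_zero (mul_ne_zero hW hp0) (mul_ne_zero hp0 hP))]
    ring
  have hfirst : ‖v / ((v * p' - v' * p) * p)‖ ≤ 1 / |(conj p * p').im| := by
    have hWp : 0 < ‖v * p' - v' * p‖ * ‖p‖ := by positivity
    rw [norm_div, norm_mul, div_le_div_iff₀ hWp (abs_pos.2 hp), one_mul]
    exact norm_mul_abs_im_le hsign
  rw [hsplit]
  refine (norm_sub_le _ _).trans (add_le_add hfirst (le_of_eq ?_))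
  rw [norm_div, norm_one, norm_mul]

end Moebius

section WeylDisc

variable {q : ℝ → ℝ} {κ : ℂ} {δ : ℝ} {u u' φ φ' f f' : ℝ → ℂ}

theorem exp_neg_two_mul : Real.exp (-2 * δ * κ.re) = 1 / Real.exp (κ.re * δ) ^ 2 := by
  rw [← Real.exp_nat_mul, one_div, ← Real.exp_neg]
  push_cast
  ring_nf

theorem SolvesOn.one_div_norm_sine_mul_le (h : SolvesOn q (-κ ^ 2) 0 δ φ φ') (hδ : 0 ≤ δ)
    (hq : IntervalIntegrable q volume 0 δ) (hκ : 0 < κ.re) (hI : ∫ y in 0..δ, |q y| ≤ ‖κ‖ / 4)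
    (hlog : Real.log 6 ≤ δ * κ.re) (him : κ.im ≠ 0) (h0 : φ 0 = 0) (h0' : φ' 0 = 1) :
    1 / (‖φ δ‖ * ‖φ' δ + κ * φ δ‖)
      ≤ 108 / 11 * (‖κ‖ ^ 2 / |κ.im|) * Real.exp (-2 * δ * κ.re) := by
  have hnorm : 0 < ‖κ‖ := hκ.trans_le (Complex.re_le_norm κ)
  have hX := six_le_exp_mul hlog
  have hdecay : Real.exp (-(κ.re * δ)) ≤ Real.exp (κ.re * δ) / 36 := by
    rw [Real.exp_neg, inv_le_iff_one_le_mul₀ (Real.exp_pos _)]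
    nlinarith
  have hφ : 11 / 72 * Real.exp (κ.re * δ) / ‖κ‖ ≤ ‖φ δ‖ := by
    rw [div_le_iff₀ hnorm]
    linarith [h.le_norm_sine hq hκ hI h0 h0' ⟨hδ, le_rfl⟩]
  have hP := h.le_norm_sine_deriv_add hq hκ hI h0 h0' ⟨hδ, le_rfl⟩
  have hκim : ‖κ‖ ≤ ‖κ‖ ^ 2 / |κ.im| := by
    rw [le_div_iff₀ (abs_pos.2 him), sq]
    gcongr
    exact Complex.abs_im_le_norm κ
  calc 1 / (‖φ δ‖ * ‖φ' δ + κ * φ δ‖)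
      ≤ 1 / (11 / 72 * Real.exp (κ.re * δ) / ‖κ‖ * (2 / 3 * Real.exp (κ.re * δ))) := by gcongr
    _ = 108 / 11 * ‖κ‖ * Real.exp (-2 * δ * κ.re) := by
        rw [exp_neg_two_mul]
        field_simp
        norm_num
    _ ≤ 108 / 11 * (‖κ‖ ^ 2 / |κ.im|) * Real.exp (-2 * δ * κ.re) := by gcongr

theorem SolvesOn.one_div_abs_im_sine_le (h : SolvesOn q (-κ ^ 2) 0 δ φ φ')
    (hq : IntervalIntegrable q volume 0 δ) (hκ : 0 < κ.re) (hI : ∫ y in 0..δ, |q y| ≤ ‖κ‖ / 4)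
    (hlog : Real.log 6 ≤ δ * κ.re) (him : κ.im ≠ 0) (h0 : φ 0 = 0) (h0' : φ' 0 = 1) :
    1 / (|(-κ ^ 2).im| * ∫ y in 0..δ, ‖φ y‖ ^ 2)
      ≤ 96 * (‖κ‖ ^ 2 / |κ.im|) * Real.exp (-2 * δ * κ.re) := by
  have hnorm : 0 < ‖κ‖ := hκ.trans_le (Complex.re_le_norm κ)
  have hlower := h.le_integral_norm_sine_sq hq hκ hI h0 h0' hlog
  have habs : |(-κ ^ 2).im| = 2 * κ.re * |κ.im| := by
    rw [im_neg_sq, abs_mul, abs_mul, abs_of_pos hκ, abs_neg, Nat.abs_ofNat]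
  have := abs_pos.2 him
  calc 1 / (|(-κ ^ 2).im| * ∫ y in 0..δ, ‖φ y‖ ^ 2)
      ≤ 1 / (2 * κ.re * |κ.im| * (Real.exp (2 * κ.re * δ) / (192 * κ.re * ‖κ‖ ^ 2))) := by
        rw [habs]
        gcongr
    _ = 96 * (‖κ‖ ^ 2 / |κ.im|) * Real.exp (-2 * δ * κ.re) := by
        rw [exp_neg_two_mul, exp_two_mul]
        field_simp
        norm_num

theorem SolvesOn.im_sine {z : ℂ} (h : SolvesOn q z 0 δ φ φ') (h0 : φ 0 = 0) :
    (conj (φ δ) * φ' δ).im = -(z.im * ∫ y in 0..δ, ‖φ y‖ ^ 2) := by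
  have hgreen := h.im_sub_im left_mem_uIcc right_mem_uIcc
  rwa [h0, map_zero, zero_mul, Complex.zero_im, sub_zero, neg_mul] at hgreen

theorem SolvesOn.jost_zero (hf : SolvesOn q (-κ ^ 2) 0 δ f f') (hφ : SolvesOn q (-κ ^ 2) 0 δ φ φ')
    (hf1 : f δ = 1) (hf1' : f' δ = -κ) (h0 : φ 0 = 0) (h0' : φ' 0 = 1) :
    φ' δ + κ * φ δ = f 0 := by
  simpa [hf1, hf1', h0, h0'] using hf.wronskian_eq hφ right_mem_uIcc

theorem logDeriv_add_eq (hf : SolvesOn q (-κ ^ 2) 0 δ f f') (hu : SolvesOn q (-κ ^ 2) 0 δ u u')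
    (hf1 : f δ = 1) (hf1' : f' δ = -κ) (hu0 : u 0 ≠ 0) (hf0 : f 0 ≠ 0) :
    u' 0 / u 0 + κ = (f' 0 + κ * f 0) / f 0 + (u' δ + κ * u δ) / (u 0 * f 0) := by
  have hW := hf.wronskian_eq hu right_mem_uIcc
  rw [hf1, hf1'] at hW
  field_simp
  linear_combination -hW

theorem SolvesOn.le_norm_jost (hf : SolvesOn q (-κ ^ 2) 0 δ f f') (hδ : 0 ≤ δ)
    (hq : IntegrableOn q (Ioo 0 δ)) (hκ : 0 < κ.re) (hI : ∫ y in 0..δ, |q y| ≤ ‖κ‖ / 4)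
    (hf1 : f δ = 1) (hf1' : f' δ = -κ) : 2 / 3 * Real.exp (κ.re * δ) ≤ ‖f 0‖ := by
  obtain ⟨φ, φ', h0, h0', hφ⟩ := exists_solvesOn hδ hq (-κ ^ 2) 0 1
  rw [← hf.jost_zero hφ hf1 hf1' h0 h0']
  exact hφ.le_norm_sine_deriv_add ((intervalIntegrable_iff_integrableOn_Ioo_of_le hδ).2 hq) hκ hI
    h0 h0' ⟨hδ, le_rfl⟩

theorem SolvesOn.norm_jost_logDeriv_add_le (hf : SolvesOn q (-κ ^ 2) 0 δ f f') (hδ : 0 ≤ δ)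
    (hq : IntegrableOn q (Ioo 0 δ)) (hκ : 0 < κ.re) (hI : ∫ y in 0..δ, |q y| ≤ ‖κ‖ / 4)
    (hf1 : f δ = 1) (hf1' : f' δ = -κ) :
    ‖(f' 0 + κ * f 0) / f 0‖ ≤ 2 * ∫ y in 0..δ, Real.exp (-2 * κ.re * y) * |q y| := by
  have hf0 := hf.le_norm_jost hδ hq hκ hI hf1 hf1'
  have hI0 : 0 ≤ ∫ y in 0..δ, Real.exp (-2 * κ.re * y) * |q y| :=
    intervalIntegral.integral_nonneg hδ fun y _ => by positivity
  rw [norm_div, div_le_iff₀ (lt_of_lt_of_le (by positivity) hf0)]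
  calc ‖f' 0 + κ * f 0‖
      ≤ 4 / 3 * Real.exp (κ.re * δ) * ∫ y in 0..δ, Real.exp (-2 * κ.re * y) * |q y| :=
        hf.norm_jost_deriv_add_le hδ ((intervalIntegrable_iff_integrableOn_Ioo_of_le hδ).2 hq) hκ hI
          hf1 hf1'
    _ = 2 * (∫ y in 0..δ, Real.exp (-2 * κ.re * y) * |q y|) * (2 / 3 * Real.exp (κ.re * δ)) := by
        ring
    _ ≤ _ := by gcongr

theorem SolvesOn.norm_remainder_le (hu : SolvesOn q (-κ ^ 2) 0 δ u u')
    (hφ : SolvesOn q (-κ ^ 2) 0 δ φ φ') (hδ : 0 ≤ δ) (hq : IntervalIntegrable q volume 0 δ)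
    (hκ : 0 < κ.re) (hI : ∫ y in 0..δ, |q y| ≤ ‖κ‖ / 4) (hlog : Real.log 6 ≤ δ * κ.re)
    (him : κ.im ≠ 0) (h0 : φ 0 = 0) (h0' : φ' 0 = 1)
    (hsign : 0 ≤ (conj (u δ) * u' δ).im * (-κ ^ 2).im) (hne : u δ ≠ 0 ∨ u' δ ≠ 0) :
    u 0 ≠ 0 ∧ ‖(u' δ + κ * u δ) / (u 0 * (φ' δ + κ * φ δ))‖
      ≤ 864 / 5 * (‖κ‖ ^ 2 / |κ.im|) * Real.exp (-2 * δ * κ.re) := by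
  have hnorm : 0 < ‖κ‖ := hκ.trans_le (Complex.re_le_norm κ)
  have hJ : 0 < ∫ y in 0..δ, ‖φ y‖ ^ 2 :=
    lt_of_lt_of_le (by positivity) (hφ.le_integral_norm_sine_sq hq hκ hI h0 h0' hlog)
  have hφu : u δ * φ' δ - u' δ * φ δ = u 0 := by
    simpa [h0, h0'] using hu.wronskian_eq hφ right_mem_uIcc
  have hφsign : (conj (u δ) * u' δ).im * (conj (φ δ) * φ' δ).im ≤ 0 := by
    rw [hφ.im_sine h0]
    linarith [mul_nonneg hsign hJ.le]
  have hφim : (conj (φ δ) * φ' δ).im ≠ 0 := by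
    rw [hφ.im_sine h0]
    exact neg_ne_zero.2 (mul_ne_zero (im_neg_sq_ne_zero hκ him) hJ.ne')
  have hP : φ' δ + κ * φ δ ≠ 0 := norm_pos_iff.1 (lt_of_lt_of_le (by positivity)
    (hφ.le_norm_sine_deriv_add hq hκ hI h0 h0' ⟨hδ, le_rfl⟩))
  have hu0 := wronskian_ne_zero_of_im_mul_im_nonpos hφsign hφim hne
  have hbound := norm_add_mul_div_le hφsign hφim hu0 hP
  rw [hφu] at hu0 hbound
  rw [hφ.im_sine h0, abs_neg, abs_mul, abs_of_pos hJ] at hbound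
  have hX : 0 ≤ ‖κ‖ ^ 2 / |κ.im| * Real.exp (-2 * δ * κ.re) := by positivity
  refine ⟨hu0, ?_⟩
  linarith [hφ.one_div_abs_im_sine_le hq hκ hI hlog him h0 h0',
    hφ.one_div_norm_sine_mul_le hδ hq hκ hI hlog him h0 h0']

theorem logDeriv_add_le (hδ : 0 < δ) (hq : IntegrableOn q (Ioo 0 δ))
    (hI : ∫ y in 0..δ, |q y| ≤ κ.re / 4) (hlog : Real.log 6 ≤ δ * κ.re) (him : κ.im ≠ 0)
    (hu : SolvesOn q (-κ ^ 2) 0 δ u u') (hsign : 0 ≤ (conj (u δ) * u' δ).im * (-κ ^ 2).im)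
    (hne : u δ ≠ 0 ∨ u' δ ≠ 0) :
    u 0 ≠ 0 ∧ ‖u' 0 / u 0 + κ‖ ≤ 2 * (∫ y in 0..δ, Real.exp (-2 * κ.re * y) * |q y|)
      + 864 / 5 * (‖κ‖ ^ 2 / |κ.im|) * Real.exp (-2 * δ * κ.re) := by
  have hκ : 0 < κ.re := pos_of_mul_pos_right ((Real.log_pos (by norm_num)).trans_le hlog) hδ.le
  have hI' : ∫ y in 0..δ, |q y| ≤ ‖κ‖ / 4 := by linarith [Complex.re_le_norm κ]
  obtain ⟨φ, φ', h0, h0', hφ⟩ := exists_solvesOn hδ.le hq (-κ ^ 2) 0 1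
  obtain ⟨f, f', hf1, hf1', hf⟩ := exists_solvesOn_final hδ.le hq (-κ ^ 2) 1 (-κ)
  have hf0 : f 0 ≠ 0 := norm_pos_iff.1
    (lt_of_lt_of_le (by positivity) (hf.le_norm_jost hδ.le hq hκ hI' hf1 hf1'))
  obtain ⟨hu0, hremainder⟩ := hu.norm_remainder_le hφ hδ.le
    ((intervalIntegrable_iff_integrableOn_Ioo_of_le hδ.le).2 hq) hκ hI' hlog him h0 h0' hsign hne
  rw [hf.jost_zero hφ hf1 hf1' h0 h0'] at hremainder
  refine ⟨hu0, ?_⟩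
  rw [logDeriv_add_eq hf hu hf1 hf1' hu0 hf0]
  exact (norm_add_le _ _).trans
    (add_le_add (hf.norm_jost_logDeriv_add_le hδ.le hq hκ hI' hf1 hf1') hremainder)

end WeylDisc

/-! ### Weyl solutions -/

theorem IsPrimitiveOn.hasDerivWithinAt {E : Type*} [NormedAddCommGroup E] [NormedSpace ℝ E]
    [CompleteSpace E] {f f' : ℝ → E} {a b x : ℝ} (hf : IsPrimitiveOn f f' a b)
    (hf' : ContinuousOn f' (uIcc a b)) (hx : x ∈ uIcc a b) :
    HasDerivWithinAt f (f' x) (uIcc a b) x := by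
  have : Fact (x ∈ Icc (min a b) (max a b)) := ⟨hx⟩
  have hderiv : HasDerivWithinAt (fun y => ∫ t in a..y, f' t) (f' x) (uIcc a b) x :=
    intervalIntegral.integral_hasDerivWithinAt_right (s := Icc (min a b) (max a b))
      (t := Icc (min a b) (max a b)) (hf.intervalIntegrable_of_mem left_mem_uIcc hx)
      (hf'.stronglyMeasurableAtFilter_nhdsWithin measurableSet_uIcc x) (hf' x hx)
  exact (hderiv.const_add (f a)).congr hf.eq_add_integral (hf.eq_add_integral x hx)

section Solutions

variable {q : ℝ → ℝ} {z : ℂ} {I : Set ℝ} {c x : ℝ} {u u' v v' : ℝ → ℂ} {e : Endpoint}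

theorem IsSolution.solvesOn (h : IsSolution q z I u u') (hc : 0 ≤ c) (hI : Icc 0 c ⊆ I)
    (hq : IntegrableOn q (Ioo 0 c)) : SolvesOn q z 0 c u u' := by
  rw [← uIcc_of_le hc] at hI
  have hac := h.absCont c (hI right_mem_uIcc)
  have hcont : ContinuousOn u (uIcc 0 c) := fun x hx =>
    ((h.hasDeriv x (hI hx)).mono hI).continuousWithinAt
  have hqi : IntervalIntegrable (fun x => (q x : ℂ)) volume 0 c :=
    (intervalIntegrable_iff_integrableOn_Ioo_of_le hc).2 hq.ofReal
  refine ⟨⟨hac.continuousOn.intervalIntegrable, fun x hx => ?_⟩,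
    .of_absolutelyContinuousOnInterval hac ?_ ?_⟩
  · have hsub : uIcc 0 x ⊆ uIcc 0 c := uIcc_subset_uIcc left_mem_uIcc hx
    rw [intervalIntegral.integral_eq_sub_of_hasDeriv_right (hcont.mono hsub) (fun y hy => ?_)
      (hac.continuousOn.mono hsub).intervalIntegrable, add_sub_cancel]
    have hnhds : uIcc 0 c ∈ 𝓝 y := mem_of_superset (Icc_mem_nhds hy.1 hy.2) hsub
    exact ((h.hasDeriv y (hI (mem_of_mem_nhds hnhds))).hasDerivAt
      (mem_of_superset hnhds hI)).hasDerivWithinAt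
  · exact (hqi.sub intervalIntegrable_const).mul_continuousOn hcont
  · rw [← ae_restrict_iff' measurableSet_uIoc]
    exact ae_restrict_of_ae_restrict_of_subset (uIoc_subset_uIcc.trans hI) h.equation

theorem exists_Icc_mem_nhdsWithin (hI : I ⊆ Ici 0) (hx : x ∈ I) :
    ∃ c ∈ I, x ∈ Icc 0 c ∧ Icc 0 c ∈ 𝓝[I] x := by
  by_cases hmax : ∃ c ∈ I, x < c
  · obtain ⟨c, hc, hxc⟩ := hmax
    refine ⟨c, hc, ⟨hI hx, hxc.le⟩, ?_⟩
    filter_upwards [self_mem_nhdsWithin, mem_nhdsWithin_of_mem_nhds (Iic_mem_nhds hxc)]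
      with y hyI hyc using ⟨hI hyI, hyc⟩
  · push Not at hmax
    exact ⟨x, hx, ⟨hI hx, le_rfl⟩,
      mem_of_superset self_mem_nhdsWithin fun y hy => ⟨hI hy, hmax y hy⟩⟩

theorem SolvesOn.ae_hasDerivAt_deriv (h : SolvesOn q z 0 c u u') :
    ∀ᵐ x, x ∈ Icc 0 c → HasDerivAt u' (((q x : ℂ) - z) * u x) x := by
  have hne : ∀ᵐ x : ℝ, x ≠ 0 := by simp [ae_iff, measure_singleton]
  filter_upwards [h.isPrimitiveOn_deriv.ae_hasDerivAt, hne] with x hx hx0 hmem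
  refine hx ?_
  rw [uIoc_of_le (hmem.1.trans hmem.2)]
  exact ⟨lt_of_le_of_ne hmem.1 hx0.symm, hmem.2⟩

theorem isSolution_of_solvesOn (hI : I ⊆ Ici 0) (hIc : I.OrdConnected)
    (h : ∀ c ∈ I, SolvesOn q z 0 c u u') : IsSolution q z I u u' where
  hasDeriv x hx := by
    obtain ⟨c, hc, hxc, hnhds⟩ := exists_Icc_mem_nhdsWithin hI hx
    rw [← uIcc_of_le (hI hc)] at hxc hnhds
    exact ((h c hc).isPrimitiveOn.hasDerivWithinAt (h c hc).continuousOn_deriv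
      hxc).mono_of_mem_nhdsWithin hnhds
  absCont c hc := (h c hc).isPrimitiveOn_deriv.absolutelyContinuousOnInterval
  equation := by
    rw [ae_restrict_iff' hIc.measurableSet, ae_iff]
    refine measure_null_of_locally_null _ fun x hx => ?_
    obtain ⟨c, hc, -, hnhds⟩ := exists_Icc_mem_nhdsWithin hI (Classical.not_imp.1 hx).1
    have hsub : {x | ¬(x ∈ I → HasDerivAt u' (((q x : ℂ) - z) * u x) x)} ⊆ I :=
      fun y hy => (Classical.not_imp.1 hy).1
    refine ⟨_, inter_mem (nhdsWithin_mono x hsub hnhds) self_mem_nhdsWithin,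
      measure_mono_null (fun y hy => ?_) (h c hc).ae_hasDerivAt_deriv⟩
    exact fun hderiv => hy.2 fun _ => hderiv hy.1

theorem IsSolution.isNonzeroOn (h : IsSolution q z I u u') (hI : UniqueDiffOn ℝ I) (h0I : 0 ∈ I)
    (h0 : u 0 ≠ 0 ∨ u' 0 ≠ 0) : IsNonzeroOn I u := by
  contrapose! h0
  have hzero : ∀ x ∈ I, u x = 0 := fun x hx => by_contra fun hne => h0 ⟨x, hx, hne⟩
  have hderiv : HasDerivWithinAt u 0 I 0 :=
    (hasDerivWithinAt_const 0 I 0).congr hzero (hzero 0 h0I)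
  exact ⟨hzero 0 h0I, (hI 0 h0I).eq_deriv _ (h.hasDeriv 0 h0I) hderiv⟩

theorem LocallyIntegrableHalfLine.integrableOn (hq : LocallyIntegrableHalfLine q) (c : ℝ) :
    IntegrableOn q (Ioo 0 c) := by
  rcases lt_or_ge 0 c with h | h
  · exact hq c h
  · rw [Ioo_eq_empty h.not_gt]
    exact integrableOn_empty

theorem IsSolution.solvesOn_halfLine (hq : LocallyIntegrableHalfLine q)
    (h : IsSolution q z (Ici 0) u u') (c : ℝ) (hc : 0 ≤ c) : SolvesOn q z 0 c u u' :=
  h.solvesOn hc Icc_subset_Ici_self (hq.integrableOn c)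

theorem isSolution_halfLine (h : ∀ c, 0 ≤ c → SolvesOn q z 0 c u u') :
    IsSolution q z (Ici 0) u u' :=
  isSolution_of_solvesOn Subset.rfl ordConnected_Ici h

namespace Endpoint

theorem interval_subset : e.interval ⊆ Ici 0 := by
  cases e with
  | regular b h => exact Icc_subset_Ici_self
  | squareIntegrable => exact Subset.rfl
  | limitCircle u₀ u₀' => exact Subset.rfl

theorem Icc_subset_interval (hc : c ∈ e.interval) : Icc 0 c ⊆ e.interval := by
  cases e with
  | regular b h => exact Icc_subset_Icc_right hc.2
  | squareIntegrable => exact Icc_subset_Ici_self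
  | limitCircle u₀ u₀' => exact Icc_subset_Ici_self

theorem integrableOn (he : e.Admissible q) (hc : c ∈ e.interval) :
    IntegrableOn q (Ioo 0 c) := by
  cases e with
  | regular b h => exact he.2.mono_set (Ioo_subset_Ioo_right hc.2)
  | squareIntegrable => exact he.1.integrableOn c
  | limitCircle u₀ u₀' => exact he.1.integrableOn c

theorem mem_interval_of_le (hc : 0 ≤ c) (h : (c : EReal) ≤ e.right) : c ∈ e.interval := by
  cases e with
  | regular b h' => exact ⟨hc, EReal.coe_le_coe_iff.1 h⟩
  | squareIntegrable => exact hc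
  | limitCircle u₀ u₀' => exact hc

theorem solvesOn (he : e.Admissible q) (h : IsSolution q z e.interval u u')
    (hc : c ∈ e.interval) : SolvesOn q z 0 c u u' :=
  h.solvesOn (interval_subset hc) (Icc_subset_interval hc) (integrableOn he hc)

theorem initial_ne_zero (he : e.Admissible q) (h : IsSolution q z e.interval u u')
    (hn : IsNonzeroOn e.interval u) : u 0 ≠ 0 ∨ u' 0 ≠ 0 := by
  by_contra! h0
  obtain ⟨x, hx, hux⟩ := hn
  have hsol := solvesOn he h hx
  refine hux ?_
  simpa using (hsol.eq_of_initial (interval_subset hx) (integrableOn he hx) (hsol.const_mul 0)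
    (by simpa using h0.1) (by simpa using h0.2) ⟨interval_subset hx, le_rfl⟩).1

end Endpoint

theorem SolvesOn.im_mul_im_anti {a b c d : ℝ} (h : SolvesOn q z a b u u') (hc : c ∈ uIcc a b)
    (hd : d ∈ uIcc a b) (hcd : c ≤ d) :
    (conj (u d) * u' d).im * z.im ≤ (conj (u c) * u' c).im * z.im := by
  have hidentity := h.im_sub_im hc hd
  have hintegral : 0 ≤ ∫ t in c..d, ‖u t‖ ^ 2 :=
    intervalIntegral.integral_nonneg hcd fun t _ => by positivity
  have := mul_nonneg (mul_self_nonneg z.im) hintegral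
  linear_combination this + z.im * hidentity

end Solutions

section WeylGenerator

variable {q : ℝ → ℝ} {e : Endpoint} {z : ℂ} {ψ ψ' : ℝ → ℂ}

/-- A Weyl solution `ψ` whose logarithmic derivative lies in the closed half-plane of `z` all along
the interval, and to which every other Weyl solution is proportional. This is all that the estimates
of the Weyl–Titchmarsh function need to know about the boundary condition. -/
structure IsWeylGenerator (q : ℝ → ℝ) (e : Endpoint) (z : ℂ) (ψ ψ' : ℝ → ℂ) : Prop where
  isWeylSolution : IsWeylSolution q e z ψ ψ'
  im_nonneg : ∀ x ∈ e.interval, 0 ≤ (conj (ψ x) * ψ' x).im * z.im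
  wronskian_eq : ∀ v v' : ℝ → ℂ, IsWeylSolution q e z v v' → ψ 0 * v' 0 - ψ' 0 * v 0 = 0

theorem IsWeylGenerator.isWeylM (he : e.Admissible q) (h : IsWeylGenerator q e z ψ ψ')
    (h0 : ψ 0 ≠ 0) : IsWeylM q e z (ψ' 0 / ψ 0) := by
  refine ⟨⟨ψ, ψ', h.isWeylSolution⟩, fun v v' hv => ?_⟩
  have hW := h.wronskian_eq v v' hv
  have hv0 : v 0 ≠ 0 := by
    intro hv0
    rw [hv0, mul_zero, sub_zero] at hW
    exact (mul_ne_zero h0 ((Endpoint.initial_ne_zero he hv.1 hv.2.1).resolve_left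
      (not_not_intro hv0))) hW
  refine ⟨hv0, ?_⟩
  rw [div_eq_div_iff hv0 h0]
  linear_combination hW

theorem exists_isWeylGenerator_regular_of_satisfies_iff {b : ℝ} {h : OnePoint ℝ} {A B : ℂ}
    (he : (Endpoint.regular b h).Admissible q) (z : ℂ) (hAB : A ≠ 0 ∨ B ≠ 0)
    (him : (conj A * B).im = 0)
    (hsat : ∀ v v' : ℝ → ℂ, (Endpoint.regular b h).Satisfies v v' ↔ A * v' b - B * v b = 0) :
    ∃ ψ ψ', IsWeylGenerator q (.regular b h) z ψ ψ' := by
  obtain ⟨hb, hq⟩ := he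
  obtain ⟨ψ, ψ', hψb, hψb', hψ⟩ := exists_solvesOn_final hb.le hq z A B
  have hsol : IsSolution q z (Icc 0 b) ψ ψ' :=
    isSolution_of_solvesOn Icc_subset_Ici_self ordConnected_Icc fun c hc =>
      hψ.mono left_mem_uIcc (Icc_subset_uIcc hc)
  have hψ0 : ψ 0 ≠ 0 ∨ ψ' 0 ≠ 0 := by
    contrapose! hAB
    have hzero := hψ.eq_of_initial hb.le hq (hψ.const_mul 0) (by simpa using hAB.1)
      (by simpa using hAB.2) ⟨hb.le, le_rfl⟩
    simpa [hψb, hψb'] using hzero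
  refine ⟨ψ, ψ', ⟨hsol, hsol.isNonzeroOn (uniqueDiffOn_Icc hb) ⟨le_rfl, hb.le⟩ hψ0,
    (hsat ψ ψ').2 (by rw [hψb, hψb']; ring)⟩, fun x hx => ?_, fun v v' hv => ?_⟩
  · have hle := hψ.im_mul_im_anti (Icc_subset_uIcc hx) right_mem_uIcc hx.2
    rwa [hψb, hψb', him, zero_mul] at hle
  · have hv0 := Endpoint.solvesOn (e := .regular b h) ⟨hb, hq⟩ hv.1 ⟨hb.le, le_rfl⟩
    rw [← hψ.wronskian_eq hv0 right_mem_uIcc, hψb, hψb']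
    exact (hsat v v').1 hv.2.2

theorem exists_isWeylGenerator_regular {b : ℝ} {h : OnePoint ℝ}
    (he : (Endpoint.regular b h).Admissible q) (z : ℂ) :
    ∃ ψ ψ', IsWeylGenerator q (.regular b h) z ψ ψ' := by
  cases h with
  | infty =>
    exact exists_isWeylGenerator_regular_of_satisfies_iff (A := 0) (B := 1) he z (by simp)
      (by simp) fun v v' => show v b = 0 ↔ _ by simp
  | coe h =>
    exact exists_isWeylGenerator_regular_of_satisfies_iff (A := 1) (B := -(h : ℂ)) he z (by simp)
      (by simp) fun v v' => show v' b + (h : ℂ) * v b = 0 ↔ _ by simp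

end WeylGenerator

/-! ### Square integrable solutions on the half-line -/

section HalfLine

theorem continuousOn_Ici_of_forall_uIcc {X : Type*} [TopologicalSpace X] {g : ℝ → X}
    (h : ∀ c, 0 ≤ c → ContinuousOn g (uIcc 0 c)) : ContinuousOn g (Ici 0) := by
  intro x hx
  obtain ⟨c, hc, hxc, hnhds⟩ := exists_Icc_mem_nhdsWithin Subset.rfl hx
  exact ((uIcc_of_le (mem_Ici.1 hc) ▸ h c hc) x hxc).mono_of_mem_nhdsWithin hnhds

theorem integrableOn_norm_sq_of_frequently_integral_le {E : Type*} [NormedAddCommGroup E]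
    {g : ℝ → E} {B : ℝ} (hg : ContinuousOn g (Ici 0))
    (hB : ∃ᶠ y in atTop, ∫ t in 0..y, ‖g t‖ ^ 2 ≤ B) :
    IntegrableOn (fun t => ‖g t‖ ^ 2) (Ioi 0) := by
  have hi {y : ℝ} (hy : 0 ≤ y) : IntervalIntegrable (fun t => ‖g t‖ ^ 2) volume 0 y :=
    ((hg.mono (uIcc_of_le hy ▸ Icc_subset_Ici_self)).norm.pow 2).intervalIntegrable
  have hle : ∀ᶠ y in atTop, ∫ t in 0..y, ‖‖g t‖ ^ 2‖ ≤ B := by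
    filter_upwards [eventually_ge_atTop 0] with y hy
    obtain ⟨w, hyw, hw⟩ := hB.forall_exists_of_atTop y
    simp only [norm_pow, norm_norm]
    exact (intervalIntegral.integral_mono_interval le_rfl hy hyw
      (Eventually.of_forall fun t => by positivity) (hi (hy.trans hyw))).trans hw
  refine integrableOn_Ioi_of_intervalIntegral_norm_bounded B 0 (fun n : ℕ => ?_)
    tendsto_natCast_atTop_atTop (tendsto_natCast_atTop_atTop.eventually hle)
  exact (intervalIntegrable_iff_integrableOn_Ioc_of_le n.cast_nonneg).1 (hi n.cast_nonneg)

theorem integrable_mul_of_integrable_norm_sq {X 𝕜 : Type*} [MeasurableSpace X]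
    [NormedDivisionRing 𝕜] {μ : Measure X} {f g : X → 𝕜} (hf : AEStronglyMeasurable f μ)
    (hg : AEStronglyMeasurable g μ) (hf2 : Integrable (fun x => ‖f x‖ ^ 2) μ)
    (hg2 : Integrable (fun x => ‖g x‖ ^ 2) μ) : Integrable (fun x => f x * g x) μ :=
  MemLp.integrable_mul ((memLp_two_iff_integrable_sq_norm hf).2 hf2)
    ((memLp_two_iff_integrable_sq_norm hg).2 hg2)

variable {q : ℝ → ℝ} {z z₁ z₂ : ℂ} {u u' v v' : ℝ → ℂ}

theorem solvesOn_of_halfLine (h : ∀ c, 0 ≤ c → SolvesOn q z 0 c u u') {a b : ℝ} (ha : 0 ≤ a)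
    (hb : 0 ≤ b) : SolvesOn q z a b u u' :=
  (h (max a b) (ha.trans (le_max_left a b))).mono (Icc_subset_uIcc ⟨ha, le_max_left a b⟩)
    (Icc_subset_uIcc ⟨hb, le_max_right a b⟩)

theorem continuousOn_halfLine (h : ∀ c, 0 ≤ c → SolvesOn q z 0 c u u') :
    ContinuousOn u (Ici 0) :=
  continuousOn_Ici_of_forall_uIcc fun c hc => (h c hc).continuousOn

theorem continuousOn_deriv_halfLine (h : ∀ c, 0 ≤ c → SolvesOn q z 0 c u u') :
    ContinuousOn u' (Ici 0) :=
  continuousOn_Ici_of_forall_uIcc fun c hc => (h c hc).continuousOn_deriv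

/-- A solution, with derivative `u'`, that is square integrable on the whole half-line. -/
structure IsL2Solution (q : ℝ → ℝ) (z : ℂ) (u u' : ℝ → ℂ) : Prop where
  solvesOn : ∀ c, 0 ≤ c → SolvesOn q z 0 c u u'
  integrableOn_norm_sq : IntegrableOn (fun x => ‖u x‖ ^ 2) (Ioi 0)

theorem IsL2AtInfinity.isL2Solution (hu : IsL2AtInfinity u)
    (h : ∀ c, 0 ≤ c → SolvesOn q z 0 c u u') : IsL2Solution q z u u' := by
  obtain ⟨R, hR, hi⟩ := hu
  refine ⟨h, ?_⟩
  rw [← Ioc_union_Ioi_eq_Ioi hR, ← uIoc_of_le hR]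
  exact (((h R hR).intervalIntegrable_norm_sq left_mem_uIcc right_mem_uIcc).def').union hi

namespace IsL2Solution

theorem isL2AtInfinity (h : IsL2Solution q z u u') : IsL2AtInfinity u :=
  ⟨0, le_rfl, h.integrableOn_norm_sq⟩

theorem star (h : IsL2Solution q z u u') :
    IsL2Solution q (conj z) (fun x => conj (u x)) (fun x => conj (u' x)) :=
  ⟨fun c hc => (h.solvesOn c hc).star, by simpa using h.integrableOn_norm_sq⟩

theorem aestronglyMeasurable (h : IsL2Solution q z u u') :
    AEStronglyMeasurable u (volume.restrict (Ioi 0)) :=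
  ((continuousOn_halfLine h.solvesOn).mono Ioi_subset_Ici_self).aestronglyMeasurable
    measurableSet_Ioi

theorem aestronglyMeasurable_deriv (h : IsL2Solution q z u u') :
    AEStronglyMeasurable u' (volume.restrict (Ioi 0)) :=
  ((continuousOn_deriv_halfLine h.solvesOn).mono Ioi_subset_Ici_self).aestronglyMeasurable
    measurableSet_Ioi

theorem exists_tendsto_wronskian (hu : IsL2Solution q z₁ u u') (hv : IsL2Solution q z₂ v v') :
    ∃ l : ℂ, Tendsto (fun x => u x * v' x - u' x * v x) atTop (𝓝 l) := by
  have hi : IntegrableOn (fun x => u x * v x) (Ioi 0) :=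
    integrable_mul_of_integrable_norm_sq hu.aestronglyMeasurable hv.aestronglyMeasurable
      hu.integrableOn_norm_sq hv.integrableOn_norm_sq
  have hlim := intervalIntegral_tendsto_integral_Ioi 0 (hi.const_mul (z₁ - z₂)) tendsto_id
  refine ⟨_, (hlim.const_add (u 0 * v' 0 - u' 0 * v 0)).congr' ?_⟩
  filter_upwards [eventually_ge_atTop 0] with x hx
  rw [((hu.solvesOn x hx).wronskian (hv.solvesOn x hx)).eq_add_integral x right_mem_uIcc]
  congr 1
  exact intervalIntegral.integral_congr fun t _ => by ring

theorem of_im_nonneg (hz : z.im ≠ 0) (h : ∀ c, 0 ≤ c → SolvesOn q z 0 c u u')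
    (him : ∀ x, 0 ≤ x → 0 ≤ (conj (u x) * u' x).im * z.im) : IsL2Solution q z u u' := by
  refine ⟨h, integrableOn_norm_sq_of_frequently_integral_le (continuousOn_halfLine h)
    (B := (conj (u 0) * u' 0).im * z.im / (z.im * z.im)) (Eventually.frequently ?_)⟩
  filter_upwards [eventually_ge_atTop 0] with y hy
  rw [le_div_iff₀ (mul_self_pos.2 hz)]
  linear_combination him y hy + z.im * (h y hy).im_sub_im left_mem_uIcc right_mem_uIcc

end IsL2Solution

theorem SolvesOn.integral_norm_sq_pos {c : ℝ} (hc : 0 < c) (h : SolvesOn q z 0 c u u')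
    (h0 : u 0 ≠ 0 ∨ u' 0 ≠ 0) : 0 < ∫ t in 0..c, ‖u t‖ ^ 2 := by
  have hcont : ContinuousOn u (Icc 0 c) := uIcc_of_le hc.le ▸ h.continuousOn
  have hsol : IsSolution q z (Icc 0 c) u u' :=
    isSolution_of_solvesOn Icc_subset_Ici_self ordConnected_Icc fun x hx =>
      h.mono left_mem_uIcc (Icc_subset_uIcc hx)
  obtain ⟨x, hx, hux⟩ := hsol.isNonzeroOn (uniqueDiffOn_Icc hc) ⟨le_rfl, hc.le⟩ h0
  exact intervalIntegral.integral_pos hc (hcont.norm.pow 2) (fun _ _ => by positivity)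
    ⟨x, hx, by positivity⟩

end HalfLine

section WeylDisc

variable {q : ℝ → ℝ} {z : ℂ} {c d : ℝ} {θ θ' φ φ' : ℝ → ℂ}

/-- The Weyl disc at `c`: the values `m` for which the logarithmic derivative of `θ + m φ` at `c`
lies in the closed half-plane of `z`. -/
def weylDisc (z : ℂ) (θ θ' φ φ' : ℝ → ℂ) (c : ℝ) : Set ℂ :=
  {m | 0 ≤ (conj (θ c + m * φ c) * (θ' c + m * φ' c)).im * z.im}

theorem isClosed_weylDisc : IsClosed (weylDisc z θ θ' φ φ' c) :=
  isClosed_le continuous_const (by fun_prop)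

theorem weylDisc_subset_weylDisc (hθ : SolvesOn q z c d θ θ') (hφ : SolvesOn q z c d φ φ')
    (hcd : c ≤ d) : weylDisc z θ θ' φ φ' d ⊆ weylDisc z θ θ' φ φ' c := fun m hm =>
  le_trans hm ((hθ.add (hφ.const_mul m)).im_mul_im_anti left_mem_uIcc right_mem_uIcc hcd)

theorem SolvesOn.im_mul_im_sine_neg (hz : z.im ≠ 0) (hc : 0 < c) (hφ : SolvesOn q z 0 c φ φ')
    (hφ0 : φ 0 = 0) (hφ0' : φ' 0 = 1) : (conj (φ c) * φ' c).im * z.im < 0 := by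
  have := mul_pos (mul_self_pos.2 hz) (hφ.integral_norm_sq_pos hc (Or.inr (by simp [hφ0'])))
  rw [hφ.im_sine hφ0]
  linarith

theorem weylDisc_nonempty (hφ : φ c ≠ 0) : (weylDisc z θ θ' φ φ' c).Nonempty :=
  ⟨-θ c / φ c, by
    rw [weylDisc, mem_ofPred_eq, div_mul_cancel₀ _ hφ, add_neg_cancel, map_zero, zero_mul,
      Complex.zero_im, zero_mul]⟩

theorem isBounded_weylDisc (hz : z.im ≠ 0) (hc : 0 < c) (hθ : SolvesOn q z 0 c θ θ')
    (hφ : SolvesOn q z 0 c φ φ') (hθ0 : θ 0 = 1) (hφ0 : φ 0 = 0) (hφ0' : φ' 0 = 1) :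
    Bornology.IsBounded (weylDisc z θ θ' φ φ' c) := by
  have hneg := hφ.im_mul_im_sine_neg hz hc hφ0 hφ0'
  set D := (conj (φ c) * φ' c).im
  have hD : 0 < |D| := abs_pos.2 (left_ne_zero_of_mul hneg.ne)
  have hφc : φ c ≠ 0 := fun h => hneg.ne (by simp [D, h])
  refine (isBounded_iff_forall_norm_le.2 ⟨(‖φ c‖ / |D| + ‖θ c‖) / ‖φ c‖, fun m hm => ?_⟩)
  have hW := (hθ.add (hφ.const_mul m)).wronskian_eq hφ right_mem_uIcc
  rw [hθ0, hφ0, hφ0', mul_zero, mul_zero, add_zero, sub_zero, mul_one] at hW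
  have hsign : (conj (θ c + m * φ c) * (θ' c + m * φ' c)).im * D ≤ 0 := by
    have hm' : 0 ≤ (conj (θ c + m * φ c) * (θ' c + m * φ' c)).im * z.im := hm
    nlinarith [mul_nonneg hm' (neg_nonneg.2 hneg.le), mul_self_pos.2 hz]
  have hle := norm_mul_abs_im_le hsign
  rw [hW, norm_one, one_mul, ← le_div_iff₀ hD] at hle
  rw [le_div_iff₀ (norm_pos_iff.2 hφc), ← norm_mul]
  calc ‖m * φ c‖ = ‖θ c + m * φ c - θ c‖ := by rw [add_sub_cancel_left]
    _ ≤ ‖φ c‖ / |D| + ‖θ c‖ := (norm_sub_le _ _).trans (by gcongr)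

theorem exists_isL2Solution (hq : LocallyIntegrableHalfLine q) (hz : z.im ≠ 0) :
    ∃ ψ ψ' : ℝ → ℂ, IsL2Solution q z ψ ψ' ∧ ψ 0 = 1 ∧
      ∀ x, 0 ≤ x → 0 ≤ (conj (ψ x) * ψ' x).im * z.im := by
  obtain ⟨θ, θ', hθ0, -, hθ⟩ := exists_solvesOn_halfLine hq z 1 0
  obtain ⟨φ, φ', hφ0, hφ0', hφ⟩ := exists_solvesOn_halfLine hq z 0 1
  have hpos : ∀ n : ℕ, (0 : ℝ) < n + 1 := fun n => by positivity
  have hanti {c d : ℝ} (hc : 0 ≤ c) (hcd : c ≤ d) :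
      weylDisc z θ θ' φ φ' d ⊆ weylDisc z θ θ' φ φ' c :=
    weylDisc_subset_weylDisc (solvesOn_of_halfLine hθ hc (hc.trans hcd))
      (solvesOn_of_halfLine hφ hc (hc.trans hcd)) hcd
  have hnonempty (n : ℕ) : (weylDisc z θ θ' φ φ' (n + 1)).Nonempty := by
    refine weylDisc_nonempty fun h => ?_
    simpa [h] using (hφ _ (hpos n).le).im_mul_im_sine_neg hz (hpos n) hφ0 hφ0'
  obtain ⟨m, hm⟩ := IsCompact.nonempty_iInter_of_sequence_nonempty_isCompact_isClosed
    (fun n : ℕ => weylDisc z θ θ' φ φ' (n + 1))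
    (fun n => hanti (hpos n).le (by push_cast; linarith)) hnonempty
    (Metric.isCompact_of_isClosed_isBounded isClosed_weylDisc
      (isBounded_weylDisc hz (hpos 0) (hθ _ (hpos 0).le) (hφ _ (hpos 0).le) hθ0 hφ0 hφ0'))
    fun n => isClosed_weylDisc
  have him : ∀ x, 0 ≤ x → 0 ≤ (conj (θ x + m * φ x) * (θ' x + m * φ' x)).im * z.im := fun x hx =>
    hanti hx ((Nat.le_ceil x).trans (le_add_of_nonneg_right zero_le_one)) (mem_iInter.1 hm ⌈x⌉₊)
  exact ⟨_, _, .of_im_nonneg hz (fun c hc => (hθ c hc).add ((hφ c hc).const_mul m)) him,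
    by simp [hθ0, hφ0], him⟩

end WeylDisc

/-! ### The limit point case -/

section LimitPoint

variable {q : ℝ → ℝ} {z : ℂ} {u u' v v' : ℝ → ℂ}

theorem IsLimitPoint.wronskian_eq_zero_of_im_pos (hp : IsLimitPoint q) (hz : 0 < z.im)
    (hu : IsL2Solution q z u u') (hv : IsL2Solution q z v v') : u 0 * v' 0 - u' 0 * v 0 = 0 := by
  obtain ⟨w, w', hw, -, -, hunique⟩ := hp z hz
  have hmul {v v' : ℝ → ℂ} (hv : IsL2Solution q z v v') : ∃ c, v 0 = c * w 0 ∧ v' 0 = c * w' 0 := by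
    have hsol := isSolution_halfLine hv.solvesOn
    obtain ⟨c, hc⟩ := hunique v v' hsol hv.isL2AtInfinity
    have hderiv : HasDerivWithinAt v (c * w' 0) (Ici 0) 0 :=
      ((hw.hasDeriv 0 self_mem_Ici).const_mul c).congr hc (hc 0 self_mem_Ici)
    exact ⟨c, hc 0 self_mem_Ici, (uniqueDiffOn_Ici 0 0 self_mem_Ici).eq_deriv _
      (hsol.hasDeriv 0 self_mem_Ici) hderiv⟩
  obtain ⟨c, hu0, hu0'⟩ := hmul hu
  obtain ⟨d, hv0, hv0'⟩ := hmul hv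
  rw [hu0, hu0', hv0, hv0']
  ring

theorem IsLimitPoint.wronskian_eq_zero (hp : IsLimitPoint q) (hz : z.im ≠ 0)
    (hu : IsL2Solution q z u u') (hv : IsL2Solution q z v v') : u 0 * v' 0 - u' 0 * v 0 = 0 := by
  rcases lt_or_gt_of_ne hz with hz | hz
  · simpa using congrArg conj (hp.wronskian_eq_zero_of_im_pos (by simpa using hz) hu.star hv.star)
  · exact hp.wronskian_eq_zero_of_im_pos hz hu hv

end LimitPoint

section EssentiallyBoundedBelow

variable {q p : ℝ → ℝ} {z : ℂ} {a b s t x ε M : ℝ} {u u' v v' : ℝ → ℂ}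

namespace SolvesOn

theorem norm_sq (h : SolvesOn q z a b u u') :
    IsPrimitiveOn (fun x => ‖u x‖ ^ 2) (fun x => 2 * (conj (u x) * u' x).re) a b := by
  refine ((h.isPrimitiveOn.star.mul h.isPrimitiveOn).clm_comp Complex.reCLM).congr
    (fun x _ => ?_) fun x _ => ?_
  · rw [Complex.reCLM_apply, Complex.conj_mul', ← Complex.ofReal_pow, Complex.ofReal_re]
  · simp only [Complex.reCLM_apply, Complex.add_re, Complex.mul_re, Complex.conj_re,
      Complex.conj_im]
    ring

theorem intervalIntegrable_norm_sq_deriv (h : SolvesOn q z a b u u') :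
    IntervalIntegrable (fun t => ‖u' t‖ ^ 2) volume a b :=
  (h.continuousOn_deriv.norm.pow 2).intervalIntegrable

theorem intervalIntegrable_mul_norm_sq (h : SolvesOn q z a b u u')
    (hp : IntervalIntegrable p volume a b) :
    IntervalIntegrable (fun t => p t * ‖u t‖ ^ 2) volume a b :=
  hp.mul_continuousOn (h.continuousOn.norm.pow 2)

theorem norm_sq_le_norm_sq_add (h : SolvesOn q z a b u u') (hab : a ≤ b) (hε : 0 < ε)
    (hs : s ∈ uIcc a b) (ht : t ∈ uIcc a b) :
    ‖u s‖ ^ 2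
      ≤ ‖u t‖ ^ 2 + (ε * (∫ x in a..b, ‖u' x‖ ^ 2) + ε⁻¹ * ∫ x in a..b, ‖u x‖ ^ 2) := by
  have hi := h.intervalIntegrable_norm_sq left_mem_uIcc right_mem_uIcc
  have hi' := h.intervalIntegrable_norm_sq_deriv
  have hpointwise (x : ℝ) :
      ‖2 * (conj (u x) * u' x).re‖ ≤ ε * ‖u' x‖ ^ 2 + ε⁻¹ * ‖u x‖ ^ 2 := by
    have hre := Complex.abs_re_le_norm (conj (u x) * u' x)
    rw [norm_mul, Complex.norm_conj] at hre
    have hsq : ε⁻¹ * (ε * ‖u' x‖ - ‖u x‖) ^ 2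
        = ε * ‖u' x‖ ^ 2 - 2 * (‖u x‖ * ‖u' x‖) + ε⁻¹ * ‖u x‖ ^ 2 := by
      field_simp
      ring
    have : 0 ≤ ε⁻¹ * (ε * ‖u' x‖ - ‖u x‖) ^ 2 := by positivity
    rw [norm_mul, Real.norm_eq_abs, Real.norm_eq_abs, Nat.abs_ofNat]
    linarith
  rw [← sub_le_iff_le_add']
  calc ‖u s‖ ^ 2 - ‖u t‖ ^ 2 = ∫ x in t..s, 2 * (conj (u x) * u' x).re :=
        (h.norm_sq.integral_eq_sub ht hs).symm
    _ ≤ |∫ x in t..s, ε * ‖u' x‖ ^ 2 + ε⁻¹ * ‖u x‖ ^ 2| :=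
        (Real.le_norm_self _).trans (intervalIntegral.norm_integral_le_abs_of_norm_le
          (Eventually.of_forall hpointwise)
          (((hi'.const_mul ε).add (hi.const_mul ε⁻¹)).mono_set (uIcc_subset_uIcc ht hs)))
    _ ≤ |∫ x in a..b, ε * ‖u' x‖ ^ 2 + ε⁻¹ * ‖u x‖ ^ 2| :=
        intervalIntegral.abs_integral_mono_interval (uIoc_subset_uIoc_of_uIcc_subset_uIcc
          (uIcc_subset_uIcc ht hs)) (Eventually.of_forall fun x => by positivity)
          ((hi'.const_mul ε).add (hi.const_mul ε⁻¹))
    _ = ε * (∫ x in a..b, ‖u' x‖ ^ 2) + ε⁻¹ * ∫ x in a..b, ‖u x‖ ^ 2 := by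
        rw [abs_of_nonneg (intervalIntegral.integral_nonneg hab fun x _ => by positivity),
          intervalIntegral.integral_add (hi'.const_mul ε) (hi.const_mul ε⁻¹),
          intervalIntegral.integral_const_mul, intervalIntegral.integral_const_mul]

theorem norm_sq_le_of_unit_interval (h : SolvesOn q z x (x + 1) u u') (hε : 0 < ε)
    (hs : s ∈ Icc x (x + 1)) :
    ‖u s‖ ^ 2 ≤ ε * (∫ t in x..(x + 1), ‖u' t‖ ^ 2)
      + (1 + ε⁻¹) * ∫ t in x..(x + 1), ‖u t‖ ^ 2 := by
  have hx : x ≤ x + 1 := (lt_add_one x).le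
  have hi := h.intervalIntegrable_norm_sq left_mem_uIcc right_mem_uIcc
  have hmean := intervalIntegral.integral_mono_on hx intervalIntegrable_const
    (hi.add intervalIntegrable_const) fun t ht =>
      h.norm_sq_le_norm_sq_add hx hε (Icc_subset_uIcc hs) (Icc_subset_uIcc ht)
  rw [intervalIntegral.integral_const, intervalIntegral.integral_add hi intervalIntegrable_const,
    intervalIntegral.integral_const, add_sub_cancel_left, one_smul, one_smul] at hmean
  linarith

theorem integral_mul_norm_sq_le_of_unit_interval (h : SolvesOn q z x (x + 1) u u')
    (hp : IntervalIntegrable p volume x (x + 1)) (hp0 : ∀ t, 0 ≤ p t) (hM : 0 < M)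
    (hpM : ∫ y in x..(x + 1), p y ≤ M) :
    ∫ t in x..(x + 1), p t * ‖u t‖ ^ 2 ≤ 1 / 2 * (∫ t in x..(x + 1), ‖u' t‖ ^ 2)
      + M * (1 + 2 * M) * ∫ t in x..(x + 1), ‖u t‖ ^ 2 := by
  have hx : x ≤ x + 1 := (lt_add_one x).le
  set A := ∫ t in x..(x + 1), ‖u' t‖ ^ 2
  set B := ∫ t in x..(x + 1), ‖u t‖ ^ 2
  have hA : 0 ≤ A := intervalIntegral.integral_nonneg hx fun _ _ => by positivity
  have hB : 0 ≤ B := intervalIntegral.integral_nonneg hx fun _ _ => by positivity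
  have hsup : ∀ t ∈ Icc x (x + 1), ‖u t‖ ^ 2 ≤ (2 * M)⁻¹ * A + (1 + 2 * M) * B := fun t ht => by
    simpa only [inv_inv] using h.norm_sq_le_of_unit_interval (ε := (2 * M)⁻¹) (by positivity) ht
  calc ∫ t in x..(x + 1), p t * ‖u t‖ ^ 2
      ≤ ∫ t in x..(x + 1), p t * ((2 * M)⁻¹ * A + (1 + 2 * M) * B) :=
        intervalIntegral.integral_mono_on hx (h.intervalIntegrable_mul_norm_sq hp)
          (hp.mul_const _) fun t ht => mul_le_mul_of_nonneg_left (hsup t ht) (hp0 t)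
    _ = (∫ t in x..(x + 1), p t) * ((2 * M)⁻¹ * A + (1 + 2 * M) * B) :=
        intervalIntegral.integral_mul_const _ _
    _ ≤ M * ((2 * M)⁻¹ * A + (1 + 2 * M) * B) := by gcongr
    _ = 1 / 2 * A + M * (1 + 2 * M) * B := by
        field_simp

theorem integral_mul_norm_sq_le (n : ℕ) (h : SolvesOn q z x (x + n) u u')
    (hp : IntervalIntegrable p volume x (x + n)) (hp0 : ∀ t, 0 ≤ p t) (hM : 0 < M)
    (hpM : ∀ y, x ≤ y → ∫ t in y..(y + 1), p t ≤ M) :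
    ∫ t in x..(x + n), p t * ‖u t‖ ^ 2 ≤ 1 / 2 * (∫ t in x..(x + n), ‖u' t‖ ^ 2)
      + M * (1 + 2 * M) * ∫ t in x..(x + n), ‖u t‖ ^ 2 := by
  induction n with
  | zero => simp
  | succ n ih =>
    have hmem : x + n ∈ uIcc x (x + (n + 1 : ℕ)) := by
      push_cast
      exact Icc_subset_uIcc ⟨le_add_of_nonneg_right n.cast_nonneg, by linarith⟩
    have hleft := h.mono left_mem_uIcc hmem
    have hright := h.mono hmem right_mem_uIcc
    have hpl := hp.mono_set (uIcc_subset_uIcc left_mem_uIcc hmem)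
    have hpr := hp.mono_set (uIcc_subset_uIcc hmem right_mem_uIcc)
    rw [← intervalIntegral.integral_add_adjacent_intervals
        (hleft.intervalIntegrable_mul_norm_sq hpl) (hright.intervalIntegrable_mul_norm_sq hpr),
      ← intervalIntegral.integral_add_adjacent_intervals
        hleft.intervalIntegrable_norm_sq_deriv hright.intervalIntegrable_norm_sq_deriv,
      ← intervalIntegral.integral_add_adjacent_intervals
        (h.intervalIntegrable_norm_sq left_mem_uIcc hmem)
        (h.intervalIntegrable_norm_sq hmem right_mem_uIcc)]
    push_cast [← add_assoc] at hright hpr ⊢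
    have hstep := hright.integral_mul_norm_sq_le_of_unit_interval hpr hp0 hM
      (hpM _ (le_add_of_nonneg_right n.cast_nonneg))
    linarith [ih hleft hpl]

theorem half_integral_norm_sq_deriv_le (n : ℕ) (h : SolvesOn q z x (x + n) u u')
    (hq : IntervalIntegrable q volume x (x + n)) (hM : 0 < M)
    (hqM : ∀ y, x ≤ y → ∫ t in y..(y + 1), max (-q t) 0 ≤ M) :
    1 / 2 * (∫ t in x..(x + n), ‖u' t‖ ^ 2)
      ≤ (conj (u (x + n)) * u' (x + n)).re - (conj (u x) * u' x).re
        + (M * (1 + 2 * M) + |z.re|) * ∫ t in x..(x + n), ‖u t‖ ^ 2 := by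
  have hneg : IntervalIntegrable (fun t => max (-q t) 0) volume x (x + n) :=
    ⟨hq.1.neg.pos_part, hq.2.neg.pos_part⟩
  have hi := h.intervalIntegrable_norm_sq left_mem_uIcc right_mem_uIcc
  have hi' := h.intervalIntegrable_norm_sq_deriv
  have hineg := h.intervalIntegrable_mul_norm_sq hneg
  have hgreen : (∫ t in x..(x + n), ‖u' t‖ ^ 2) - (∫ t in x..(x + n), max (-q t) 0 * ‖u t‖ ^ 2)
      - |z.re| * (∫ t in x..(x + n), ‖u t‖ ^ 2)
      ≤ (conj (u (x + n)) * u' (x + n)).re - (conj (u x) * u' x).re := by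
    rw [← h.green_re.integral_eq_sub left_mem_uIcc right_mem_uIcc,
      ← intervalIntegral.integral_const_mul, ← intervalIntegral.integral_sub hi' hineg,
      ← intervalIntegral.integral_sub (hi'.sub hineg) (hi.const_mul _)]
    refine intervalIntegral.integral_mono_on (le_add_of_nonneg_right n.cast_nonneg)
      ((hi'.sub hineg).sub (hi.const_mul _)) h.green_re.intervalIntegrable fun t _ => ?_
    have hcoeff : -max (-q t) 0 - |z.re| ≤ q t - z.re := by
      linarith [le_max_left (-q t) 0, le_abs_self z.re]
    linarith [mul_le_mul_of_nonneg_right hcoeff (sq_nonneg ‖u t‖)]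
  have hle := h.integral_mul_norm_sq_le n hneg (fun t => le_max_right _ _) hM hqM
  linarith

end SolvesOn

theorem not_integrableOn_Ioi_of_eventually_one_le {g : ℝ → ℝ}
    (hg : ∀ᶠ x in atTop, 1 ≤ g x) (a : ℝ) : ¬ IntegrableOn g (Ioi a) := by
  intro h
  obtain ⟨y, hy⟩ := eventually_atTop.1 hg
  have hone : IntegrableOn (fun _ : ℝ => (1 : ℝ)) (Ioi (max a y)) := by
    refine (h.mono_set (Ioi_subset_Ioi (le_max_left a y))).mono' aestronglyMeasurable_const ?_
    filter_upwards [self_mem_ae_restrict measurableSet_Ioi] with x hx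
    simpa using hy x ((le_max_right a y).trans (mem_Ioi.1 hx).le)
  simp [integrableOn_const_iff] at hone

namespace IsL2Solution

theorem frequently_re_le (h : IsL2Solution q z u u') :
    ∃ᶠ y in atTop, (conj (u y) * u' y).re ≤ 1 := by
  intro hcon
  obtain ⟨y, hy⟩ := eventually_atTop.1 (hcon.and (eventually_ge_atTop 0))
  have hy0 : 0 ≤ y := (hy y le_rfl).2
  refine not_integrableOn_Ioi_of_eventually_one_le ?_ 0 h.integrableOn_norm_sq
  filter_upwards [eventually_ge_atTop (y + 1)] with x hx
  have hyx : y ≤ x := by linarith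
  have hprim := (solvesOn_of_halfLine h.solvesOn hy0 (hy0.trans hyx)).norm_sq
  have hgrowth : ∫ _ in y..x, (1 : ℝ) ≤ ‖u x‖ ^ 2 - ‖u y‖ ^ 2 := by
    rw [← hprim.integral_eq_sub left_mem_uIcc right_mem_uIcc]
    exact intervalIntegral.integral_mono_on hyx intervalIntegrable_const
      hprim.intervalIntegrable fun t ht => by linarith [(hy t ht.1).1]
  rw [intervalIntegral.integral_const, smul_eq_mul, mul_one] at hgrowth
  linarith [sq_nonneg ‖u y‖]

theorem integral_norm_sq_le (h : IsL2Solution q z u u') (ha : 0 ≤ a) (hab : a ≤ b) :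
    ∫ t in a..b, ‖u t‖ ^ 2 ≤ ∫ t in Ioi 0, ‖u t‖ ^ 2 := by
  rw [intervalIntegral.integral_of_le hab]
  exact setIntegral_mono_set h.integrableOn_norm_sq (Eventually.of_forall fun _ => by positivity)
    (Eventually.of_forall fun t ht => ha.trans_lt ht.1)

end IsL2Solution

theorem LocallyIntegrableHalfLine.intervalIntegrable (hq : LocallyIntegrableHalfLine q)
    (ha : 0 ≤ a) (hb : 0 ≤ b) : IntervalIntegrable q volume a b := by
  have h0 {c : ℝ} (hc : 0 ≤ c) : IntervalIntegrable q volume 0 c :=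
    (intervalIntegrable_iff_integrableOn_Ioo_of_le hc).2 (hq.integrableOn c)
  exact (h0 ha).symm.trans (h0 hb)

namespace EssentiallyBoundedBelow

theorem exists_half_integral_norm_sq_deriv_le (hb : EssentiallyBoundedBelow q)
    (hq : LocallyIntegrableHalfLine q) (h : IsL2Solution q z u u') :
    ∃ C, ∀ y, 1 ≤ y → 1 / 2 * (∫ t in 0..y, ‖u' t‖ ^ 2) ≤ (conj (u y) * u' y).re + C := by
  obtain ⟨M', hM'⟩ := hb
  set M := max M' 1
  have hM : 0 < M := lt_max_of_lt_right one_pos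
  obtain ⟨C, hC⟩ := isCompact_uIcc.exists_bound_of_continuousOn
    (h.solvesOn 1 zero_le_one).green_re.continuousOn
  set S := ∫ t in Ioi 0, ‖u t‖ ^ 2
  refine ⟨1 / 2 * (∫ t in 0..1, ‖u' t‖ ^ 2) + C + (M * (1 + 2 * M) + |z.re|) * S, fun y hy => ?_⟩
  obtain ⟨n, x, hx0, hx1, rfl⟩ : ∃ (n : ℕ) (x : ℝ), 0 < x ∧ x ≤ 1 ∧ x + n = y := by
    obtain ⟨n, hn⟩ := Nat.exists_eq_add_of_le' (Nat.ceil_pos.2 (one_pos.trans_le hy))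
    obtain ⟨hlt, hle⟩ := (Nat.ceil_eq_iff n.succ_ne_zero).1 hn
    push_cast [Nat.add_sub_cancel] at hlt hle
    exact ⟨n, y - n, sub_pos.2 hlt, by linarith, sub_add_cancel y _⟩
  have hxn : x ≤ x + n := le_add_of_nonneg_right n.cast_nonneg
  have hsol := solvesOn_of_halfLine h.solvesOn hx0.le (hx0.le.trans hxn)
  have htail := hsol.half_integral_norm_sq_deriv_le n
    (hq.intervalIntegrable hx0.le (hx0.le.trans hxn)) hM fun w hw =>
      (hM' w (hx0.trans_le hw)).trans (le_max_left _ _)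
  have hhead : ∫ t in 0..x, ‖u' t‖ ^ 2 ≤ ∫ t in 0..1, ‖u' t‖ ^ 2 :=
    intervalIntegral.integral_mono_interval le_rfl hx0.le hx1
      (Eventually.of_forall fun _ => by positivity)
      (h.solvesOn 1 zero_le_one).intervalIntegrable_norm_sq_deriv
  have hCx := (neg_le_abs _).trans (hC x (Icc_subset_uIcc ⟨hx0.le, hx1⟩))
  have hS := mul_le_mul_of_nonneg_left (h.integral_norm_sq_le hx0.le hxn)
    (show 0 ≤ M * (1 + 2 * M) + |z.re| by positivity)
  rw [← intervalIntegral.integral_add_adjacent_intervals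
    (h.solvesOn x hx0.le).intervalIntegrable_norm_sq_deriv hsol.intervalIntegrable_norm_sq_deriv]
  linarith

theorem integrableOn_norm_sq_deriv (hb : EssentiallyBoundedBelow q)
    (hq : LocallyIntegrableHalfLine q) (h : IsL2Solution q z u u') :
    IntegrableOn (fun x => ‖u' x‖ ^ 2) (Ioi 0) := by
  obtain ⟨C, hC⟩ := hb.exists_half_integral_norm_sq_deriv_le hq h
  refine integrableOn_norm_sq_of_frequently_integral_le (B := 2 * (1 + C))
    (continuousOn_deriv_halfLine h.solvesOn)
    ((h.frequently_re_le.and_eventually (eventually_ge_atTop 1)).mono fun y hy => ?_)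
  linarith [hC y hy.2, hy.1]

theorem wronskian_eq_zero (hb : EssentiallyBoundedBelow q) (hq : LocallyIntegrableHalfLine q)
    (hu : IsL2Solution q z u u') (hv : IsL2Solution q z v v') :
    u 0 * v' 0 - u' 0 * v 0 = 0 := by
  have hleft : IntegrableOn (fun x => u x * v' x) (Ioi 0) :=
    integrable_mul_of_integrable_norm_sq hu.aestronglyMeasurable hv.aestronglyMeasurable_deriv
      hu.integrableOn_norm_sq (hb.integrableOn_norm_sq_deriv hq hv)
  have hright : IntegrableOn (fun x => u' x * v x) (Ioi 0) :=
    integrable_mul_of_integrable_norm_sq hu.aestronglyMeasurable_deriv hv.aestronglyMeasurable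
      (hb.integrableOn_norm_sq_deriv hq hu) hv.integrableOn_norm_sq
  have hconst : IntegrableOn (fun _ : ℝ => u 0 * v' 0 - u' 0 * v 0) (Ioi 0) := by
    refine (hleft.sub hright).congr ?_
    filter_upwards [self_mem_ae_restrict measurableSet_Ioi] with x hx
    exact (hu.solvesOn x (le_of_lt hx)).wronskian_eq (hv.solvesOn x (le_of_lt hx)) right_mem_uIcc
  simpa [integrableOn_const_iff] using hconst

end EssentiallyBoundedBelow

end EssentiallyBoundedBelow

theorem exists_isWeylGenerator_squareIntegrable {q : ℝ → ℝ} {z : ℂ}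
    (he : Endpoint.squareIntegrable.Admissible q) (hz : z.im ≠ 0) :
    ∃ ψ ψ', IsWeylGenerator q .squareIntegrable z ψ ψ' := by
  obtain ⟨hq, hq'⟩ := he
  obtain ⟨ψ, ψ', hψ, hψ0, him⟩ := exists_isL2Solution hq hz
  refine ⟨ψ, ψ', ⟨isSolution_halfLine hψ.solvesOn, ⟨0, self_mem_Ici, by simp [hψ0]⟩,
    hψ.isL2AtInfinity⟩, him, fun v v' hv => ?_⟩
  have hvL2 := IsL2AtInfinity.isL2Solution hv.2.2 (hv.1.solvesOn_halfLine hq)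
  rcases hq' with hb | hp
  · exact hb.wronskian_eq_zero hq hψ hvL2
  · exact hp.wronskian_eq_zero hz hψ hvL2

/-! ### The limit circle case -/

section LimitCircle

variable {q : ℝ → ℝ} {z z₁ z₂ : ℂ} {u u' v v' u₀ u₀' : ℝ → ℂ}

theorem IsLimitCircle.isL2Solution (hc : IsLimitCircle q) (hz : z.im ≠ 0)
    (h : ∀ c, 0 ≤ c → SolvesOn q z 0 c u u') : IsL2Solution q z u u' := by
  rcases lt_or_gt_of_ne hz with hz | hz
  · have hstar : ∀ c, 0 ≤ c → SolvesOn q (conj z) 0 c _ _ := fun c hc => (h c hc).star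
    simpa using (IsL2AtInfinity.isL2Solution
      (hc (conj z) (by simpa using hz) _ _ (isSolution_halfLine hstar)) hstar).star
  · exact (hc z hz u u' (isSolution_halfLine h)).isL2Solution h

theorem IsLimitCircle.tendsto_wronskian (hc : IsLimitCircle q) (hq : LocallyIntegrableHalfLine q)
    (h₀ : IsL2Solution q Complex.I u₀ u₀') (hne : u₀ 0 ≠ 0 ∨ u₀' 0 ≠ 0)
    (hu : IsL2Solution q z₁ u u') (hv : IsL2Solution q z₂ v v')
    (hWu : Tendsto (fun x => u₀ x * u' x - u₀' x * u x) atTop (𝓝 0))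
    (hWv : Tendsto (fun x => u₀ x * v' x - u₀' x * v x) atTop (𝓝 0)) :
    Tendsto (fun x => u x * v' x - u' x * v x) atTop (𝓝 0) := by
  obtain ⟨w, w', hw0, hw0', hw⟩ :=
    exists_solvesOn_halfLine hq Complex.I (-conj (u₀' 0)) (conj (u₀ 0))
  have hwL2 := hc.isL2Solution (by simp) hw
  obtain ⟨l, hl⟩ := hv.exists_tendsto_wronskian hwL2
  obtain ⟨m, hm⟩ := hwL2.exists_tendsto_wronskian hu
  set K := u₀ 0 * w' 0 - u₀' 0 * w 0 with hK
  have hK0 : K ≠ 0 := by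
    rw [hK, hw0, hw0', mul_neg, sub_neg_eq_add, Complex.mul_conj', Complex.mul_conj']
    norm_cast
    rcases hne with h | h
    · have := norm_pos_iff.2 h
      positivity
    · have := norm_pos_iff.2 h
      positivity
  have hlim := ((hWu.mul hl).add (hWv.mul hm)).const_mul (-K⁻¹)
  simp only [zero_mul, add_zero, mul_zero] at hlim
  refine hlim.congr' ?_
  filter_upwards [eventually_ge_atTop 0] with x hx
  have hKx := (h₀.solvesOn x hx).wronskian_eq (hw x hx) right_mem_uIcc
  rw [← hK] at hKx
  have hplucker : (u₀ x * u' x - u₀' x * u x) * (v x * w' x - v' x * w x)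
      + (u₀ x * v' x - u₀' x * v x) * (w x * u' x - w' x * u x)
      = -K * (u x * v' x - u' x * v x) := by
    rw [← hKx]
    ring
  rw [hplucker]
  field_simp

theorem IsL2Solution.tendsto_wronskian_star
    (hsa : Tendsto (fun x => (conj (u₀ x) * u₀' x).im) atTop (𝓝 0)) (hu : IsL2Solution q z u u')
    (hW : Tendsto (fun x => u₀ x * u' x - u₀' x * u x) atTop (𝓝 0)) :
    Tendsto (fun x => u₀ x * conj (u' x) - u₀' x * conj (u x)) atTop (𝓝 0) := by
  obtain ⟨l, hl⟩ := hu.exists_tendsto_wronskian hu.star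
  have hW₀ : Tendsto (fun x => u₀ x * conj (u₀' x) - u₀' x * conj (u₀ x)) atTop (𝓝 0) := by
    have him := ((Complex.continuous_ofReal.tendsto 0).comp hsa).const_mul (-2 * Complex.I)
    rw [Complex.ofReal_zero, mul_zero] at him
    refine him.congr fun x => ?_
    apply Complex.ext <;> simp <;> ring
  have hWconj := (Complex.continuous_conj.tendsto 0).comp hW
  have hsqrt := ((hW₀.mul hl).sub (hW.mul hWconj)).norm.sqrt
  simp only [map_zero, zero_mul, mul_zero, sub_zero, norm_zero, Real.sqrt_zero] at hsqrt
  rw [tendsto_zero_iff_norm_tendsto_zero]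
  refine hsqrt.congr fun x => ?_
  have hplucker :
      (u₀ x * conj (u₀' x) - u₀' x * conj (u₀ x)) * (u x * conj (u' x) - u' x * conj (u x))
        - (u₀ x * u' x - u₀' x * u x) * conj (u₀ x * u' x - u₀' x * u x)
      = -((u₀ x * conj (u' x) - u₀' x * conj (u x))
        * conj (u₀ x * conj (u' x) - u₀' x * conj (u x))) := by
    simp only [map_sub, map_mul, Complex.conj_conj]
    ring
  rw [Function.comp_apply, hplucker, norm_neg, norm_mul, Complex.norm_conj,
    Real.sqrt_mul_self (norm_nonneg _)]

theorem IsLimitCircle.exists_isL2Solution_tendsto_wronskian (hc : IsLimitCircle q)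
    (hq : LocallyIntegrableHalfLine q) (hz : z.im ≠ 0) (h₀ : IsL2Solution q Complex.I u₀ u₀') :
    ∃ ψ ψ', IsL2Solution q z ψ ψ' ∧ (ψ 0 ≠ 0 ∨ ψ' 0 ≠ 0) ∧
      Tendsto (fun x => u₀ x * ψ' x - u₀' x * ψ x) atTop (𝓝 0) := by
  obtain ⟨θ, θ', hθ0, hθ0', hθ⟩ := exists_solvesOn_halfLine hq z 1 0
  obtain ⟨φ, φ', hφ0, hφ0', hφ⟩ := exists_solvesOn_halfLine hq z 0 1
  obtain ⟨A, hA⟩ := h₀.exists_tendsto_wronskian (hc.isL2Solution hz hθ)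
  obtain ⟨B, hB⟩ := h₀.exists_tendsto_wronskian (hc.isL2Solution hz hφ)
  obtain ⟨α, β, hαβ, hlin⟩ : ∃ α β : ℂ, (α ≠ 0 ∨ β ≠ 0) ∧ α * A + β * B = 0 := by
    by_cases hA0 : A = 0
    · exact ⟨1, 0, by simp, by simp [hA0]⟩
    · exact ⟨B, -A, Or.inr (neg_ne_zero.2 hA0), by ring⟩
  refine ⟨_, _, hc.isL2Solution hz fun c hc => ((hθ c hc).const_mul α).add ((hφ c hc).const_mul β),
    by simpa [hθ0, hθ0', hφ0, hφ0'] using hαβ, ?_⟩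
  have hlim := (hA.const_mul α).add (hB.const_mul β)
  rw [hlin] at hlim
  exact hlim.congr fun x => by ring

theorem im_nonneg_of_tendsto_wronskian_star (h : ∀ c, 0 ≤ c → SolvesOn q z 0 c u u')
    (hW : Tendsto (fun x => conj (u x) * u' x - conj (u' x) * u x) atTop (𝓝 0)) {x : ℝ}
    (hx : 0 ≤ x) : 0 ≤ (conj (u x) * u' x).im * z.im := by
  have him : Tendsto (fun y => (conj (u y) * u' y).im * z.im) atTop (𝓝 0) := by
    have hlim := ((Complex.continuous_im.tendsto 0).comp hW).mul_const (z.im / 2)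
    rw [Complex.zero_im, zero_mul] at hlim
    refine hlim.congr fun y => ?_
    simp only [Function.comp_apply, Complex.sub_im, Complex.mul_im, Complex.conj_re,
      Complex.conj_im]
    ring
  refine le_of_tendsto him ?_
  filter_upwards [eventually_ge_atTop x] with y hy
  exact (h y (hx.trans hy)).im_mul_im_anti (Icc_subset_uIcc ⟨hx, hy⟩) right_mem_uIcc hy

theorem exists_isWeylGenerator_limitCircle (he : (Endpoint.limitCircle u₀ u₀').Admissible q)
    (hz : z.im ≠ 0) : ∃ ψ ψ', IsWeylGenerator q (.limitCircle u₀ u₀') z ψ ψ' := by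
  obtain ⟨hq, hc, hs₀, hn₀, hsa⟩ := id he
  have hne := Endpoint.initial_ne_zero he hs₀ hn₀
  have h₀ : IsL2Solution q Complex.I u₀ u₀' :=
    hc.isL2Solution (by simp) (hs₀.solvesOn_halfLine hq)
  obtain ⟨ψ, ψ', hψ, hψ0, hψlim⟩ := hc.exists_isL2Solution_tendsto_wronskian hq hz h₀
  have hsol := isSolution_halfLine hψ.solvesOn
  refine ⟨ψ, ψ', ⟨hsol, hsol.isNonzeroOn (uniqueDiffOn_Ici 0) self_mem_Ici hψ0, hψlim⟩,
    fun x hx => ?_, fun v v' hv => ?_⟩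
  · exact im_nonneg_of_tendsto_wronskian_star hψ.solvesOn (hc.tendsto_wronskian hq h₀ hne hψ.star hψ
      (hψ.tendsto_wronskian_star hsa hψlim) hψlim) hx
  · have hvsol := hv.1.solvesOn_halfLine hq
    have hW := hc.tendsto_wronskian hq h₀ hne hψ (hc.isL2Solution hz hvsol) hψlim hv.2.2
    refine tendsto_nhds_unique (tendsto_const_nhds.congr' ?_) hW
    filter_upwards [eventually_ge_atTop 0] with x hx
    exact ((hψ.solvesOn x hx).wronskian_eq (hvsol x hx) right_mem_uIcc).symm

end LimitCircle

theorem exists_isWeylGenerator {q : ℝ → ℝ} {e : Endpoint} {z : ℂ} (he : e.Admissible q)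
    (hz : z.im ≠ 0) : ∃ ψ ψ', IsWeylGenerator q e z ψ ψ' := by
  cases e with
  | regular b h => exact exists_isWeylGenerator_regular he z
  | squareIntegrable => exact exists_isWeylGenerator_squareIntegrable he hz
  | limitCircle u₀ u₀' => exact exists_isWeylGenerator_limitCircle he hz

/-! ### Local `L¹` norms -/

section LocalL1

variable {q : ℝ → ℝ} {a δ η k x : ℝ}

theorem integral_abs_le_of_localL1Sup_le (hδ : 0 ≤ δ) (hq : IntervalIntegrable q volume 0 (a + δ))
    (h : localL1Sup a δ q ≤ η) (hx : x ∈ Icc 0 a) : ∫ y in x..(x + δ), |q y| ≤ η := by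
  refine h.trans' (le_csSup ⟨∫ y in 0..(a + δ), |q y|, ?_⟩ ⟨x, hx, rfl⟩)
  rintro _ ⟨y, hy, rfl⟩
  exact intervalIntegral.integral_mono_interval hy.1 (by linarith) (by linarith [hy.2])
    (Eventually.of_forall fun _ => abs_nonneg _) hq.abs

theorem integral_abs_le (ha : 0 ≤ a) (hδ : 0 < δ) (hq : IntervalIntegrable q volume 0 (a + δ))
    (hη : ∀ x ∈ Icc 0 a, ∫ y in x..(x + δ), |q y| ≤ η) :
    ∫ y in 0..(a + δ), |q y| ≤ (a / δ + 2) * η := by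
  have hη0 : 0 ≤ η := (intervalIntegral.integral_nonneg (le_add_of_nonneg_right hδ.le)
    fun _ _ => abs_nonneg _).trans (hη a ⟨ha, le_rfl⟩)
  have hmono {c d : ℝ} (hc : c ∈ Icc 0 (a + δ)) (hd : d ∈ Icc 0 (a + δ)) :
      IntervalIntegrable (fun y => |q y|) volume c d :=
    (hq.mono_set (uIcc_subset_uIcc (Icc_subset_uIcc hc) (Icc_subset_uIcc hd))).abs
  set p : ℕ → ℝ := fun n => min (n * δ) a with hp
  have hpmem (n : ℕ) : p n ∈ Icc 0 a := ⟨le_min (by positivity) ha, min_le_right _ _⟩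
  have hpmem' (n : ℕ) : p n ∈ Icc 0 (a + δ) := Icc_subset_Icc_right (by linarith) (hpmem n)
  have hstep (n : ℕ) : ∫ y in p n..p (n + 1), |q y| ≤ η := by
    refine (intervalIntegral.integral_mono_interval le_rfl (min_le_min_right a ?_) ?_
      (Eventually.of_forall fun _ => abs_nonneg _) (hmono (hpmem' n) ?_)).trans (hη _ (hpmem n))
    · gcongr
      exact n.le_succ
    · rw [← min_add_add_right]
      exact min_le_min (by push_cast; linarith) (by linarith)
    · exact ⟨by linarith [(hpmem n).1], by linarith [(hpmem n).2]⟩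
  have hhead : ∫ y in 0..a, |q y| ≤ (a / δ + 1) * η := by
    have hlast : p ⌈a / δ⌉₊ = a := min_eq_right ((div_le_iff₀ hδ).1 (Nat.le_ceil _))
    have hsum := intervalIntegral.sum_integral_adjacent_intervals (n := ⌈a / δ⌉₊)
      fun n _ => hmono (hpmem' n) (hpmem' (n + 1))
    rw [hlast, show p 0 = 0 by simp [hp, ha]] at hsum
    calc ∫ y in 0..a, |q y| = _ := hsum.symm
      _ ≤ ⌈a / δ⌉₊ * η := by
        simpa using Finset.sum_le_card_nsmul (Finset.range ⌈a / δ⌉₊) _ η fun n _ => hstep n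
      _ ≤ (a / δ + 1) * η := by
        gcongr
        exact (Nat.ceil_lt_add_one (by positivity)).le
  rw [← intervalIntegral.integral_add_adjacent_intervals (b := a)
    (hmono ⟨le_rfl, by linarith⟩ ⟨ha, by linarith⟩) (hmono ⟨ha, by linarith⟩ ⟨by linarith, le_rfl⟩)]
  linarith [hη a ⟨ha, le_rfl⟩]

/-- The `L¹` norm of `q` on `(x, x + δ)` with the weight `exp (-2 k (y - x))`, which for
`k = Re κ` bounds the deviation of a logarithmic derivative at `x` from `-κ`. -/
def weightedL1 (k δ : ℝ) (q : ℝ → ℝ) (x : ℝ) : ℝ :=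
  ∫ y in 0..δ, Real.exp (-2 * k * y) * |q (x + y)|

theorem weightedL1_le (hk : 0 ≤ k) (hδ : 0 ≤ δ) (hq : IntervalIntegrable q volume x (x + δ)) :
    weightedL1 k δ q x ≤ ∫ y in x..(x + δ), |q y| := by
  have hshift : IntervalIntegrable (fun y => |q (x + y)|) volume 0 δ := by
    simpa using (hq.comp_add_left x).abs
  calc weightedL1 k δ q x ≤ ∫ y in 0..δ, |q (x + y)| :=
        intervalIntegral.integral_mono_on hδ (hshift.continuousOn_mul (by fun_prop)) hshift
          fun y hy => mul_le_of_le_one_left (abs_nonneg _)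
            (Real.exp_le_one_iff.2 (by linarith [mul_nonneg hk hy.1]))
    _ = ∫ y in x..(x + δ), |q y| := by
        rw [intervalIntegral.integral_comp_add_left (fun y => |q y|), add_zero]

section Correlation

variable {f g : ℝ → ℝ}

open scoped Convolution in
theorem integral_mul_comp_add_eq_convolution :
    (fun x => ∫ y, f y * g (x + y))
      = (fun y => f (-y)) ⋆[ContinuousLinearMap.mul ℝ ℝ, volume] g := by
  ext x
  rw [convolution_mul, ← integral_neg_eq_self (fun y => f y * g (x + y))]
  simp only [sub_eq_add_neg]

theorem integrable_integral_mul_comp_add (hf : Integrable f) (hg : Integrable g) :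
    Integrable fun x => ∫ y, f y * g (x + y) := by
  rw [integral_mul_comp_add_eq_convolution]
  exact hf.comp_neg.integrable_convolution _ hg

theorem integral_integral_mul_comp_add (hf : Integrable f) (hg : Integrable g) :
    ∫ x, ∫ y, f y * g (x + y) = (∫ y, f y) * ∫ y, g y := by
  rw [integral_mul_comp_add_eq_convolution, integral_convolution _ hf.comp_neg hg,
    integral_neg_eq_self]
  rfl

end Correlation

theorem weightedL1_eq_integral_indicator (hδ : 0 ≤ δ) (hx : x ∈ Icc 0 a) :
    weightedL1 k δ q x = ∫ y, (Ioc 0 δ).indicator (fun y => Real.exp (-2 * k * y)) y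
      * (Ioc 0 (a + δ)).indicator (fun y => |q y|) (x + y) := by
  rw [weightedL1, intervalIntegral.integral_of_le hδ, ← integral_indicator measurableSet_Ioc]
  congr 1 with y
  by_cases hy : y ∈ Ioc 0 δ
  · have hxy : x + y ∈ Ioc 0 (a + δ) := ⟨by linarith [hx.1, hy.1], by linarith [hx.2, hy.2]⟩
    simp only [indicator_of_mem hy, indicator_of_mem hxy]
  · simp only [indicator_of_notMem hy, zero_mul]

theorem integrable_indicator_exp (k δ : ℝ) :
    Integrable ((Ioc 0 δ).indicator fun y => Real.exp (-2 * k * y)) :=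
  (integrable_indicator_iff measurableSet_Ioc).2
    ((by fun_prop : Continuous fun y => Real.exp (-2 * k * y)).integrableOn_Ioc)

theorem integrable_indicator_abs (ha : 0 ≤ a) (hq : IntervalIntegrable q volume 0 a) :
    Integrable ((Ioc 0 a).indicator fun y => |q y|) :=
  (integrable_indicator_iff measurableSet_Ioc).2
    ((intervalIntegrable_iff_integrableOn_Ioc_of_le ha).1 hq.abs)

theorem intervalIntegrable_weightedL1 (ha : 0 ≤ a) (hδ : 0 ≤ δ)
    (hq : IntervalIntegrable q volume 0 (a + δ)) :
    IntervalIntegrable (weightedL1 k δ q) volume 0 a := by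
  refine ((integrable_integral_mul_comp_add (integrable_indicator_exp k δ)
    (integrable_indicator_abs (add_nonneg ha hδ) hq)).intervalIntegrable).congr fun x hx => ?_
  exact (weightedL1_eq_integral_indicator hδ (Ioc_subset_Icc_self (uIoc_of_le ha ▸ hx))).symm

theorem integral_weightedL1_le (hk : 0 < k) (ha : 0 ≤ a) (hδ : 0 ≤ δ)
    (hq : IntervalIntegrable q volume 0 (a + δ)) :
    ∫ x in 0..a, weightedL1 k δ q x ≤ (2 * k)⁻¹ * ∫ y in 0..(a + δ), |q y| := by
  have haδ : 0 ≤ a + δ := add_nonneg ha hδ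
  have hexp := integrable_indicator_exp k δ
  have habs := integrable_indicator_abs haδ hq
  set E := (Ioc 0 δ).indicator fun y => Real.exp (-2 * k * y) with hE
  set Q := (Ioc 0 (a + δ)).indicator fun y => |q y|
  have hE0 (y : ℝ) : 0 ≤ E y := indicator_nonneg (fun _ _ => by positivity) y
  have hQ0 (y : ℝ) : 0 ≤ Q y := indicator_nonneg (fun _ _ => by positivity) y
  have hEle : ∫ y, E y ≤ (2 * k)⁻¹ := by
    have htail : ∫ y in Ioi 0, Real.exp (-2 * k * y) = (2 * k)⁻¹ := by
      rw [integral_exp_mul_Ioi (by linarith)]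
      simp [neg_div_neg_eq]
    rw [hE, integral_indicator measurableSet_Ioc, ← htail]
    exact setIntegral_mono_set (integrableOn_exp_mul_Ioi (by linarith) 0)
      (Eventually.of_forall fun _ => by positivity) Ioc_subset_Ioi_self.eventuallyLE
  calc ∫ x in 0..a, weightedL1 k δ q x = ∫ x in Ioc 0 a, ∫ y, E y * Q (x + y) := by
        rw [intervalIntegral.integral_of_le ha]
        exact setIntegral_congr_fun measurableSet_Ioc fun x hx =>
          weightedL1_eq_integral_indicator hδ (Ioc_subset_Icc_self hx)
    _ ≤ ∫ x, ∫ y, E y * Q (x + y) :=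
        setIntegral_le_integral (integrable_integral_mul_comp_add hexp habs)
          (Eventually.of_forall fun x => integral_nonneg fun y => mul_nonneg (hE0 y) (hQ0 _))
    _ = (∫ y, E y) * ∫ y in 0..(a + δ), |q y| := by
        rw [integral_integral_mul_comp_add hexp habs, intervalIntegral.integral_of_le haδ,
          ← integral_indicator measurableSet_Ioc]
    _ ≤ (2 * k)⁻¹ * ∫ y in 0..(a + δ), |q y| := by
        gcongr
        exact intervalIntegral.integral_nonneg haδ fun _ _ => abs_nonneg _

end LocalL1

/-! ### Comparison of two Weyl–Titchmarsh functions -/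

section LogDeriv

variable {q : ℝ → ℝ} {z κ : ℂ} {a b c : ℝ} {u u' v v' : ℝ → ℂ} {B : ℝ → ℝ}

namespace SolvesOn

theorem ne_zero_of_initial (hc : 0 ≤ c) (hq : IntegrableOn q (Ioo 0 c))
    (h : SolvesOn q z 0 c u u') (h0 : u 0 ≠ 0 ∨ u' 0 ≠ 0) : u c ≠ 0 ∨ u' c ≠ 0 := by
  by_contra! hzero
  have hW (A B : ℂ) : u 0 * B - u' 0 * A = 0 := by
    obtain ⟨v, v', rfl, rfl, hv⟩ := exists_solvesOn hc hq z A B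
    rw [← h.wronskian_eq hv right_mem_uIcc, hzero.1, hzero.2, zero_mul, zero_mul, sub_zero]
  exact h0.elim (fun h => h (by simpa using hW 0 1)) fun h => h (by simpa using hW 1 0)

theorem eq_mul_cexp_integral_logDeriv (h : SolvesOn q z a b u u')
    (hne : ∀ x ∈ uIcc a b, u x ≠ 0) : u b = u a * Complex.exp (∫ x in a..b, u' x / u x) := by
  have hcont : ContinuousOn (fun x => u' x / u x) (uIcc a b) :=
    h.continuousOn_deriv.div h.continuousOn hne
  have hprim : IsPrimitiveOn (fun x => ∫ t in a..x, u' t / u t) (fun x => u' x / u x) a b :=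
    ⟨hcont.intervalIntegrable, fun x _ => by simp⟩
  have hderiv (x : ℝ) (hx : x ∈ uIcc a b) :
      HasDerivWithinAt (fun x => u x * Complex.exp (-∫ t in a..x, u' t / u t)) 0 (uIcc a b) x := by
    refine ((h.isPrimitiveOn.hasDerivWithinAt h.continuousOn_deriv hx).mul
      (hprim.hasDerivWithinAt hcont hx).neg.cexp).congr_deriv ?_
    have := hne x hx
    field_simp
    ring
  have hconst := (convex_uIcc a b).norm_image_sub_le_of_norm_hasDerivWithin_le hderiv
    (fun _ _ => norm_zero.le) left_mem_uIcc right_mem_uIcc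
  rw [zero_mul, norm_le_zero_iff, intervalIntegral.integral_same, neg_zero, Complex.exp_zero,
    mul_one, sub_eq_zero] at hconst
  rw [← hconst, mul_assoc, ← Complex.exp_add, neg_add_cancel, Complex.exp_zero, mul_one]

theorem norm_div_le_exp (h : SolvesOn q z a b u u') (hab : a ≤ b) (hne : ∀ x ∈ Icc a b, u x ≠ 0)
    (hB : ∀ x ∈ Icc a b, ‖u' x / u x + κ‖ ≤ B x) (hBi : IntervalIntegrable B volume a b) :
    ‖u b / u a‖ ≤ Real.exp ((∫ x in a..b, B x) - (b - a) * κ.re) := by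
  rw [← uIcc_of_le hab] at hne
  have hcont : ContinuousOn (fun x => u' x / u x) (uIcc a b) :=
    h.continuousOn_deriv.div h.continuousOn hne
  rw [h.eq_mul_cexp_integral_logDeriv hne, mul_div_cancel_left₀ _ (hne a left_mem_uIcc),
    Complex.norm_exp]
  refine Real.exp_le_exp.2 ?_
  have hre : (∫ x in a..b, u' x / u x).re = ∫ x in a..b, (u' x / u x).re := by
    simpa using (Complex.reCLM.intervalIntegral_comp_comm hcont.intervalIntegrable).symm
  calc (∫ x in a..b, u' x / u x).re
      ≤ ∫ x in a..b, (B x - κ.re) := by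
        rw [hre]
        refine intervalIntegral.integral_mono_on hab
          (Complex.continuous_re.comp_continuousOn hcont).intervalIntegrable
          (hBi.sub intervalIntegrable_const) fun x hx => ?_
        have hle := (Complex.re_le_norm _).trans (hB x hx)
        rw [Complex.add_re] at hle
        linarith
    _ = (∫ x in a..b, B x) - (b - a) * κ.re := by
        rw [intervalIntegral.integral_sub hBi intervalIntegrable_const,
          intervalIntegral.integral_const, smul_eq_mul]

theorem logDeriv_sub_logDeriv (hu : SolvesOn q z a b u u') (hv : SolvesOn q z a b v v')
    (hua : u a ≠ 0) (hub : u b ≠ 0) (hva : v a ≠ 0) (hvb : v b ≠ 0) :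
    u' a / u a - v' a / v a = (u' b / u b - v' b / v b) * (u b / u a) * (v b / v a) := by
  have hW := hv.wronskian_eq hu right_mem_uIcc
  field_simp
  linear_combination -hW

end SolvesOn

end LogDeriv

section WeylFunctionComparison

variable {q q₁ q₂ : ℝ → ℝ} {e e₁ e₂ : Endpoint} {a δ η k G x : ℝ} {κ : ℂ} {ψ ψ' : ℝ → ℂ}

/-- The assumptions on one of the two potentials: `q` with the boundary condition `e` at `b` is
admissible, `a + δ ≤ b`, and the local `L¹` norms of `q` on `[0, a + δ]` are at most `η`. -/
structure IsLocallyBounded (q : ℝ → ℝ) (e : Endpoint) (a δ η : ℝ) : Prop where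
  admissible : e.Admissible q
  le_right : ((a + δ : ℝ) : EReal) ≤ e.right
  localL1Sup_le : localL1Sup a δ q ≤ η

/-- The parameters `κ` for which the logarithmic derivative of a Weyl solution for `-κ ^ 2` is
controlled by the potential on an interval of length `δ`, on which its `L¹` norm is at most `η`. -/
structure IsLargeParameter (δ η : ℝ) (κ : ℂ) : Prop where
  four_mul_le_re : 4 * η ≤ κ.re
  log_six_le_re : δ⁻¹ * Real.log 6 ≤ κ.re
  im_ne_zero : κ.im ≠ 0

/-- The part of `boundF η δ κ` that does not depend on the potential. -/
def remainderBound (δ : ℝ) (κ : ℂ) : ℝ :=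
  864 / 5 * (‖κ‖ ^ 2 / |κ.im|) * Real.exp (-2 * δ * κ.re)

theorem boundF_eq (η δ : ℝ) (κ : ℂ) : boundF η δ κ = 2 * η + remainderBound δ κ := rfl

theorem boundF_nonneg (hη : 0 ≤ η) : 0 ≤ boundF η δ κ := by
  unfold boundF
  positivity

theorem IsLargeParameter.re_pos (hκ : IsLargeParameter δ η κ) (hδ : 0 < δ) : 0 < κ.re :=
  (mul_pos (inv_pos.2 hδ) (Real.log_pos (by norm_num))).trans_le hκ.log_six_le_re

namespace IsLocallyBounded

theorem mem_interval (hq : IsLocallyBounded q e a δ η) (hx : 0 ≤ x) (hxa : x ≤ a + δ) :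
    x ∈ e.interval :=
  Endpoint.mem_interval_of_le hx ((EReal.coe_le_coe_iff.2 hxa).trans hq.le_right)

theorem intervalIntegrable (hq : IsLocallyBounded q e a δ η) (ha : 0 ≤ a) (hδ : 0 ≤ δ) :
    IntervalIntegrable q volume 0 (a + δ) :=
  (intervalIntegrable_iff_integrableOn_Ioo_of_le (add_nonneg ha hδ)).2
    (Endpoint.integrableOn hq.admissible (hq.mem_interval (add_nonneg ha hδ) le_rfl))

theorem intervalIntegrable_of_mem_Icc (hq : IsLocallyBounded q e a δ η) (hδ : 0 ≤ δ)
    (hx : x ∈ Icc 0 a) : IntervalIntegrable q volume x (x + δ) :=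
  (hq.intervalIntegrable (hx.1.trans hx.2) hδ).mono_set (uIcc_subset_uIcc
    (Icc_subset_uIcc ⟨hx.1, by linarith [hx.2]⟩)
    (Icc_subset_uIcc ⟨by linarith [hx.1], by linarith [hx.2]⟩))

theorem integral_abs_le_of_mem_Icc (hq : IsLocallyBounded q e a δ η) (hδ : 0 ≤ δ)
    (hx : x ∈ Icc 0 a) : ∫ y in x..(x + δ), |q y| ≤ η :=
  integral_abs_le_of_localL1Sup_le hδ (hq.intervalIntegrable (hx.1.trans hx.2) hδ)
    hq.localL1Sup_le hx

theorem nonneg (hq : IsLocallyBounded q e a δ η) (ha : 0 ≤ a) (hδ : 0 ≤ δ) : 0 ≤ η :=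
  (intervalIntegral.integral_nonneg (le_add_of_nonneg_right hδ) fun _ _ => abs_nonneg _).trans
    (hq.integral_abs_le_of_mem_Icc hδ ⟨le_rfl, ha⟩)

theorem weightedL1_le (hq : IsLocallyBounded q e a δ η) (hk : 0 ≤ k) (hδ : 0 ≤ δ)
    (hx : x ∈ Icc 0 a) : weightedL1 k δ q x ≤ η :=
  (Schrodinger.weightedL1_le hk hδ (hq.intervalIntegrable_of_mem_Icc hδ hx)).trans
    (hq.integral_abs_le_of_mem_Icc hδ hx)

theorem integral_two_mul_weightedL1_add_le (hq : IsLocallyBounded q e a δ η) (ha : 0 ≤ a)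
    (hδ : 0 < δ) (hk : 0 < k) (G : ℝ) :
    ∫ x in 0..a, (2 * weightedL1 k δ q x + G)
      ≤ min (a * (2 * η + G)) ((a / δ + 2) * η / k + a * G) := by
  have hqi := hq.intervalIntegrable ha hδ.le
  have hw : IntervalIntegrable (weightedL1 k δ q) volume 0 a :=
    intervalIntegrable_weightedL1 ha hδ.le hqi
  refine le_min ?_ ?_
  · have hle := intervalIntegral.integral_mono_on ha
      ((hw.const_mul 2).add intervalIntegrable_const) intervalIntegrable_const fun x hx =>
      add_le_add_left (mul_le_mul_of_nonneg_left (hq.weightedL1_le hk.le hδ.le hx) zero_le_two) G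
    rwa [intervalIntegral.integral_const, smul_eq_mul, sub_zero] at hle
  · have hle : ∫ x in 0..a, weightedL1 k δ q x ≤ (2 * k)⁻¹ * ((a / δ + 2) * η) := by
      refine (integral_weightedL1_le hk ha hδ.le hqi).trans ?_
      gcongr
      exact integral_abs_le ha hδ hqi fun x hx => hq.integral_abs_le_of_mem_Icc hδ.le hx
    rw [intervalIntegral.integral_add (hw.const_mul 2) intervalIntegrable_const,
      intervalIntegral.integral_const_mul, intervalIntegral.integral_const, smul_eq_mul, sub_zero]
    calc 2 * (∫ x in 0..a, weightedL1 k δ q x) + a * G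
        ≤ 2 * ((2 * k)⁻¹ * ((a / δ + 2) * η)) + a * G := by gcongr
      _ = (a / δ + 2) * η / k + a * G := by field_simp

end IsLocallyBounded

namespace IsWeylGenerator

theorem logDeriv_add_le_weightedL1 (hψ : IsWeylGenerator q e (-κ ^ 2) ψ ψ')
    (hq : IsLocallyBounded q e a δ η) (hκ : IsLargeParameter δ η κ) (hδ : 0 < δ)
    (hx : x ∈ Icc 0 a) :
    ψ x ≠ 0 ∧ ‖ψ' x / ψ x + κ‖ ≤ 2 * weightedL1 κ.re δ q x + remainderBound δ κ := by
  have hxδ : 0 ≤ x + δ := by linarith [hx.1]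
  have hmem : x + δ ∈ e.interval := hq.mem_interval hxδ (by linarith [hx.2])
  have hsol := Endpoint.solvesOn hq.admissible hψ.isWeylSolution.1 hmem
  have hne := hsol.ne_zero_of_initial hxδ (Endpoint.integrableOn hq.admissible hmem)
    (Endpoint.initial_ne_zero hq.admissible hψ.isWeylSolution.1 hψ.isWeylSolution.2.1)
  have hshift : SolvesOn (fun y => q (x + y)) (-κ ^ 2) 0 δ (fun y => ψ (x + y))
      fun y => ψ' (x + y) := by
    refine SolvesOn.comp_add_left x (hsol.mono (Icc_subset_uIcc ?_) right_mem_uIcc)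
    rw [add_zero]
    exact ⟨hx.1, le_add_of_nonneg_right hδ.le⟩
  have hqshift : IntegrableOn (fun y => q (x + y)) (Ioo 0 δ) := by
    rw [← intervalIntegrable_iff_integrableOn_Ioo_of_le hδ.le]
    simpa using (hq.intervalIntegrable_of_mem_Icc hδ.le hx).comp_add_left x
  have hsmall : ∫ y in 0..δ, |q (x + y)| ≤ κ.re / 4 := by
    rw [intervalIntegral.integral_comp_add_left (fun y => |q y|), add_zero]
    linarith [hq.integral_abs_le_of_mem_Icc hδ.le hx, hκ.four_mul_le_re]
  have hlog : Real.log 6 ≤ δ * κ.re := (inv_mul_le_iff₀ hδ).1 hκ.log_six_le_re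
  simpa only [add_zero, weightedL1, remainderBound] using
    logDeriv_add_le hδ hqshift hsmall hlog hκ.im_ne_zero hshift (hψ.im_nonneg _ hmem) hne

theorem logDeriv_add_le_boundF (hψ : IsWeylGenerator q e (-κ ^ 2) ψ ψ')
    (hq : IsLocallyBounded q e a δ η) (hκ : IsLargeParameter δ η κ) (hδ : 0 < δ)
    (hx : x ∈ Icc 0 a) : ‖ψ' x / ψ x + κ‖ ≤ boundF η δ κ := by
  rw [boundF_eq]
  linarith [(hψ.logDeriv_add_le_weightedL1 hq hκ hδ hx).2,
    hq.weightedL1_le (hκ.re_pos hδ).le hδ.le hx]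

theorem solvesOn (hψ : IsWeylGenerator q e (-κ ^ 2) ψ ψ') (hq : IsLocallyBounded q e a δ η)
    (ha : 0 ≤ a) (hδ : 0 ≤ δ) : SolvesOn q (-κ ^ 2) 0 a ψ ψ' :=
  Endpoint.solvesOn hq.admissible hψ.isWeylSolution.1
    (hq.mem_interval ha (le_add_of_nonneg_right hδ))

theorem norm_div_le_exp (hψ : IsWeylGenerator q e (-κ ^ 2) ψ ψ')
    (hq : IsLocallyBounded q e a δ η) (hκ : IsLargeParameter δ η κ) (ha : 0 ≤ a) (hδ : 0 < δ) :
    ‖ψ a / ψ 0‖ ≤ Real.exp (min (a * boundF η δ κ)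
      ((a / δ + 2) * η / κ.re + a * remainderBound δ κ) - a * κ.re) := by
  have hlog (x : ℝ) (hx : x ∈ Icc 0 a) := hψ.logDeriv_add_le_weightedL1 hq hκ hδ hx
  refine ((hψ.solvesOn hq ha hδ.le).norm_div_le_exp ha (fun x hx => (hlog x hx).1)
    (fun x hx => (hlog x hx).2) (((intervalIntegrable_weightedL1 ha hδ.le
      (hq.intervalIntegrable ha hδ.le)).const_mul 2).add intervalIntegrable_const)).trans ?_
  rw [sub_zero]
  gcongr
  exact hq.integral_two_mul_weightedL1_add_le ha hδ (hκ.re_pos hδ) _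

end IsWeylGenerator

theorem exists_isWeylM_norm_sub_le (ha : 0 ≤ a) (hδ : 0 < δ) (h₁ : IsLocallyBounded q₁ e₁ a δ η)
    (h₂ : IsLocallyBounded q₂ e₂ a δ η) (hq : ∀ᵐ x ∂volume.restrict (Icc 0 a), q₁ x = q₂ x)
    (hκ : IsLargeParameter δ η κ) :
    ∃ m₁ m₂ : ℂ, IsWeylM q₁ e₁ (-κ ^ 2) m₁ ∧ IsWeylM q₂ e₂ (-κ ^ 2) m₂ ∧
      ‖m₁ - m₂‖ ≤ 2 * boundF η δ κ * Real.exp (2 * (min (a * boundF η δ κ)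
        ((a / δ + 2) * η / κ.re + a * remainderBound δ κ) - a * κ.re)) := by
  have hz := im_neg_sq_ne_zero (hκ.re_pos hδ) hκ.im_ne_zero
  obtain ⟨ψ₁, ψ₁', hψ₁⟩ := exists_isWeylGenerator h₁.admissible hz
  obtain ⟨ψ₂, ψ₂', hψ₂⟩ := exists_isWeylGenerator h₂.admissible hz
  have hne₁ (x : ℝ) (hx : x ∈ Icc 0 a) := (hψ₁.logDeriv_add_le_weightedL1 h₁ hκ hδ hx).1
  have hne₂ (x : ℝ) (hx : x ∈ Icc 0 a) := (hψ₂.logDeriv_add_le_weightedL1 h₂ hκ hδ hx).1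
  have hmem₀ : (0 : ℝ) ∈ Icc 0 a := ⟨le_rfl, ha⟩
  have hmem : a ∈ Icc 0 a := ⟨ha, le_rfl⟩
  have hsol₁ := (hψ₁.solvesOn h₁ ha hδ.le).congr_potential
    (((ae_restrict_iff' measurableSet_Icc).1 hq).mono fun x hx hxa =>
      hx (Ioc_subset_Icc_self (uIoc_of_le ha ▸ hxa)))
  have hdiff : ‖ψ₁' a / ψ₁ a - ψ₂' a / ψ₂ a‖ ≤ 2 * boundF η δ κ := by
    rw [← add_sub_add_right_eq_sub _ _ κ, two_mul]
    exact (norm_sub_le _ _).trans (add_le_add (hψ₁.logDeriv_add_le_boundF h₁ hκ hδ hmem)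
      (hψ₂.logDeriv_add_le_boundF h₂ hκ hδ hmem))
  refine ⟨_, _, hψ₁.isWeylM h₁.admissible (hne₁ 0 hmem₀),
    hψ₂.isWeylM h₂.admissible (hne₂ 0 hmem₀), ?_⟩
  rw [hsol₁.logDeriv_sub_logDeriv (hψ₂.solvesOn h₂ ha hδ.le) (hne₁ 0 hmem₀) (hne₁ a hmem)
    (hne₂ 0 hmem₀) (hne₂ a hmem), norm_mul, norm_mul, two_mul (_ - _), Real.exp_add, ← mul_assoc]
  have := (norm_nonneg _).trans hdiff
  gcongr
  · exact hψ₁.norm_div_le_exp h₁ hκ ha hδ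
  · exact hψ₂.norm_div_le_exp h₂ hκ ha hδ

end WeylFunctionComparison

/-! ### Asymptotics in sectors -/

section Sector

variable {ε δ : ℝ} {κ : ℂ}

/-- The filter of `κ → ∞` in the sector `-π / 2 + ε < arg κ < -ε` of part (i). -/
def sectorAtInfinity (ε : ℝ) : Filter ℂ :=
  comap norm atTop ⊓ 𝓟 {κ | -(Real.pi / 2) + ε < κ.arg ∧ κ.arg < -ε}

theorem eventually_sectorAtInfinity {p : ℂ → Prop} :
    (∀ᶠ κ in sectorAtInfinity ε, p κ) ↔ ∃ K₀ : ℝ, ∀ κ : ℂ,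
      -(Real.pi / 2) + ε < κ.arg → κ.arg < -ε → K₀ ≤ ‖κ‖ → p κ := by
  simp only [sectorAtInfinity, eventually_inf_principal, eventually_comap, eventually_atTop,
    mem_ofPred_eq]
  exact ⟨fun ⟨K, hK⟩ => ⟨K, fun κ h₁ h₂ hκ => hK _ hκ κ rfl ⟨h₁, h₂⟩⟩,
    fun ⟨K, hK⟩ => ⟨K, fun _ hr κ hκ h => hK κ h.1 h.2 (hκ ▸ hr)⟩⟩

theorem tendsto_norm_sectorAtInfinity : Tendsto norm (sectorAtInfinity ε) atTop :=
  tendsto_comap.mono_left inf_le_left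

theorem exists_eventually_mul_norm_le (hε : 0 < ε) :
    ∃ s > 0, ∀ᶠ κ in sectorAtInfinity ε, s * ‖κ‖ ≤ κ.re ∧ s * ‖κ‖ ≤ |κ.im| := by
  have hpi := Real.pi_gt_three
  have hmin : 0 < min ε 1 := lt_min hε one_pos
  have hmin_le : min ε 1 ≤ 1 := min_le_right ε 1
  refine ⟨Real.sin (min ε 1), Real.sin_pos_of_pos_of_lt_pi hmin (by linarith), ?_⟩
  filter_upwards [mem_inf_of_right (mem_principal_self _)] with κ ⟨hlower, hupper⟩
  replace hlower := (add_le_add_right (min_le_left ε 1) (-(Real.pi / 2))).trans_lt hlower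
  replace hupper := hupper.trans_le (neg_le_neg (min_le_left ε 1))
  constructor
  · rw [← Complex.norm_mul_cos_arg κ, mul_comm, ← Real.cos_pi_div_two_sub, ← Real.cos_neg κ.arg]
    gcongr
    exact Real.cos_le_cos_of_nonneg_of_le_pi (by linarith) (by linarith) (by linarith)
  · refine le_trans ?_ (neg_le_abs _)
    rw [← Complex.norm_mul_sin_arg κ, mul_comm, ← mul_neg, ← Real.sin_neg]
    gcongr
    exact Real.sin_le_sin_of_le_of_le_pi_div_two (by linarith) (by linarith) (by linarith)

theorem tendsto_re_sectorAtInfinity (hε : 0 < ε) :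
    Tendsto Complex.re (sectorAtInfinity ε) atTop := by
  obtain ⟨s, hs, hle⟩ := exists_eventually_mul_norm_le hε
  exact tendsto_atTop_mono' _ (hle.mono fun _ h => h.1)
    (tendsto_norm_sectorAtInfinity.const_mul_atTop hs)

theorem tendsto_abs_im_sectorAtInfinity (hε : 0 < ε) :
    Tendsto (fun κ : ℂ => |κ.im|) (sectorAtInfinity ε) atTop := by
  obtain ⟨s, hs, hle⟩ := exists_eventually_mul_norm_le hε
  exact tendsto_atTop_mono' _ (hle.mono fun _ h => h.2)
    (tendsto_norm_sectorAtInfinity.const_mul_atTop hs)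

theorem remainderBound_le {s : ℝ} (hs : 0 < s) (hδ : 0 < δ) (him : 0 < |κ.im|)
    (hre_le : s * ‖κ‖ ≤ κ.re) (him_le : s * ‖κ‖ ≤ |κ.im|) :
    remainderBound δ κ ≤ 864 / 5 * s⁻¹ * (‖κ‖ * Real.exp (-(2 * δ * s) * ‖κ‖)) := by
  have hquot : ‖κ‖ ^ 2 / |κ.im| ≤ s⁻¹ * ‖κ‖ := by
    rw [div_le_iff₀ him]
    calc ‖κ‖ ^ 2 = s⁻¹ * ‖κ‖ * (s * ‖κ‖) := by field_simp
      _ ≤ s⁻¹ * ‖κ‖ * |κ.im| := by gcongr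
  calc remainderBound δ κ = 864 / 5 * (‖κ‖ ^ 2 / |κ.im|) * Real.exp (-(2 * δ * κ.re)) := by
        rw [remainderBound, neg_mul, neg_mul]
    _ ≤ 864 / 5 * (s⁻¹ * ‖κ‖) * Real.exp (-(2 * δ * (s * ‖κ‖))) := by gcongr
    _ = 864 / 5 * s⁻¹ * (‖κ‖ * Real.exp (-(2 * δ * s) * ‖κ‖)) := by ring_nf

theorem tendsto_remainderBound (hε : 0 < ε) (hδ : 0 < δ) :
    Tendsto (remainderBound δ) (sectorAtInfinity ε) (𝓝 0) := by
  obtain ⟨s, hs, hle⟩ := exists_eventually_mul_norm_le hε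
  have hlim : Tendsto (fun r : ℝ => 864 / 5 * s⁻¹ * (r * Real.exp (-(2 * δ * s) * r))) atTop
      (𝓝 0) := by
    simpa using (tendsto_rpow_mul_exp_neg_mul_atTop_nhds_zero 1 (2 * δ * s)
      (by positivity)).const_mul (864 / 5 * s⁻¹)
  refine squeeze_zero' (Eventually.of_forall fun κ => by unfold remainderBound; positivity) ?_
    (hlim.comp tendsto_norm_sectorAtInfinity)
  filter_upwards [hle, (tendsto_abs_im_sectorAtInfinity hε).eventually_gt_atTop 0]
    with κ ⟨hre_le, him_le⟩ him
  exact remainderBound_le hs hδ him hre_le him_le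

theorem eventually_isLargeParameter (hε : 0 < ε) (δ η : ℝ) :
    ∀ᶠ κ in sectorAtInfinity ε, IsLargeParameter δ η κ := by
  have hre := tendsto_re_sectorAtInfinity hε
  filter_upwards [hre.eventually_ge_atTop (4 * η), hre.eventually_ge_atTop (δ⁻¹ * Real.log 6),
    (tendsto_abs_im_sectorAtInfinity hε).eventually_gt_atTop 0] with κ h₄ hlog him
  exact ⟨h₄, hlog, abs_pos.1 him⟩

end Sector

section MainEstimates

variable {ε δ η a : ℝ} {q₁ q₂ : ℝ → ℝ} {e₁ e₂ : Endpoint} {κ : ℂ}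

theorem eventually_exists_isWeylM_norm_sub_le (hε : 0 < ε) (ha : 0 ≤ a) (hδ : 0 < δ) (η : ℝ) :
    ∀ᶠ κ in sectorAtInfinity ε, ∀ (q₁ q₂ : ℝ → ℝ) (e₁ e₂ : Endpoint),
      IsLocallyBounded q₁ e₁ a δ η → IsLocallyBounded q₂ e₂ a δ η →
      (∀ᵐ x ∂volume.restrict (Icc 0 a), q₁ x = q₂ x) →
      ∃ m₁ m₂ : ℂ, IsWeylM q₁ e₁ (-κ ^ 2) m₁ ∧ IsWeylM q₂ e₂ (-κ ^ 2) m₂ ∧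
        ‖m₁ - m₂‖ ≤ 2 * (2 * η + 1) * Real.exp 4 * Real.exp (-2 * a * κ.re) := by
  have hrem_le := (tendsto_remainderBound hε hδ).eventually_le_const
    (inv_pos.2 (add_pos_of_nonneg_of_pos ha one_pos))
  filter_upwards [eventually_isLargeParameter hε δ η, hrem_le,
    (tendsto_re_sectorAtInfinity hε).eventually_ge_atTop ((a / δ + 2) * η)]
    with κ hκ hrem hre q₁ q₂ e₁ e₂ h₁ h₂ hq
  obtain ⟨m₁, m₂, hm₁, hm₂, hle⟩ := exists_isWeylM_norm_sub_le ha hδ h₁ h₂ hq hκ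
  refine ⟨m₁, m₂, hm₁, hm₂, hle.trans ?_⟩
  have hF : boundF η δ κ ≤ 2 * η + 1 := by
    rw [boundF_eq]
    have := inv_le_one_of_one_le₀ (le_add_of_nonneg_left ha)
    linarith
  have harem : a * remainderBound δ κ ≤ 1 := by
    refine (mul_le_mul_of_nonneg_left hrem ha).trans ?_
    rw [← div_eq_mul_inv, div_le_one (by positivity)]
    linarith
  have hquot : (a / δ + 2) * η / κ.re ≤ 1 := (div_le_one (hκ.re_pos hδ)).2 hre
  have := h₁.nonneg ha hδ.le
  rw [mul_assoc _ (Real.exp 4), ← Real.exp_add]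
  gcongr
  linarith [min_le_right (a * boundF η δ κ) ((a / δ + 2) * η / κ.re + a * remainderBound δ κ)]

theorem exists_isWeylM_norm_sub_le_boundF (ha : 0 ≤ a) (hδ : 0 < δ)
    (h₁ : IsLocallyBounded q₁ e₁ a δ η) (h₂ : IsLocallyBounded q₂ e₂ a δ η)
    (hq : ∀ᵐ x ∂volume.restrict (Icc 0 a), q₁ x = q₂ x) (hκ : IsLargeParameter δ η κ) :
    ∃ m₁ m₂ : ℂ, IsWeylM q₁ e₁ (-κ ^ 2) m₁ ∧ IsWeylM q₂ e₂ (-κ ^ 2) m₂ ∧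
      ‖m₁ - m₂‖ ≤ 2 * boundF η δ κ * Real.exp (-2 * a * (κ.re - boundF η δ κ)) := by
  obtain ⟨m₁, m₂, hm₁, hm₂, hle⟩ := exists_isWeylM_norm_sub_le ha hδ h₁ h₂ hq hκ
  refine ⟨m₁, m₂, hm₁, hm₂, hle.trans ?_⟩
  have := boundF_nonneg (δ := δ) (κ := κ) (h₁.nonneg ha hδ.le)
  refine mul_le_mul_of_nonneg_left (Real.exp_le_exp.2 ?_) (by positivity)
  linarith [min_le_left (a * boundF η δ κ) ((a / δ + 2) * η / κ.re + a * remainderBound δ κ)]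

end MainEstimates

end Schrodinger

end

theorem theorem1p3 :
    -- the constant depends only on `ε`, `δ` and the local `L¹` bound `η`
    (∀ ε δ η : ℝ, 0 < ε → 0 < δ → ∃ C : ℝ, ∀ a : ℝ, 0 ≤ a → ∃ K₀ : ℝ,
      ∀ (q₁ q₂ : ℝ → ℝ) (e₁ e₂ : Schrodinger.Endpoint),
        e₁.Admissible q₁ → e₂.Admissible q₂ →
        ((a + δ : ℝ) : EReal) ≤ e₁.right → ((a + δ : ℝ) : EReal) ≤ e₂.right →
        (∀ᵐ x ∂(volume.restrict (Icc 0 a)), q₁ x = q₂ x) →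
        Schrodinger.localL1Sup a δ q₁ ≤ η → Schrodinger.localL1Sup a δ q₂ ≤ η →
        ∀ κ : ℂ, -(Real.pi / 2) + ε < κ.arg → κ.arg < -ε → K₀ ≤ ‖κ‖ →
          ∃ m₁ m₂ : ℂ, Schrodinger.IsWeylM q₁ e₁ (-κ ^ 2) m₁ ∧
            Schrodinger.IsWeylM q₂ e₂ (-κ ^ 2) m₂ ∧
            ‖m₁ - m₂‖ ≤ C * Real.exp (-2 * a * κ.re)) ∧
    -- the explicit form
    (∀ (a δ η : ℝ) (q₁ q₂ : ℝ → ℝ) (e₁ e₂ : Schrodinger.Endpoint), 0 ≤ a → 0 < δ →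
        e₁.Admissible q₁ → e₂.Admissible q₂ →
        ((a + δ : ℝ) : EReal) ≤ e₁.right → ((a + δ : ℝ) : EReal) ≤ e₂.right →
        (∀ᵐ x ∂(volume.restrict (Icc 0 a)), q₁ x = q₂ x) →
        η = max (Schrodinger.localL1Sup a δ q₁) (Schrodinger.localL1Sup a δ q₂) →
        ∀ κ : ℂ, max (4 * η) (δ⁻¹ * Real.log 6) ≤ κ.re → κ.im ≠ 0 →
          ∃ m₁ m₂ : ℂ, Schrodinger.IsWeylM q₁ e₁ (-κ ^ 2) m₁ ∧
            Schrodinger.IsWeylM q₂ e₂ (-κ ^ 2) m₂ ∧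
            ‖m₁ - m₂‖ ≤ 2 * Schrodinger.boundF η δ κ *
              Real.exp (-2 * a * (κ.re - Schrodinger.boundF η δ κ))) := by
  constructor
  · intro ε δ η hε hδ
    refine ⟨2 * (2 * η + 1) * Real.exp 4, fun a ha => ?_⟩
    obtain ⟨K₀, hK₀⟩ := Schrodinger.eventually_sectorAtInfinity.1
      (Schrodinger.eventually_exists_isWeylM_norm_sub_le hε ha hδ η)
    exact ⟨K₀, fun q₁ q₂ e₁ e₂ he₁ he₂ hr₁ hr₂ hq hη₁ hη₂ κ hlower hupper hκ =>
      hK₀ κ hlower hupper hκ q₁ q₂ e₁ e₂ ⟨he₁, hr₁, hη₁⟩ ⟨he₂, hr₂, hη₂⟩ hq⟩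
  · rintro a δ η q₁ q₂ e₁ e₂ ha hδ he₁ he₂ hr₁ hr₂ hq rfl κ hκ him
    exact Schrodinger.exists_isWeylM_norm_sub_le_boundF ha hδ ⟨he₁, hr₁, le_max_left _ _⟩
      ⟨he₂, hr₂, le_max_right _ _⟩ hq ⟨(le_max_left _ _).trans hκ, (le_max_right _ _).trans hκ, him⟩
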